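/- **Notation.** Write $e(x)=e^{2\pi i x}$ and let $\mathbb H$ be the upper half plane, $q=e(\tau)$ and $q^n=e(n\tau)$ for rational $n$. Let $G=\mathrm{Mp}_2(\mathbb Z)$ be the group of pairs $(A,w)$, where $A=\begin{pmatrix}a&b\\c&d\end{pmatrix}\in \mathrm{SL}_2(\mathbb Z)$ and $w$ is a holomorphic square root of $c\tau+d$ on $\mathbb H$, and let $\varepsilon(A,w)=\eta(A\tau)/(\eta(\tau)w(\tau))$ be the character of $G$ given by the Dedekind eta function (the quotient is independent of $\tau$). An integral positive definite lattice $\underline L=(L,\beta)$ of rank $n$ is a free $\mathbb Z$-module $L$ of rank $n$ with a symmetric positive definite bilinear form $\beta:L\times L\to\mathbb Z$; put $\beta(x)=\frac12\beta(x,x)$ and extend $\beta$ bilinearly to $\mathbb Q\otimes L$ and $\mathbb C\otimes L$. Its dual is $L^\#=\{r\in\mathbb Q\otimes L:\beta(r,L)\subseteq\mathbb Z\}$, its shadow is $L^\bullet=\{r\in\mathbb Q\otimes L:\beta(r,x)\equiv\beta(x)\bmod\mathbb Z\ \text{for all } x\in L\}$, and its associated bilinear module is the finite abelian group $L^\#/L$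 with the bilinear form $(x+L,y+L)\mapsto\beta(x,y)+\mathbb Z\in\mathbb Q/\mathbb Z$. For $k\in\frac12\mathbb Z$ and $h\in\mathbb Z$ let $J_{k,\underline L}(\varepsilon^h)$ be the space of holomorphic functions $\phi(\tau,z)$ on $\mathbb H\times(\mathbb C\otimes L)$ such that 1. $\phi\big(A\tau,\tfrac{z}{c\tau+d}\big)\,e\big(\tfrac{-c\beta(z)}{c\tau+d}\big)\,w(\tau)^{-2k}=\varepsilon(\alpha)^h\phi(\tau,z)$ for all $\alpha=(A,w)\in G$; 2. $\phi(\tau,z+x\tau+y)\,e(\tau\beta(x)+\beta(x,z))=e(\beta(x+y))\,\phi(\tau,z)$ for all $x,y\in L$; 3. $\phi$ has an absolutely convergent Fourier expansion $\phi(\tau,z)=\sum c(n,r)\,q^n e(\beta(z,r))$, the sum being over all $n\in\frac h{24}+\mathbb Z$ and $r\in L^\bullet$ with $n\ge\beta(r)$. Let $W(\underline L)$ be the space of functions $\lambda:L^\bullet\to\mathbb C$ with $\lambda(r+x)=e(\beta(x))\lambda(r)$ for $r\in L^\bullet$ and $x\in L$, and for $\lambda\in W(\underline L)$ put $\vartheta_{\underline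 L,\lambda}(\tau,z)=\sum_{r\in L^\bullet}\lambda(r)\,q^{\beta(r)}e(\beta(r,z))$. **Theorem.** Let $\underline L_1$ and $\underline L_2$ be integral positive definite lattices of ranks $n_1$ and $n_2$ whose associated bilinear modules are isomorphic. Then for every $k\in\frac12\mathbb Z$ and every $h\in\mathbb Z$ there is a natural isomorphism of complex vector spaces $$J_{k+\frac{n_1}2,\underline L_1}\big(\varepsilon^{h+3n_1}\big)\;\cong\;J_{k+\frac{n_2}2,\underline L_2}\big(\varepsilon^{h+3n_2}\big).$$ Here "natural" means the following. For every isomorphism $\sigma:L_1^\#/L_1\to L_2^\#/L_2$ of bilinear modules there is a linear isomorphism $T:W(\underline L_1)\to W(\underline L_2)$, independent of $k$ and $h$, such that * $T$ lies over $\sigma$: there are maps $s:L_1^\bullet\to L_2^\bullet$ and $u:L_1^\bullet\to\{\pm1\}$ such that $s(r+x)-s(r)\in L_2^\#$ represents $\sigma(x+L_1)$ for all $r\in L_1^\bullet$ and $x\in L_1^\#$, and $(T\lambda)(s(r))=u(r)\lambda(r)$ for all $\lambda\in W(\underline L_1)$ and $r\in L_1^\bullet$; * for all $k$ and $h$, each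 $\phi\in J_{k+n_1/2,\underline L_1}(\varepsilon^{h+3n_1})$ is a finite sum $\sum_i f_i(\tau)\,\vartheta_{\underline L_1,\lambda_i}(\tau,z)$ with holomorphic functions $f_i$ on $\mathbb H$ and $\lambda_i\in W(\underline L_1)$, and the isomorphism above sends $\phi$ to $\sum_i f_i(\tau)\,\vartheta_{\underline L_2,T\lambda_i}(\tau,z)$, for every way of writing $\phi$ as such a sum, with arbitrary functions $f_i:\mathbb H\to\mathbb C$. -/

import Mathlib

open scoped TensorProduct UpperHalfPlane MatrixGroups Manifold

noncomputable section

namespace JacobiLattice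

/-- `e(x) = exp(2πix)`. -/
def e (x : ℂ) : ℂ := Complex.exp (2 * Real.pi * Complex.I * x)

/-- `cτ + d`, where `(c, d)` is the second row of `A`. -/
def autFactor (A : SL(2, ℤ)) (τ : ℍ) : ℂ :=
  ((A.1 1 0 : ℤ) : ℂ) * (τ : ℂ) + ((A.1 1 1 : ℤ) : ℂ)

/-- Elements `(A, w)` of the metaplectic cover of `SL(2, ℤ)`: `w` is a holomorphic square root of
`cτ + d` on the upper half plane. (Only the elements, not the group law, are used below.) -/
structure Metaplectic where
  A : SL(2, ℤ)
  w : ℍ → ℂ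
  holo : MDifferentiable 𝓘(ℂ) 𝓘(ℂ) w
  sq : ∀ τ, w τ ^ 2 = autFactor A τ

/-- The character `ε(A, w) = η(Aτ) / (η(τ) w(τ))` of the metaplectic group. The quotient does not
depend on `τ`, so it is evaluated at `τ = i`. -/
def epsilon (α : Metaplectic) : ℂ :=
  ModularForm.eta ((α.A • UpperHalfPlane.I : ℍ) : ℂ) /
    (ModularForm.eta ((UpperHalfPlane.I : ℍ) : ℂ) * α.w UpperHalfPlane.I)

/-- A positive definite, symmetric, integer valued bilinear form on `L`. For `L` free of finite
rank this is an integral positive definite lattice `(L, β)`. -/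
structure PosDefLattice (L : Type*) [AddCommGroup L] where
  form : LinearMap.BilinForm ℤ L
  symm : ∀ x y, form x y = form y x
  pos : ∀ x, x ≠ 0 → 0 < form x x

namespace PosDefLattice

variable {L : Type*} [AddCommGroup L] (Λ : PosDefLattice L)

/-- The extension of `β` to `ℚ ⊗ L`. -/
def formQ : LinearMap.BilinForm ℚ (ℚ ⊗[ℤ] L) := Λ.form.baseChange ℚ

/-- The extension of `β` to `ℂ ⊗ L`. -/
def formC : LinearMap.BilinForm ℂ (ℂ ⊗[ℤ] L) := Λ.form.baseChange ℂ

/-- `β(x) = β(x, x) / 2` on `L`. -/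
def quad (x : L) : ℚ := (Λ.form x x : ℚ) / 2

/-- `β(r) = β(r, r) / 2` on `ℚ ⊗ L`. -/
def quadQ (r : ℚ ⊗[ℤ] L) : ℚ := Λ.formQ r r / 2

/-- `β(z) = β(z, z) / 2` on `ℂ ⊗ L`. -/
def quadC (z : ℂ ⊗[ℤ] L) : ℂ := Λ.formC z z / 2

end PosDefLattice

/-- The embedding of `L` into `ℚ ⊗ L`. -/
def inclQ (L : Type*) [AddCommGroup L] : L →+ ℚ ⊗[ℤ] L :=
  (TensorProduct.mk ℤ ℚ L 1).toAddMonoidHom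

/-- The embedding of `ℚ ⊗ L` into `ℂ ⊗ L`. -/
def inclC (L : Type*) [AddCommGroup L] : ℚ ⊗[ℤ] L →ₗ[ℚ] ℂ ⊗[ℤ] L :=
  TensorProduct.AlgebraTensorModule.map (Algebra.linearMap ℚ ℂ) LinearMap.id

namespace PosDefLattice

variable {L : Type*} [AddCommGroup L] (Λ : PosDefLattice L)

/-- The shadow of the lattice: all `r ∈ ℚ ⊗ L` with `β(r, x) ≡ β(x) mod ℤ` for all `x ∈ L`. -/
def shadow : Set (ℚ ⊗[ℤ] L) :=
  {r | ∀ x : L, ∃ m : ℤ, Λ.formQ r (inclQ L x) - Λ.quad x = m}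

/-- The dual lattice: all `r ∈ ℚ ⊗ L` with `β(r, x) ∈ ℤ` for all `x ∈ L`. -/
def dual : AddSubgroup (ℚ ⊗[ℤ] L) where
  carrier := {r | ∀ x : L, ∃ m : ℤ, Λ.formQ r (inclQ L x) = m}
  zero_mem' x := ⟨0, by simp⟩
  add_mem' := by
    intro a b ha hb x
    obtain ⟨m, hm⟩ := ha x
    obtain ⟨k, hk⟩ := hb x
    exact ⟨m + k, by simp [hm, hk]⟩
  neg_mem' := by
    intro a ha x
    obtain ⟨m, hm⟩ := ha x
    exact ⟨-m, by simp [hm]⟩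

/-- The finite abelian group `L^# / L`. -/
abbrev Disc : Type _ := Λ.dual ⧸ ((inclQ L).range.addSubgroupOf Λ.dual)

/-- The class in `L^# / L` of an element of the dual. -/
def toDisc : Λ.dual →+ Λ.Disc := QuotientAddGroup.mk' _

theorem formQ_symm (r s : ℚ ⊗[ℤ] L) : Λ.formQ r s = Λ.formQ s r :=
  (LinearMap.BilinForm.IsSymm.baseChange ℚ (B₂ := Λ.form) ⟨Λ.symm⟩).eq r s

theorem coe_eq_zero_of_int {q : ℚ} (h : ∃ m : ℤ, q = m) : (q : AddCircle (1 : ℚ)) = 0 := by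
  obtain ⟨m, rfl⟩ := h
  rw [AddCircle.coe_eq_zero_iff]
  exact ⟨m, by simp⟩

/-- `y ↦ β(x, y) + ℤ` on `L^#`, for `x ∈ L^#`. -/
def discFormAux (x : Λ.dual) : Λ.dual →+ AddCircle (1 : ℚ) :=
  (QuotientAddGroup.mk' (AddSubgroup.zmultiples (1 : ℚ))).comp
    ((Λ.formQ (x : ℚ ⊗[ℤ] L)).toAddMonoidHom.comp Λ.dual.subtype)

theorem discFormAux_apply (x y : Λ.dual) :
    Λ.discFormAux x y = ((Λ.formQ (x : ℚ ⊗[ℤ] L) (y : ℚ ⊗[ℤ] L) : ℚ) : AddCircle (1 : ℚ)) := rfl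

theorem discFormAux_right (x y : Λ.dual) (hy : y ∈ (inclQ L).range.addSubgroupOf Λ.dual) :
    Λ.discFormAux x y = 0 := by
  obtain ⟨l, hl⟩ := hy
  rw [discFormAux_apply]
  apply coe_eq_zero_of_int
  obtain ⟨m, hm⟩ := x.2 l
  refine ⟨m, ?_⟩
  rw [← hm]
  exact congrArg (Λ.formQ (x : ℚ ⊗[ℤ] L)) hl.symm

theorem discFormAux_left (x y : Λ.dual) (hx : x ∈ (inclQ L).range.addSubgroupOf Λ.dual) :
    Λ.discFormAux x y = 0 := by
  have h := Λ.discFormAux_right y x hx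
  rw [discFormAux_apply] at h ⊢
  rwa [Λ.formQ_symm]

/-- The form `β'(x + L, y + L) = β(x, y) + ℤ` of the bilinear module `(L^# / L, β')` associated
to the lattice, with values in `ℚ / ℤ`. -/
def discForm : Λ.Disc →+ Λ.Disc →+ AddCircle (1 : ℚ) :=
  QuotientAddGroup.lift _
    { toFun := fun x => QuotientAddGroup.lift _ (Λ.discFormAux x) (Λ.discFormAux_right x)
      map_zero' := by
        ext y
        change Λ.discFormAux 0 y = 0
        simp [discFormAux_apply]
      map_add' := by
        intro a b
        ext y
        change Λ.discFormAux (a + b) y = Λ.discFormAux a y + Λ.discFormAux b y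
        simp [discFormAux_apply] }
    (by
      intro x hx
      ext y
      exact Λ.discFormAux_left x y hx)

theorem discForm_toDisc (x y : Λ.dual) :
    Λ.discForm (Λ.toDisc x) (Λ.toDisc y) =
      ((Λ.formQ (x : ℚ ⊗[ℤ] L) (y : ℚ ⊗[ℤ] L) : ℚ) : AddCircle (1 : ℚ)) := rfl

/-- The space `W` of functions `a` on the shadow with `a(r + x) = e(β(x)) a(r)` for `x ∈ L`. -/
def W : Submodule ℂ (Λ.shadow → ℂ) where
  carrier := {a | ∀ (r r' : Λ.shadow) (x : L), (r' : ℚ ⊗[ℤ] L) = r + inclQ L x →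
    a r' = e (Λ.quad x : ℂ) * a r}
  zero_mem' r r' x _ := by simp
  add_mem' := by
    intro a b ha hb r r' x h
    simp [ha r r' x h, hb r r' x h, mul_add]
  smul_mem' := by
    intro c a ha r r' x h
    simp [ha r r' x h, mul_left_comm]

/-- The theta function `ϑ_a(τ, z) = ∑_r a(r) q^{β(r)} e(β(r, z))`, the sum being over the
shadow. -/
def theta (a : Λ.W) (τ : ℍ) (z : ℂ ⊗[ℤ] L) : ℂ :=
  ∑' r : Λ.shadow,
    a.1 r * e ((Λ.quadQ (r : ℚ ⊗[ℤ] L) : ℂ) * (τ : ℂ)) * e (Λ.formC (inclC L (r : ℚ ⊗[ℤ] L)) z)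

/-- The transformation law under the metaplectic group, for weight `κ / 2` and character `ε^h`. -/
def MetaplecticLaw (κ h : ℤ) (φ : ℍ → ℂ ⊗[ℤ] L → ℂ) : Prop :=
  ∀ (α : Metaplectic) (τ : ℍ) (z : ℂ ⊗[ℤ] L),
    φ (α.A • τ) ((autFactor α.A τ)⁻¹ • z) *
        e (-((α.A.1 1 0 : ℤ) : ℂ) * Λ.quadC z / autFactor α.A τ) * α.w τ ^ (-κ) =
      epsilon α ^ h * φ τ z

/-- The transformation law under `L × L`. -/
def LatticeLaw (φ : ℍ → ℂ ⊗[ℤ] L → ℂ) : Prop :=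
  ∀ (x y : L) (τ : ℍ) (z : ℂ ⊗[ℤ] L),
    φ τ (z + (τ : ℂ) ⊗ₜ[ℤ] x + (1 : ℂ) ⊗ₜ[ℤ] y) *
        e ((τ : ℂ) * (Λ.quad x : ℂ) + Λ.formC ((1 : ℂ) ⊗ₜ[ℤ] x) z) =
      e (Λ.quad (x + y) : ℂ) * φ τ z

/-- The pairs `(n, r)` with `n ∈ h/24 + ℤ`, `r` in the shadow, and `n ≥ β(r)`. -/
def FourierIndex (h : ℤ) : Type _ :=
  {p : ℚ × (ℚ ⊗[ℤ] L) //
    (∃ m : ℤ, p.1 = (h : ℚ) / 24 + m) ∧ p.2 ∈ Λ.shadow ∧ Λ.quadQ p.2 ≤ p.1}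

/-- The Fourier series `∑ c(n, r) q^n e(β(z, r))`, over the pairs `(n, r)` above, represents `φ`. -/
def HasFourier (h : ℤ) (c : Λ.FourierIndex h → ℂ) (φ : ℍ → ℂ ⊗[ℤ] L → ℂ) : Prop :=
  ∀ (τ : ℍ) (z : ℂ ⊗[ℤ] L),
    HasSum (fun p : Λ.FourierIndex h =>
      c p * e ((p.1.1 : ℂ) * (τ : ℂ)) * e (Λ.formC z (inclC L p.1.2))) (φ τ z)

end PosDefLattice

/-- The point of `ℂ ⊗ L` with coordinates `v` with respect to a `ℤ`-basis of `L`. -/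
def ofCoords (L : Type*) [AddCommGroup L] [Module.Free ℤ L] [Module.Finite ℤ L]
    (v : Fin (Module.finrank ℤ L) → ℂ) : ℂ ⊗[ℤ] L :=
  ∑ i, v i ⊗ₜ[ℤ] Module.finBasis ℤ L i

/-- `φ` is holomorphic on `ℍ × (ℂ ⊗ L)`, read in the linear coordinates of `ofCoords`. -/
def IsHolo {L : Type*} [AddCommGroup L] [Module.Free ℤ L] [Module.Finite ℤ L]
    (φ : ℍ → ℂ ⊗[ℤ] L → ℂ) : Prop :=
  DifferentiableOn ℂ
    (fun p : ℂ × (Fin (Module.finrank ℤ L) → ℂ) =>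
      φ (UpperHalfPlane.ofComplex p.1) (ofCoords L p.2))
    {p | 0 < p.1.im}

/-- The space of Jacobi forms of weight `κ / 2`, lattice index `Λ` and character `ε^h`. -/
def JacobiForms {L : Type*} [AddCommGroup L] [Module.Free ℤ L] [Module.Finite ℤ L]
    (κ : ℤ) (Λ : PosDefLattice L) (h : ℤ) : Submodule ℂ (ℍ → ℂ ⊗[ℤ] L → ℂ) where
  carrier := {φ | IsHolo φ ∧ Λ.MetaplecticLaw κ h φ ∧ Λ.LatticeLaw φ ∧ ∃ c, Λ.HasFourier h c φ}
  zero_mem' := by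
    refine ⟨?_, ?_, ?_, 0, ?_⟩
    · exact differentiableOn_const (0 : ℂ)
    · intro α τ z
      simp
    · intro x y τ z
      simp
    · intro τ z
      simp
  add_mem' := by
    rintro φ ψ ⟨h1, h2, h3, c, h4⟩ ⟨g1, g2, g3, d, g4⟩
    refine ⟨h1.add g1, ?_, ?_, c + d, ?_⟩
    · intro α τ z
      simp only [Pi.add_apply]
      linear_combination h2 α τ z + g2 α τ z
    · intro x y τ z
      simp only [Pi.add_apply]
      linear_combination h3 x y τ z + g3 x y τ z
    · intro τ z
      simpa [add_mul] using (h4 τ z).add (g4 τ z)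
  smul_mem' := by
    rintro t φ ⟨h1, h2, h3, c, h4⟩
    refine ⟨h1.const_smul t, ?_, ?_, t • c, ?_⟩
    · intro α τ z
      simp only [Pi.smul_apply, smul_eq_mul]
      linear_combination t * h2 α τ z
    · intro x y τ z
      simp only [Pi.smul_apply, smul_eq_mul]
      linear_combination t * h3 x y τ z
    · intro τ z
      simpa [mul_assoc] using (h4 τ z).mul_left t

section Natural

variable {L₁ L₂ : Type*} [AddCommGroup L₁] [AddCommGroup L₂]
  {Λ₁ : PosDefLattice L₁} {Λ₂ : PosDefLattice L₂}

/-- `T : W(Λ₁) ≃ W(Λ₂)` lies over the isomorphism `σ : L₁^# / L₁ ≃ L₂^# / L₂`: up to signs, `T`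
transports functions along a map `s` of the shadows that is compatible with `σ` in the sense that
`s(r + x) - s(r)` represents `σ(x + L₁)` for `x ∈ L₁^#`. -/
def LiesOver (σ : Λ₁.Disc ≃+ Λ₂.Disc) (T : Λ₁.W ≃ₗ[ℂ] Λ₂.W) : Prop :=
  ∃ (s : Λ₁.shadow → Λ₂.shadow) (u : Λ₁.shadow → ℤˣ),
    (∀ (r r' : Λ₁.shadow) (x : Λ₁.dual), (r' : ℚ ⊗[ℤ] L₁) = r + x →
      ∃ y : Λ₂.dual, (s r' : ℚ ⊗[ℤ] L₂) = s r + y ∧ σ (Λ₁.toDisc x) = Λ₂.toDisc y) ∧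
    ∀ (a : Λ₁.W) (r : Λ₁.shadow), (T a).1 (s r) = ((u r : ℤ) : ℂ) * a.1 r

/-- `φ = ∑ i, f i · ϑ_{a i}`, a theta expansion of `φ`. -/
def IsThetaExpansion {L : Type*} [AddCommGroup L] (Λ : PosDefLattice L) {m : ℕ}
    (f : Fin m → ℍ → ℂ) (a : Fin m → Λ.W) (φ : ℍ → ℂ ⊗[ℤ] L → ℂ) : Prop :=
  ∀ (τ : ℍ) (z : ℂ ⊗[ℤ] L), φ τ z = ∑ i, f i τ * Λ.theta (a i) τ z

/-- The linear isomorphism `Φ` between spaces of functions is the one induced by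
`T : W(Λ₁) ≃ W(Λ₂)` on theta expansions: every `φ` has a theta expansion with holomorphic
coefficients, and `Φ` sends `∑ i, f i · ϑ_{a i}` to `∑ i, f i · ϑ_{T (a i)}`. -/
def InducedByTheta (T : Λ₁.W ≃ₗ[ℂ] Λ₂.W)
    {V₁ : Submodule ℂ (ℍ → ℂ ⊗[ℤ] L₁ → ℂ)} {V₂ : Submodule ℂ (ℍ → ℂ ⊗[ℤ] L₂ → ℂ)}
    (Φ : V₁ ≃ₗ[ℂ] V₂) : Prop :=
  ∀ φ : V₁,
    (∃ (m : ℕ) (f : Fin m → ℍ → ℂ) (a : Fin m → Λ₁.W),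
      (∀ i, MDifferentiable 𝓘(ℂ) 𝓘(ℂ) (f i)) ∧ IsThetaExpansion Λ₁ f a φ.1) ∧
    ∀ (m : ℕ) (f : Fin m → ℍ → ℂ) (a : Fin m → Λ₁.W), IsThetaExpansion Λ₁ f a φ.1 →
      IsThetaExpansion Λ₂ f (fun i => T (a i)) (Φ φ).1

end Natural

end JacobiLattice

end

/-!
The theta expansion identifies a Jacobi form `φ` with the function `F : ℍ → W` such that
`φ(τ, z) = ϑ_{F(τ)}(τ, z)`. In terms of `F`, the group `L^# / L` enters only through two operators
on `W`: translation `T` acts diagonally by `e(β(r))`, and inversion `S` acts by a finite Fourier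
transform, up to a positive constant `C` and powers of `√(-iτ)`.

An isomorphism `σ` of bilinear modules need not preserve `e(β(r))`. On the shadow, however,
`β(x + ρ) - β(ρ)` is a quadratic refinement of the bilinear form, and two such refinements differ by
a character of the discriminant group. As the form is nondegenerate, base points `ρ₁`, `ρ₂` of the
two shadows can be chosen such that `σ` respects the refinements. The induced map `W₁ → W₂`
commutes with `T` and `S` up to the constants `ζ = e(β(ρ₂) - β(ρ₁))` and `ζ⁻²`.

Let `G` be the Gauss sum of `e(β(r))` over the shadow modulo `L`. Evaluating the theta
transformation formula for the relation `TSTST = S` at `τ = i` yields Milgram's formula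
`C * G = e(n / 8)`. Hence `C₁ = C₂` and `ζ = e((n₂ - n₁) / 8)`, which the shifts of the weight by
`n / 2` and of the character by `ε^{3n}` compensate.
-/

noncomputable section

namespace JacobiLattice

/-! ### The exponential `e` -/

theorem e_add (x y : ℂ) : e (x + y) = e x * e y := by
  simp only [e, ← Complex.exp_add, mul_add]

theorem e_zero : e 0 = 1 := by simp [e]

theorem e_ne_zero (x : ℂ) : e x ≠ 0 := Complex.exp_ne_zero _

theorem e_neg (x : ℂ) : e (-x) = (e x)⁻¹ := by
  rw [e, mul_neg, Complex.exp_neg, e]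

theorem e_sub (x y : ℂ) : e (x - y) = e x / e y := by
  rw [sub_eq_add_neg, e_add, e_neg, div_eq_mul_inv]

theorem e_int (m : ℤ) : e m = 1 := by
  rw [e, Complex.exp_eq_one_iff]
  exact ⟨m, mul_comm _ _⟩

theorem e_add_int (x : ℂ) (m : ℤ) : e (x + m) = e x := by rw [e_add, e_int, mul_one]

theorem e_sum {ι : Type*} (s : Finset ι) (f : ι → ℂ) : e (∑ i ∈ s, f i) = ∏ i ∈ s, e (f i) := by
  simp only [e, Finset.mul_sum, Complex.exp_sum]

theorem e_int_mul (n : ℤ) (x : ℂ) : e (n * x) = e x ^ n := by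
  rw [e, e, ← Complex.exp_int_mul, mul_left_comm]

theorem norm_e (x : ℂ) : ‖e x‖ = Real.exp (-2 * Real.pi * x.im) := by
  simp [e, Complex.norm_exp]

theorem norm_e_ratCast (q : ℚ) : ‖e q‖ = 1 := by simp [norm_e]

theorem differentiable_e : Differentiable ℂ e :=
  (differentiable_id.const_mul _).cexp

theorem coe_addCircle_eq_iff {p q : ℚ} :
    (p : AddCircle (1 : ℚ)) = q ↔ ∃ m : ℤ, p = q + m := by
  rw [← sub_eq_zero, ← AddCircle.coe_sub, AddCircle.coe_eq_zero_iff]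
  exact exists_congr fun m => by rw [zsmul_one, eq_comm, sub_eq_iff_eq_add']

theorem e_ratCast_inj {p q : ℚ} : e p = e q ↔ (p : AddCircle (1 : ℚ)) = q := by
  rw [coe_addCircle_eq_iff, e, e, Complex.exp_eq_exp_iff_exists_int]
  refine exists_congr fun m => ?_
  rw [mul_comm (m : ℂ), ← mul_add, mul_right_inj' Complex.two_pi_I_ne_zero]
  exact_mod_cast Iff.rfl

theorem e_ratCast_congr {p q : ℚ} (m : ℤ) (h : p = q + m) : e p = e q :=
  e_ratCast_inj.2 (coe_addCircle_eq_iff.2 ⟨m, h⟩)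

/-! ### Rational and complex extensions of the form -/

section Inclusions

variable {L : Type*} [AddCommGroup L]

theorem inclC_tmul (q : ℚ) (x : L) : inclC L (q ⊗ₜ[ℤ] x) = (q : ℂ) ⊗ₜ[ℤ] x := by
  simp [inclC]

theorem inclC_inclQ (x : L) : inclC L (inclQ L x) = (1 : ℂ) ⊗ₜ[ℤ] x := by
  simp [inclQ, inclC_tmul]

theorem inclC_smul (q : ℚ) (r : ℚ ⊗[ℤ] L) : inclC L (q • r) = (q : ℂ) • inclC L r := by
  induction r using TensorProduct.induction_on with
  | zero => simp
  | tmul a x => simp [TensorProduct.smul_tmul', inclC_tmul]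
  | add a b ha hb => rw [smul_add, map_add, ha, hb, map_add, smul_add]

theorem exists_nsmul_eq_inclQ (r : ℚ ⊗[ℤ] L) :
    ∃ (N : ℕ) (x : L), 0 < N ∧ (N : ℚ) • r = inclQ L x := by
  induction r using TensorProduct.induction_on with
  | zero => exact ⟨1, 0, one_pos, by simp⟩
  | tmul a x =>
    refine ⟨a.den, a.num • x, a.pos, ?_⟩
    rw [TensorProduct.smul_tmul', smul_eq_mul, Rat.den_mul_eq_num]
    simp [inclQ, TensorProduct.smul_tmul']
  | add a b ha hb =>
    obtain ⟨N, x, hN, hx⟩ := ha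
    obtain ⟨M, y, hM, hy⟩ := hb
    refine ⟨N * M, (M : ℤ) • x + (N : ℤ) • y, Nat.mul_pos hN hM, ?_⟩
    rw [smul_add, map_add, map_zsmul, map_zsmul, ← hx, ← hy]
    push_cast
    rw [mul_comm (N : ℚ), mul_smul, mul_comm (M : ℚ), mul_smul]
    simp [Nat.cast_smul_eq_nsmul]

theorem inclQ_injective [Module.Free ℤ L] : Function.Injective (inclQ L) := by
  have h := Module.Flat.rTensor_preserves_injective_linearMap (M := L) (Algebra.linearMap ℤ ℚ)
    (by intro a b h; simpa using h)
  intro x y hxy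
  have := @h ((1 : ℤ) ⊗ₜ x) ((1 : ℤ) ⊗ₜ y) (by simpa [inclQ] using hxy)
  simpa using congrArg (TensorProduct.lid ℤ L) this

end Inclusions

theorem exists_bilin_eq_of_basis {ι M V : Type*} [Finite ι] [AddCommGroup M]
    [AddCommGroup V] [Module ℚ V] {B : LinearMap.BilinForm ℚ V} (hB : B.Nondegenerate)
    (b : Module.Basis ι ℤ M) (c : Module.Basis ι ℚ V) (f : M →+ V) (hf : ∀ i, f (b i) = c i)
    (χ : M →+ AddCircle (1 : ℚ)) :
    ∃ r : V, ∀ x, χ x = (B r (f x) : ℚ) := by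
  classical
  have := Fintype.ofFinite ι
  choose t ht using fun i => QuotientAddGroup.mk_surjective (χ (b i))
  let r := ∑ i, t i • B.dualBasis hB c i
  let ψ : M →+ AddCircle (1 : ℚ) := (QuotientAddGroup.mk' _).comp ((B r).toAddMonoidHom.comp f)
  have hχ : χ.toIntLinearMap = ψ.toIntLinearMap := b.ext fun i => by
    change χ (b i) = ((B r (f (b i)) : ℚ) : AddCircle (1 : ℚ))
    simp [r, hf, ← ht, LinearMap.BilinForm.apply_dualBasis_left]
  exact ⟨r, fun x => LinearMap.congr_fun hχ x⟩

namespace PosDefLattice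

section Forms

variable {L : Type*} [AddCommGroup L] (Λ : PosDefLattice L)

theorem formC_symm (z w : ℂ ⊗[ℤ] L) : Λ.formC z w = Λ.formC w z :=
  (LinearMap.BilinForm.IsSymm.baseChange ℂ (B₂ := Λ.form) ⟨Λ.symm⟩).eq z w

theorem formC_inclC (r s : ℚ ⊗[ℤ] L) :
    Λ.formC (inclC L r) (inclC L s) = (Λ.formQ r s : ℂ) := by
  induction r using TensorProduct.induction_on with
  | zero => simp
  | add a b ha hb => simp [ha, hb]
  | tmul a x =>
    induction s using TensorProduct.induction_on with
    | zero => simp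
    | add a b ha hb => simp only [map_add, ha, hb, Rat.cast_add]
    | tmul b y => simp [inclC_tmul, formC, formQ, LinearMap.BilinForm.baseChange_tmul]

theorem formQ_inclQ (x y : L) : Λ.formQ (inclQ L x) (inclQ L y) = Λ.form x y := by
  simp [inclQ, formQ, LinearMap.BilinForm.baseChange_tmul]

theorem quadQ_inclQ (x : L) : Λ.quadQ (inclQ L x) = Λ.quad x := by
  rw [quadQ, formQ_inclQ, quad]

theorem quadQ_add (r s : ℚ ⊗[ℤ] L) :
    Λ.quadQ (r + s) = Λ.quadQ r + Λ.quadQ s + Λ.formQ r s := by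
  simp only [quadQ, map_add, LinearMap.add_apply, Λ.formQ_symm s r]
  ring

theorem quadQ_neg (r : ℚ ⊗[ℤ] L) : Λ.quadQ (-r) = Λ.quadQ r := by
  simp [quadQ]

theorem quad_zero : Λ.quad 0 = 0 := by
  simp [quad]

theorem quad_add (x y : L) : Λ.quad (x + y) = Λ.quad x + Λ.quad y + Λ.form x y := by
  simp only [← quadQ_inclQ, map_add, quadQ_add, formQ_inclQ]

theorem quadC_add (z w : ℂ ⊗[ℤ] L) :
    Λ.quadC (z + w) = Λ.quadC z + Λ.quadC w + Λ.formC z w := by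
  simp only [quadC, map_add, LinearMap.add_apply, Λ.formC_symm w z]
  ring

theorem quadC_smul (t : ℂ) (z : ℂ ⊗[ℤ] L) : Λ.quadC (t • z) = t ^ 2 * Λ.quadC z := by
  simp only [quadC, map_smul, LinearMap.smul_apply, smul_eq_mul]
  ring

theorem quadC_inclC (r : ℚ ⊗[ℤ] L) : Λ.quadC (inclC L r) = (Λ.quadQ r : ℂ) := by
  rw [quadC, formC_inclC, quadQ]
  push_cast
  rfl

theorem formQ_self_pos {r : ℚ ⊗[ℤ] L} (hr : r ≠ 0) : 0 < Λ.formQ r r := by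
  obtain ⟨N, x, hN, hx⟩ := exists_nsmul_eq_inclQ r
  have hx0 : x ≠ 0 := by
    rintro rfl
    rw [map_zero, smul_eq_zero] at hx
    exact hx.elim (by positivity) hr
  have hpos : (0 : ℚ) < (N : ℚ) * ((N : ℚ) * Λ.formQ r r) := by
    have h : (0 : ℚ) < Λ.form x x := by exact_mod_cast Λ.pos x hx0
    rwa [← formQ_inclQ, ← hx, map_smul, map_smul, LinearMap.smul_apply] at h
  exact pos_of_mul_pos_right (pos_of_mul_pos_right hpos (by positivity)) (by positivity)

theorem formQ_nondegenerate : Λ.formQ.Nondegenerate := by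
  rw [LinearMap.BilinForm.Nondegenerate, LinearMap.IsRefl.nondegenerate_iff_separatingLeft]
  · intro r hr
    by_contra h
    exact (Λ.formQ_self_pos h).ne' (hr r)
  · intro r s h
    rw [Λ.formQ_symm, h]

theorem e_quad_add (x y : L) : e (Λ.quad (x + y)) = e (Λ.quad x) * e (Λ.quad y) := by
  rw [quad_add]
  push_cast
  rw [e_add_int, e_add]

theorem e_quad_mul_self (l : L) : e (Λ.quad l) * e (Λ.quad l) = 1 := by
  rw [← e_add, ← e_int (Λ.form l l)]
  congr 1
  simp [quad]

theorem e_quad_inv (l : L) : (e (Λ.quad l))⁻¹ = e (Λ.quad l) :=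
  inv_eq_of_mul_eq_one_left (Λ.e_quad_mul_self l)

end Forms

/-! ### The dual lattice and the shadow -/

section DualShadow

variable {L : Type*} [AddCommGroup L] (Λ : PosDefLattice L)

/-- The inclusion of the lattice into its dual. -/
def inclDual : L →+ Λ.dual :=
  (inclQ L).codRestrict Λ.dual fun x y => ⟨_, Λ.formQ_inclQ x y⟩

theorem coe_inclDual (l : L) : (Λ.inclDual l : ℚ ⊗[ℤ] L) = inclQ L l := rfl

theorem inclDual_injective [Module.Free ℤ L] : Function.Injective Λ.inclDual := fun _ _ h =>
  inclQ_injective (congrArg Subtype.val h)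

theorem toDisc_surjective : Function.Surjective Λ.toDisc := QuotientAddGroup.mk'_surjective _

theorem toDisc_out (d : Λ.Disc) : Λ.toDisc d.out = d := QuotientAddGroup.out_eq' d

theorem toDisc_eq_iff {x y : Λ.dual} :
    Λ.toDisc x = Λ.toDisc y ↔ ∃ l : L, y = x + Λ.inclDual l := by
  rw [toDisc, QuotientAddGroup.mk'_eq_mk']
  constructor
  · rintro ⟨z, ⟨l, hl⟩, rfl⟩
    exact ⟨l, congrArg (x + ·) (Subtype.ext hl.symm)⟩
  · rintro ⟨l, rfl⟩
    exact ⟨Λ.inclDual l, ⟨l, rfl⟩, rfl⟩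

theorem toDisc_inclDual (l : L) : Λ.toDisc (Λ.inclDual l) = 0 := by
  rw [← map_zero Λ.toDisc, eq_comm, toDisc_eq_iff]
  exact ⟨l, (zero_add _).symm⟩

theorem e_formQ_inclQ_left (l : L) (x : Λ.dual) : e (Λ.formQ (inclQ L l) x) = 1 := by
  obtain ⟨m, hm⟩ := x.2 l
  rw [formQ_symm, hm, Rat.cast_intCast, e_int]

theorem e_formQ_shadow (r : Λ.shadow) (l : L) :
    e (Λ.formQ (r : ℚ ⊗[ℤ] L) (inclQ L l)) = e (Λ.quad l) := by
  obtain ⟨m, hm⟩ := r.2 l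
  exact e_ratCast_congr m (by rw [← hm]; ring)

theorem e_quadQ_add_inclQ_dual (x : Λ.dual) (l : L) :
    e (Λ.quadQ ((x : ℚ ⊗[ℤ] L) + inclQ L l)) = e (Λ.quad l) * e (Λ.quadQ (x : ℚ ⊗[ℤ] L)) := by
  rw [quadQ_add, quadQ_inclQ, formQ_symm]
  push_cast
  rw [e_add, e_add, e_formQ_inclQ_left, mul_one, mul_comm]

theorem e_quadQ_add_inclQ_shadow (r : Λ.shadow) (l : L) :
    e (Λ.quadQ ((r : ℚ ⊗[ℤ] L) + inclQ L l)) = e (Λ.quadQ (r : ℚ ⊗[ℤ] L)) := by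
  rw [quadQ_add, quadQ_inclQ]
  push_cast
  rw [e_add, e_add, e_formQ_shadow, mul_assoc, e_quad_mul_self, mul_one]

theorem add_mem_shadow {x r : ℚ ⊗[ℤ] L} (hx : x ∈ Λ.dual) (hr : r ∈ Λ.shadow) :
    x + r ∈ Λ.shadow := fun l => by
  obtain ⟨k, hk⟩ := hx l
  obtain ⟨m, hm⟩ := hr l
  refine ⟨k + m, ?_⟩
  rw [map_add, LinearMap.add_apply, hk, add_sub_assoc, hm, Int.cast_add]

theorem sub_mem_dual {r s : ℚ ⊗[ℤ] L} (hr : r ∈ Λ.shadow) (hs : s ∈ Λ.shadow) :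
    r - s ∈ Λ.dual := fun l => by
  obtain ⟨k, hk⟩ := hr l
  obtain ⟨m, hm⟩ := hs l
  refine ⟨k - m, ?_⟩
  rw [map_sub, LinearMap.sub_apply, ← sub_sub_sub_cancel_right _ _ (Λ.quad l), hk, hm,
    Int.cast_sub]

theorem neg_mem_shadow {r : ℚ ⊗[ℤ] L} (hr : r ∈ Λ.shadow) : -r ∈ Λ.shadow := fun l => by
  obtain ⟨m, hm⟩ := hr l
  refine ⟨-m - Λ.form l l, ?_⟩
  rw [map_neg, LinearMap.neg_apply]
  push_cast
  rw [← hm, quad]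
  ring

theorem add_mem_dual_of_shadow {r s : ℚ ⊗[ℤ] L} (hr : r ∈ Λ.shadow) (hs : s ∈ Λ.shadow) :
    r + s ∈ Λ.dual := by
  simpa using Λ.sub_mem_dual hr (Λ.neg_mem_shadow hs)

instance : AddAction Λ.dual Λ.shadow where
  vadd x r := ⟨x + r, Λ.add_mem_shadow x.2 r.2⟩
  zero_vadd _ := Subtype.ext (zero_add _)
  add_vadd _ _ _ := Subtype.ext (add_assoc _ _ _)

theorem coe_vadd (x : Λ.dual) (r : Λ.shadow) :
    ((x +ᵥ r : Λ.shadow) : ℚ ⊗[ℤ] L) = x + r := rfl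

end DualShadow

section Bases

variable {L : Type*} [AddCommGroup L] [Module.Free ℤ L] [Module.Finite ℤ L] (Λ : PosDefLattice L)

/-- The chosen `ℤ`-basis of `L`, as a basis of `ℚ ⊗ L`. -/
def ratBasis (L : Type*) [AddCommGroup L] [Module.Free ℤ L] [Module.Finite ℤ L] :
    Module.Basis (Fin (Module.finrank ℤ L)) ℚ (ℚ ⊗[ℤ] L) :=
  (Module.finBasis ℤ L).baseChange ℚ

theorem inclQ_finBasis (i : Fin (Module.finrank ℤ L)) :
    inclQ L (Module.finBasis ℤ L i) = ratBasis L i := by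
  simp [inclQ, ratBasis]

theorem span_ratBasis :
    Submodule.span ℤ (Set.range (ratBasis L)) = LinearMap.range (inclQ L).toIntLinearMap := by
  rw [← Submodule.map_top, ← (Module.finBasis ℤ L).span_eq, Submodule.map_span, ← Set.range_comp]
  exact congrArg _ (congrArg _ (funext fun i => (inclQ_finBasis i).symm))

instance : Nonempty Λ.shadow := by
  let χ : L →+ AddCircle (1 : ℚ) := AddMonoidHom.mk' (fun x => (Λ.quad x : AddCircle (1 : ℚ)))
    fun x y => by
      rw [← AddCircle.coe_add, coe_addCircle_eq_iff]
      exact ⟨Λ.form x y, Λ.quad_add x y⟩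
  obtain ⟨r, hr⟩ := exists_bilin_eq_of_basis Λ.formQ_nondegenerate (Module.finBasis ℤ L)
    (ratBasis L) (inclQ L) inclQ_finBasis χ
  refine ⟨r, fun x => ?_⟩
  obtain ⟨m, hm⟩ := coe_addCircle_eq_iff.1 (hr x).symm
  exact ⟨m, by rw [hm, add_sub_cancel_left]⟩

instance : AddTorsor Λ.dual Λ.shadow where
  vsub r s := ⟨r - s, Λ.sub_mem_dual r.2 s.2⟩
  vsub_vadd' _ _ := Subtype.ext (sub_add_cancel _ _)
  vadd_vsub' _ _ := Subtype.ext (add_sub_cancel_right _ _)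

theorem mem_dual_iff_mem_span {r : ℚ ⊗[ℤ] L} : r ∈ Λ.dual ↔
    r ∈ Submodule.span ℤ
      (Set.range (Λ.formQ.dualBasis Λ.formQ_nondegenerate (ratBasis L))) := by
  rw [← LinearMap.BilinForm.dualSubmodule_span_of_basis]
  simp only [LinearMap.BilinForm.mem_dualSubmodule, span_ratBasis, LinearMap.mem_range,
    forall_exists_index, forall_apply_eq_imp_iff, Submodule.mem_one,
    AddMonoidHom.coe_toIntLinearMap, algebraMap_int_eq, eq_intCast]
  exact forall_congr' fun l => exists_congr fun m => eq_comm

/-- The `ℤ`-basis of the dual lattice that is dual to the chosen basis of `L`. -/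
def dualBasis : Module.Basis (Fin (Module.finrank ℤ L)) ℤ Λ.dual :=
  ((Λ.formQ.dualBasis Λ.formQ_nondegenerate (ratBasis L)).restrictScalars ℤ).map
    (AddEquiv.toIntLinearEquiv
      { Equiv.subtypeEquivRight fun _ => Λ.mem_dual_iff_mem_span.symm with
        map_add' := fun _ _ => rfl })

theorem coe_dualBasis (i : Fin (Module.finrank ℤ L)) : (Λ.dualBasis i : ℚ ⊗[ℤ] L) =
    Λ.formQ.dualBasis Λ.formQ_nondegenerate (ratBasis L) i := by
  rw [dualBasis, Module.Basis.map_apply]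
  exact Module.Basis.restrictScalars_apply ℤ _ i

instance : Finite Λ.Disc := by
  have : Module.Finite ℤ Λ.dual := Module.Finite.of_basis Λ.dualBasis
  have : Module.Finite ℤ Λ.Disc :=
    Module.Finite.of_surjective Λ.toDisc.toIntLinearMap Λ.toDisc_surjective
  apply Module.finite_of_fg_torsion
  intro d
  obtain ⟨x, rfl⟩ := Λ.toDisc_surjective d
  obtain ⟨N, l, hN, hl⟩ := exists_nsmul_eq_inclQ (x : ℚ ⊗[ℤ] L)
  refine ⟨⟨(N : ℤ), mem_nonZeroDivisors_of_ne_zero (by exact_mod_cast hN.ne')⟩, ?_⟩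
  have hNx : (N : ℤ) • x = Λ.inclDual l := Subtype.ext <| by
    rw [coe_inclDual, ← hl, AddSubgroup.coe_zsmul]
    simp [Nat.cast_smul_eq_nsmul]
  change (N : ℤ) • Λ.toDisc x = 0
  rw [← map_zsmul, hNx, toDisc_inclDual]

instance : Fintype Λ.Disc := Fintype.ofFinite _

theorem exists_discForm_eq (χ : Λ.Disc →+ AddCircle (1 : ℚ)) : ∃ d, Λ.discForm d = χ := by
  obtain ⟨r, hr⟩ := exists_bilin_eq_of_basis Λ.formQ_nondegenerate Λ.dualBasis _
    Λ.dual.subtype Λ.coe_dualBasis (χ.comp Λ.toDisc)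
  have hr_mem : r ∈ Λ.dual := fun l => by
    have h := hr (Λ.inclDual l)
    rw [AddMonoidHom.comp_apply, toDisc_inclDual, map_zero, ← AddCircle.coe_zero, eq_comm,
      coe_addCircle_eq_iff] at h
    simpa only [zero_add, AddSubgroup.coe_subtype, coe_inclDual] using h
  refine ⟨Λ.toDisc ⟨r, hr_mem⟩, ?_⟩
  refine DFunLike.ext _ _ fun d => ?_
  obtain ⟨x, rfl⟩ := Λ.toDisc_surjective d
  exact (hr x).symm

end Bases

end PosDefLattice

/-! ### Sums over the shadow modulo the lattice -/

theorem bijective_out_add {A B : Type*} [AddCommGroup A] [AddCommGroup B] {S : AddSubgroup A}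
    {p : B →+ A} (hp : Function.Injective p) (hS : p.range = S) :
    Function.Bijective fun x : (A ⧸ S) × B => x.1.out + p x.2 := by
  have hmk (b : B) : (QuotientAddGroup.mk (p b) : A ⧸ S) = 0 :=
    (QuotientAddGroup.eq_zero_iff _).2 (hS ▸ ⟨b, rfl⟩)
  constructor
  · rintro ⟨d, b⟩ ⟨d', b'⟩ h
    have hd : d = d' := by
      simpa only [QuotientAddGroup.mk_add, hmk, QuotientAddGroup.out_eq', add_zero] using
        congrArg (QuotientAddGroup.mk (s := S)) h
    subst hd
    simpa [hp.eq_iff] using h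
  · intro a
    obtain ⟨b, hb⟩ : a - (QuotientAddGroup.mk a : A ⧸ S).out ∈ p.range := by
      rw [hS, ← QuotientAddGroup.eq_zero_iff, QuotientAddGroup.mk_sub, QuotientAddGroup.out_eq',
        sub_self]
    exact ⟨(QuotientAddGroup.mk a, b), by simp [hb]⟩

theorem tsum_eq_sum_tsum_out_add {A B : Type*} [AddCommGroup A] [AddCommGroup B]
    {S : AddSubgroup A} [Fintype (A ⧸ S)] {p : B →+ A} (hp : Function.Injective p)
    (hS : p.range = S) {f : A → ℂ} (hf : Summable f) :
    ∑' a, f a = ∑ d : A ⧸ S, ∑' b, f (d.out + p b) := by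
  let E := Equiv.ofBijective _ (bijective_out_add hp hS)
  have hE : Summable fun x : (A ⧸ S) × B => f (x.1.out + p x.2) := E.summable_iff.2 hf
  rw [← tsum_fintype (L := .unconditional _), ← hE.tsum_prod]
  exact (E.tsum_eq f).symm

namespace PosDefLattice

variable {L : Type*} [AddCommGroup L] (Λ : PosDefLattice L)

theorem range_inclDual : Λ.inclDual.range = (inclQ L).range.addSubgroupOf Λ.dual := by
  ext x
  exact exists_congr fun l => Subtype.ext_iff

variable {Λ}

/-- A function on the shadow is periodic if it is invariant under translation by the lattice. -/
def IsPeriodic {α : Type*} (f : Λ.shadow → α) : Prop :=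
  ∀ (l : L) (r : Λ.shadow), f (Λ.inclDual l +ᵥ r) = f r

theorem IsPeriodic.congr {α : Type*} {f : Λ.shadow → α} (hf : IsPeriodic f) {x y : Λ.dual}
    (h : Λ.toDisc x = Λ.toDisc y) (r : Λ.shadow) : f (x +ᵥ r) = f (y +ᵥ r) := by
  obtain ⟨l, rfl⟩ := Λ.toDisc_eq_iff.1 h
  rw [add_comm, add_vadd, hf]

variable (Λ) in
theorem isPeriodic_e_quadQ : IsPeriodic fun r : Λ.shadow => e (Λ.quadQ (r : ℚ ⊗[ℤ] L)) :=
  fun l r => by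
    beta_reduce
    rw [coe_vadd, coe_inclDual, add_comm, e_quadQ_add_inclQ_shadow]

theorem mem_W_iff {a : Λ.shadow → ℂ} :
    a ∈ Λ.W ↔ ∀ (l : L) (r : Λ.shadow), a (Λ.inclDual l +ᵥ r) = e (Λ.quad l) * a r := by
  constructor
  · exact fun h l r => h r _ l (add_comm _ _)
  · intro h r r' l hr'
    rw [← h]
    exact congrArg a (Subtype.ext (hr'.trans (add_comm _ _)))

theorem W_vadd (a : Λ.W) (l : L) (r : Λ.shadow) :
    a.1 (Λ.inclDual l +ᵥ r) = e (Λ.quad l) * a.1 r :=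
  mem_W_iff.1 a.2 l r

section ClassSum

variable [Module.Free ℤ L] [Module.Finite ℤ L]

theorem IsPeriodic.finite_range {α : Type*} {f : Λ.shadow → α} (hf : IsPeriodic f) :
    (Set.range f).Finite := by
  let ρ : Λ.shadow := Classical.arbitrary _
  refine (Set.finite_range fun d : Λ.Disc => f (d.out +ᵥ ρ)).subset ?_
  rintro _ ⟨r, rfl⟩
  exact ⟨Λ.toDisc (r -ᵥ ρ), by simp only [hf.congr (Λ.toDisc_out _), vsub_vadd]⟩

/-- The sum of the values of a periodic function on the shadow over representatives modulo the
lattice. -/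
def classSum (f : Λ.shadow → ℂ) : ℂ :=
  ∑ d : Λ.Disc, f (d.out +ᵥ (Classical.arbitrary Λ.shadow))

theorem classSum_mul_left (c : ℂ) (f : Λ.shadow → ℂ) :
    classSum (fun r => c * f r) = c * classSum f :=
  (Finset.mul_sum _ _ _).symm

theorem classSum_comm (f : Λ.shadow → Λ.shadow → ℂ) :
    classSum (fun r => classSum fun s => f r s) = classSum fun s => classSum fun r => f r s :=
  Finset.sum_comm

theorem IsPeriodic.classSum_eq {f : Λ.shadow → ℂ} (hf : IsPeriodic f) (ρ : Λ.shadow) :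
    classSum f = ∑ d : Λ.Disc, f (d.out +ᵥ ρ) := by
  let t : Λ.dual := ρ -ᵥ Classical.arbitrary Λ.shadow
  rw [classSum, ← Equiv.sum_comp (Equiv.addRight (Λ.toDisc t))]
  refine Finset.sum_congr rfl fun d _ => ?_
  rw [← vsub_vadd ρ (Classical.arbitrary Λ.shadow), ← add_vadd]
  exact hf.congr (by simp only [toDisc_out, map_add, Equiv.coe_addRight, t]) _

theorem IsPeriodic.classSum_vadd {f : Λ.shadow → ℂ} (hf : IsPeriodic f) (x : Λ.dual) :
    classSum (fun r => f (x +ᵥ r)) = classSum f := by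
  rw [hf.classSum_eq (x +ᵥ Classical.arbitrary Λ.shadow)]
  exact Finset.sum_congr rfl fun d _ => congrArg f (vadd_comm _ _ _)

theorem tsum_shadow_eq_classSum {f : Λ.shadow → ℂ} (hf : Summable f) :
    ∑' r, f r = classSum fun r => ∑' l : L, f (Λ.inclDual l +ᵥ r) := by
  let E := Equiv.vaddConst (Classical.arbitrary Λ.shadow)
  rw [← E.tsum_eq]
  refine (tsum_eq_sum_tsum_out_add Λ.inclDual_injective Λ.range_inclDual
    (E.summable_iff.2 hf)).trans ?_
  refine Finset.sum_congr rfl fun d _ => tsum_congr fun l => ?_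
  rw [vadd_vadd, add_comm]
  rfl

end ClassSum

/-! ### The Weil operators -/

theorem isPeriodic_mul_e_neg_formQ (a : Λ.W) (s : Λ.shadow) :
    IsPeriodic fun r : Λ.shadow => a.1 r * e (-Λ.formQ r s) := fun l r => by
  simp only [W_vadd, coe_vadd, coe_inclDual, map_add, LinearMap.add_apply, Λ.formQ_symm (inclQ L l)]
  push_cast
  rw [neg_add, e_add, e_neg (Λ.formQ s _), e_formQ_shadow, e_quad_inv]
  linear_combination a.1 r * e (-Λ.formQ r s) * Λ.e_quad_mul_self l

variable (Λ) in
/-- The action of `τ ↦ τ + 1` on `W`: multiplication by `e(β(r))`. -/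
def weilT : Module.End ℂ Λ.W where
  toFun a := ⟨fun r => e (Λ.quadQ (r : ℚ ⊗[ℤ] L)) * a.1 r, mem_W_iff.2 fun l r => by
    have h := Λ.isPeriodic_e_quadQ l r
    beta_reduce at h
    rw [h, W_vadd, mul_left_comm]⟩
  map_add' a b := Subtype.ext <| funext fun r => mul_add _ _ _
  map_smul' t a := Subtype.ext <| funext fun r => mul_left_comm _ _ _

theorem weilT_apply (a : Λ.W) (r : Λ.shadow) :
    (Λ.weilT a).1 r = e (Λ.quadQ (r : ℚ ⊗[ℤ] L)) * a.1 r := rfl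

variable [Module.Free ℤ L] [Module.Finite ℤ L]

theorem eq_inclDual_vadd_out (ρ r : Λ.shadow) :
    ∃ l : L, r = Λ.inclDual l +ᵥ ((Λ.toDisc (r -ᵥ ρ)).out +ᵥ ρ) := by
  obtain ⟨l, hl⟩ := Λ.toDisc_eq_iff.1 (Λ.toDisc_out (Λ.toDisc (r -ᵥ ρ)))
  exact ⟨l, by rw [← add_vadd, add_comm, ← hl, vsub_vadd]⟩

/-- The coordinates on `W` given by the choice of an element `ρ` of the shadow: a function `b` on
`L^# / L` corresponds to `ρ + x ↦ e(β(x)) b(x + L)`. -/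
def coeffEquiv (ρ : Λ.shadow) : (Λ.Disc → ℂ) ≃ₗ[ℂ] Λ.W where
  toFun b := ⟨fun r => e (Λ.quadQ (r -ᵥ ρ : Λ.dual)) * b (Λ.toDisc (r -ᵥ ρ)), mem_W_iff.2
    fun l r => by
      rw [vadd_vsub_assoc, map_add, toDisc_inclDual, zero_add, AddSubgroup.coe_add, coe_inclDual,
        add_comm (inclQ L l), e_quadQ_add_inclQ_dual, mul_assoc]⟩
  map_add' b b' := Subtype.ext <| funext fun r => mul_add _ _ _
  map_smul' t b := Subtype.ext <| funext fun r => mul_left_comm _ _ _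
  invFun a := fun d => (e (Λ.quadQ (d.out : Λ.dual)))⁻¹ * a.1 (d.out +ᵥ ρ)
  left_inv b := by
    ext d
    simp only [vadd_vsub, toDisc_out]
    rw [inv_mul_cancel_left₀ (e_ne_zero _)]
  right_inv a := by
    ext r
    obtain ⟨l, hr⟩ := eq_inclDual_vadd_out ρ r
    have hl : r -ᵥ ρ = (Λ.toDisc (r -ᵥ ρ)).out + Λ.inclDual l := by
      conv_lhs => rw [hr, vadd_vsub_assoc, vadd_vsub, add_comm]
    conv_rhs => rw [hr, W_vadd]
    simp only
    rw [congrArg Subtype.val hl, AddSubgroup.coe_add, coe_inclDual, e_quadQ_add_inclQ_dual,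
      mul_assoc, mul_inv_cancel_left₀ (e_ne_zero _)]

theorem coeffEquiv_vadd (ρ : Λ.shadow) (b : Λ.Disc → ℂ) (x : Λ.dual) :
    (coeffEquiv ρ b).1 (x +ᵥ ρ) = e (Λ.quadQ (x : ℚ ⊗[ℤ] L)) * b (Λ.toDisc x) := by
  change e (Λ.quadQ ((x +ᵥ ρ) -ᵥ ρ : Λ.dual)) * b (Λ.toDisc ((x +ᵥ ρ) -ᵥ ρ)) = _
  rw [vadd_vsub]

instance : Nontrivial Λ.W := (coeffEquiv (Classical.arbitrary Λ.shadow)).symm.nontrivial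

variable (Λ) in
/-- The action of `τ ↦ -1 / τ` on `W`, up to a scalar: the Fourier transform with kernel
`e(-β(r, s))` over the shadow modulo the lattice. -/
def weilS : Module.End ℂ Λ.W where
  toFun a := ⟨fun s => classSum fun r => a.1 r * e (-Λ.formQ r s), mem_W_iff.2 fun l s => by
    rw [← classSum_mul_left]
    congr 1
    ext r
    rw [coe_vadd, coe_inclDual, map_add]
    push_cast
    rw [neg_add, e_add, e_neg (Λ.formQ r (inclQ L l)), e_formQ_shadow, e_quad_inv]
    ring⟩
  map_add' a b := Subtype.ext <| funext fun s => by
    simp only [Submodule.coe_add, Pi.add_apply, classSum, add_mul, Finset.sum_add_distrib]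
  map_smul' t a := Subtype.ext <| funext fun s => by
    simp only [Submodule.coe_smul, Pi.smul_apply, smul_eq_mul, mul_assoc, classSum_mul_left,
      RingHom.id_apply]

theorem weilS_apply (a : Λ.W) (s : Λ.shadow) :
    (Λ.weilS a).1 s = classSum fun r => a.1 r * e (-Λ.formQ r s) := rfl

variable (Λ) in
/-- The Gauss sum `∑ e(β(r))` over the shadow modulo the lattice. -/
def gaussSum : ℂ := classSum fun r : Λ.shadow => e (Λ.quadQ (r : ℚ ⊗[ℤ] L))

-- Completing the square: `β(r) + β(s) + β(t) - β(r, t) - β(t, s) = β(t - (r + s)) - β(r, s)`.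
theorem weilT_weilS_weilT_weilS_weilT (a : Λ.W) :
    Λ.weilT (Λ.weilS (Λ.weilT (Λ.weilS (Λ.weilT a)))) = Λ.gaussSum • Λ.weilS a := by
  ext s
  change _ = Λ.gaussSum * (Λ.weilS a).1 s
  simp only [weilT_apply, weilS_apply, mul_comm _ (e (-_)), ← classSum_mul_left]
  rw [classSum_comm]
  congr 1
  ext r
  have shift := Λ.isPeriodic_e_quadQ.classSum_vadd
    (-⟨r + s, Λ.add_mem_dual_of_shadow r.2 s.2⟩ : Λ.dual)
  rw [gaussSum, ← shift, mul_comm (classSum _), ← classSum_mul_left]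
  congr 1
  ext t
  have square : Λ.quadQ (-(r + s) + t : ℚ ⊗[ℤ] L) =
      Λ.quadQ s - Λ.formQ t s + (Λ.quadQ t - Λ.formQ r t + Λ.quadQ r) + Λ.formQ r s := by
    simp only [quadQ_add, quadQ_neg, map_neg, map_add, LinearMap.neg_apply, LinearMap.add_apply,
      Λ.formQ_symm s t]
    ring
  rw [coe_vadd, AddSubgroup.coe_neg, square]
  simp only [Rat.cast_add, Rat.cast_neg, sub_eq_add_neg, e_add, e_neg]
  field_simp [e_ne_zero]

end PosDefLattice

/-! ### Poisson summation for lattices -/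

section PiProd

variable {𝕜 α : Type*} [NormedField 𝕜] {n : ℕ} {f : Fin n → α → 𝕜}

theorem summable_norm_pi_prod (hf : ∀ i, Summable fun a => ‖f i a‖) :
    Summable fun k : Fin n → α => ‖∏ i, f i (k i)‖ := by
  induction n with
  | zero => exact .of_finite
  | succ n ih =>
    rw [← (Fin.consEquiv fun _ : Fin (n + 1) => α).summable_iff]
    refine ((hf 0).mul_of_nonneg (ih fun i => hf i.succ) (fun _ => norm_nonneg _)
      fun _ => norm_nonneg _).congr fun x => ?_
    rw [Function.comp_apply, Fin.prod_univ_succ, norm_mul]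
    rfl

theorem tsum_pi_prod [CompleteSpace 𝕜] (hf : ∀ i, Summable fun a => ‖f i a‖) :
    ∑' k : Fin n → α, ∏ i, f i (k i) = ∏ i, ∑' a, f i a := by
  induction n with
  | zero => simp
  | succ n ih =>
    rw [Fin.prod_univ_succ, ← ih fun i => hf i.succ,
      tsum_mul_tsum_of_summable_norm (hf 0) (summable_norm_pi_prod fun i => hf i.succ),
      ← (Fin.consEquiv fun _ : Fin (n + 1) => α).tsum_eq]
    refine tsum_congr fun x => ?_
    rw [Fin.prod_univ_succ]
    rfl

end PiProd

theorem sum_addChar_out {A : Type*} [AddCommGroup A] {S : AddSubgroup A} [Fintype (A ⧸ S)]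
    (ψ : AddChar A ℂ) (hψ : ∀ x ∈ S, ψ x = 1) [Decidable (∀ x, ψ x = 1)] :
    ∑ g : A ⧸ S, ψ g.out = if ∀ x, ψ x = 1 then (Fintype.card (A ⧸ S) : ℂ) else 0 := by
  classical
  have hout (x : A) : ψ (QuotientAddGroup.mk x : A ⧸ S).out = ψ x := by
    obtain ⟨s, hs⟩ := QuotientAddGroup.mk_out_eq_add S x
    rw [hs, AddChar.map_add_eq_mul, hψ s s.2, mul_one]
  let χ : AddChar (A ⧸ S) ℂ :=
    { toFun g := ψ g.out
      map_zero_eq_one' := (hout 0).trans ψ.map_zero_eq_one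
      map_add_eq_mul' g h := by
        obtain ⟨x, rfl⟩ := QuotientAddGroup.mk_surjective g
        obtain ⟨y, rfl⟩ := QuotientAddGroup.mk_surjective h
        rw [← QuotientAddGroup.mk_add, hout, hout, hout, AddChar.map_add_eq_mul] }
  have hχ : χ = 0 ↔ ∀ x, ψ x = 1 := by
    rw [AddChar.eq_zero_iff]
    exact ⟨fun h x => (hout x).symm.trans (h x), fun h g => h g.out⟩
  have h := χ.sum_eq_ite
  simp only [hχ] at h
  exact h

/-- The square root of `-iτ` with positive real part. -/
def rootS (τ : ℂ) : ℂ := (-Complex.I * τ) ^ (1 / 2 : ℂ)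

theorem rootS_real_mul {a : ℝ} (ha : 0 < a) (τ : ℂ) : rootS (a * τ) = (√a : ℝ) * rootS τ := by
  rcases eq_or_ne τ 0 with rfl | hτ
  · simp [rootS]
  have h : -Complex.I * τ ≠ 0 := by simp [hτ]
  rw [rootS, rootS, mul_left_comm,
    Complex.cpow_def_of_ne_zero (mul_ne_zero (by exact_mod_cast ha.ne') h),
    Complex.cpow_def_of_ne_zero h, Complex.log_ofReal_mul ha h, add_mul, Complex.exp_add,
    Real.sqrt_eq_rpow, Real.rpow_def_of_pos ha]
  push_cast
  rfl

theorem coe_S_smul (τ : ℍ) : ((ModularGroup.S • τ : ℍ) : ℂ) = -1 / (τ : ℂ) := by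
  rw [UpperHalfPlane.modular_S_smul, UpperHalfPlane.coe_mk, inv_neg, neg_div, one_div]

theorem jacobiTheta₂_pos_mul {a : ℝ} (ha : 0 < a) (τ : ℍ) (z : ℂ) :
    jacobiTheta₂ z (a * τ) = (√a : ℝ)⁻¹ * (rootS τ)⁻¹ * e (-(z ^ 2 / (2 * a)) / τ) *
      jacobiTheta₂ ((τ : ℂ)⁻¹ * z / a) ((ModularGroup.S • τ : ℍ) / a) := by
  have ha' : (a : ℂ) ≠ 0 := by exact_mod_cast ha.ne'
  have hτ := τ.ne_zero
  have hexp : -Real.pi * Complex.I * z ^ 2 / (a * τ) =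
      2 * Real.pi * Complex.I * (-(z ^ 2 / (2 * a)) / τ) := by
    field_simp
  have harg : z / (a * τ) = (τ : ℂ)⁻¹ * z / a := by field_simp
  have hS : -1 / (a * τ : ℂ) = -1 / (τ : ℂ) / a := by field_simp
  rw [jacobiTheta₂_functional_equation, ← rootS, rootS_real_mul ha, one_div, mul_inv, coe_S_smul, e,
    hexp, harg, hS, Complex.ofReal_inv]

namespace PosDefLattice

variable {L : Type*} [AddCommGroup L] (Λ : PosDefLattice L)

/-- The term `q^{β(r)} e(β(r, z))` of the theta series. -/
def term (τ : ℂ) (z : ℂ ⊗[ℤ] L) (r : ℚ ⊗[ℤ] L) : ℂ :=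
  e (Λ.quadQ r * τ) * e (Λ.formC (inclC L r) z)

theorem term_ne_zero (τ : ℂ) (z : ℂ ⊗[ℤ] L) (r : ℚ ⊗[ℤ] L) : Λ.term τ z r ≠ 0 :=
  mul_ne_zero (e_ne_zero _) (e_ne_zero _)

theorem term_add (τ : ℂ) (z : ℂ ⊗[ℤ] L) (r s : ℚ ⊗[ℤ] L) :
    Λ.term τ z (r + s) = Λ.term τ z r * Λ.term τ (z + τ • inclC L r) s := by
  simp only [term, ← e_add]
  congr 1
  rw [quadQ_add, map_add, map_add, LinearMap.add_apply, map_add (Λ.formC (inclC L s)), map_smul,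
    formC_inclC, Λ.formQ_symm s r]
  push_cast
  simp only [smul_eq_mul]
  ring

theorem term_add_arg (τ : ℂ) (z : ℂ ⊗[ℤ] L) (r s : ℚ ⊗[ℤ] L) :
    Λ.term τ (z + inclC L s) r = Λ.term τ z r * e (Λ.formQ s r) := by
  rw [term, term, map_add, formC_inclC, Λ.formQ_symm, e_add, mul_assoc]

theorem term_mul_e_quadC (τ : ℍ) (z : ℂ ⊗[ℤ] L) (r : ℚ ⊗[ℤ] L) :
    Λ.term τ z r * e (-Λ.quadC (z + (τ : ℂ) • inclC L r) / τ) = e (-Λ.quadC z / τ) := by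
  have hτ := τ.ne_zero
  rw [term, ← e_add, ← e_add, quadC_add, quadC_smul, quadC_inclC, map_smul, smul_eq_mul,
    Λ.formC_symm z]
  congr 1
  field_simp
  ring

/-- An orthogonal basis of `ℚ ⊗ L` consisting of vectors of `L`. -/
structure OrthoFrame where
  v : Fin (Module.finrank ℤ L) → L
  basis : Module.Basis (Fin (Module.finrank ℤ L)) ℚ (ℚ ⊗[ℤ] L)
  coe_basis : ∀ i, basis i = inclQ L (v i)
  ortho : ∀ i j, i ≠ j → Λ.form (v i) (v j) = 0

theorem nonempty_orthoFrame [Module.Free ℤ L] [Module.Finite ℤ L] : Nonempty Λ.OrthoFrame := by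
  obtain ⟨u', hu'⟩ := LinearMap.BilinForm.exists_orthogonal_basis (B := Λ.formQ) ⟨Λ.formQ_symm⟩
  have hd : Module.finrank ℚ (ℚ ⊗[ℤ] L) = Module.finrank ℤ L := Module.finrank_baseChange
  let u := u'.reindex (finCongr hd)
  have hu (i j) (hij : i ≠ j) : Λ.formQ (u i) (u j) = 0 := by
    simp only [u, Module.Basis.reindex_apply]
    exact hu' (by simpa using hij)
  choose N v hN hv using fun i => exists_nsmul_eq_inclQ (u i)
  have hN_unit (i) : IsUnit (N i : ℚ) := isUnit_iff_ne_zero.2 (by exact_mod_cast (hN i).ne')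
  refine ⟨v, u.isUnitSMul hN_unit, fun i => (u.isUnitSMul_apply hN_unit i).trans (hv i),
    fun i j hij => ?_⟩
  rw [← Int.cast_inj (α := ℚ), ← formQ_inclQ, ← hv, ← hv]
  simp [hu i j hij]

namespace OrthoFrame

variable {Λ} (B : Λ.OrthoFrame)

/-- The values `β(vᵢ, vᵢ)` on the vectors of the frame. -/
def norm (i : Fin (Module.finrank ℤ L)) : ℤ := Λ.form (B.v i) (B.v i)

theorem norm_pos (i : Fin (Module.finrank ℤ L)) : 0 < B.norm i := by
  refine Λ.pos _ fun h => B.basis.ne_zero i ?_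
  rw [B.coe_basis, h, map_zero]

theorem norm_ne_zero {R : Type*} [Ring R] [CharZero R] (i : Fin (Module.finrank ℤ L)) :
    (B.norm i : R) ≠ 0 := by
  exact_mod_cast (B.norm_pos i).ne'

theorem formQ_basis (i j : Fin (Module.finrank ℤ L)) :
    Λ.formQ (B.basis i) (B.basis j) = if i = j then (B.norm i : ℚ) else 0 := by
  rw [B.coe_basis, B.coe_basis, formQ_inclQ]
  split_ifs with h
  · rw [h, norm]
  · rw [B.ortho i j h, Int.cast_zero]

theorem formQ_sum_basis (t : Fin (Module.finrank ℤ L) → ℚ) (j : Fin (Module.finrank ℤ L)) :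
    Λ.formQ (∑ i, t i • B.basis i) (B.basis j) = t j * B.norm j := by
  simp [formQ_basis]

theorem quadQ_sum_basis (t : Fin (Module.finrank ℤ L) → ℚ) :
    Λ.quadQ (∑ i, t i • B.basis i) = ∑ i, B.norm i * t i ^ 2 / 2 := by
  rw [quadQ, map_sum, Finset.sum_div]
  refine Finset.sum_congr rfl fun i _ => ?_
  rw [map_smul, formQ_sum_basis, smul_eq_mul]
  ring

theorem sum_formQ_div_norm (r : ℚ ⊗[ℤ] L) :
    ∑ i, (Λ.formQ r (B.basis i) / B.norm i) • B.basis i = r := by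
  conv_rhs => rw [← B.basis.sum_repr r]
  refine Finset.sum_congr rfl fun i _ => ?_
  conv_lhs => rw [← B.basis.sum_repr r, formQ_sum_basis, mul_div_cancel_right₀ _ (B.norm_ne_zero i)]

/-- The coordinates `β(vᵢ, z)` of a point `z`. -/
def coord (z : ℂ ⊗[ℤ] L) (i : Fin (Module.finrank ℤ L)) : ℂ := Λ.formC (inclC L (B.basis i)) z

theorem sum_coord_div_norm (z : ℂ ⊗[ℤ] L) :
    ∑ i, (B.coord z i / B.norm i) • inclC L (B.basis i) = z := by
  induction z using TensorProduct.induction_on with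
  | zero => simp [coord]
  | add z w hz hw =>
    conv_rhs => rw [← hz, ← hw]
    simp [coord, ← Finset.sum_add_distrib, add_div, add_smul]
  | tmul t x =>
    have htx : t ⊗ₜ[ℤ] x = t • inclC L (inclQ L x) := by
      simp [inclC_inclQ, TensorProduct.smul_tmul']
    conv_rhs => rw [htx, ← B.sum_formQ_div_norm (inclQ L x), map_sum, Finset.smul_sum]
    refine Finset.sum_congr rfl fun i _ => ?_
    rw [inclC_smul, smul_smul, htx, coord, map_smul, formC_inclC, Λ.formQ_symm]
    push_cast
    rw [smul_eq_mul, mul_div_assoc]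

theorem quadC_eq_sum_coord (z : ℂ ⊗[ℤ] L) :
    Λ.quadC z = ∑ i, B.coord z i ^ 2 / (2 * B.norm i) := by
  rw [quadC]
  conv_lhs => enter [1, 1, 2]; rw [← B.sum_coord_div_norm z]
  simp only [map_sum, LinearMap.sum_apply, map_smul, LinearMap.smul_apply, Finset.sum_div]
  refine Finset.sum_congr rfl fun i _ => ?_
  rw [← coord, smul_eq_mul]
  field_simp [B.norm_ne_zero i]

theorem term_sum_basis (τ : ℂ) (z : ℂ ⊗[ℤ] L) (t : Fin (Module.finrank ℤ L) → ℚ) :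
    Λ.term τ z (∑ i, t i • B.basis i) =
      ∏ i, e (B.norm i * t i ^ 2 / 2 * τ + t i * B.coord z i) := by
  rw [term, quadQ_sum_basis, ← e_add, ← e_sum, Finset.sum_add_distrib, map_sum, map_sum,
    LinearMap.sum_apply]
  push_cast
  simp only [inclC_smul]
  simp only [Finset.sum_mul, map_smul, LinearMap.smul_apply, coord, smul_eq_mul]

/-- The embedding of `ℤ^n` into `L` given by the frame. -/
def latticeHom : (Fin (Module.finrank ℤ L) → ℤ) →+ L where
  toFun k := ∑ i, k i • B.v i
  map_zero' := by simp
  map_add' k l := by simp [add_smul, Finset.sum_add_distrib]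

theorem inclQ_latticeHom (k : Fin (Module.finrank ℤ L) → ℤ) :
    inclQ L (B.latticeHom k) = ∑ i, (k i : ℚ) • B.basis i := by
  simp [latticeHom, coe_basis, Int.cast_smul_eq_zsmul]

theorem latticeHom_injective : Function.Injective B.latticeHom := fun k l h => by
  ext i
  have hi := congrArg (fun x => Λ.formQ (inclQ L x) (B.basis i)) h
  simpa [inclQ_latticeHom, formQ_basis, B.norm_ne_zero i] using hi

/-- The elements of the dual of the lattice spanned by the frame. -/
def dualPoint (k : Fin (Module.finrank ℤ L) → ℤ) : ℚ ⊗[ℤ] L :=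
  ∑ i, ((k i : ℚ) / B.norm i) • B.basis i

theorem formQ_dualPoint (k : Fin (Module.finrank ℤ L) → ℤ) (i : Fin (Module.finrank ℤ L)) :
    Λ.formQ (B.dualPoint k) (B.basis i) = k i := by
  rw [dualPoint, formQ_sum_basis, div_mul_cancel₀ _ (B.norm_ne_zero i)]

theorem formQ_latticeHom_dualPoint (m k : Fin (Module.finrank ℤ L) → ℤ) :
    Λ.formQ (inclQ L (B.latticeHom m)) (B.dualPoint k) = ((∑ i, m i * k i : ℤ) : ℚ) := by
  rw [inclQ_latticeHom, formQ_symm]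
  simp [formQ_dualPoint]

/-- The coordinates `β(x, vᵢ)` of an element `x` of the dual. -/
def dualCoord (x : Λ.dual) (i : Fin (Module.finrank ℤ L)) : ℤ :=
  (x.2 (B.v i)).choose

theorem dualCoord_spec (x : Λ.dual) (i : Fin (Module.finrank ℤ L)) :
    (B.dualCoord x i : ℚ) = Λ.formQ x (B.basis i) := by
  rw [coe_basis]
  exact (x.2 (B.v i)).choose_spec.symm

theorem dualPoint_dualCoord (x : Λ.dual) : B.dualPoint (B.dualCoord x) = x := by
  simp only [dualPoint, dualCoord_spec, sum_formQ_div_norm]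

theorem dualCoord_injective : Function.Injective B.dualCoord := fun x y h =>
  Subtype.ext (by rw [← B.dualPoint_dualCoord, h, dualPoint_dualCoord])

theorem mem_range_dualCoord {k : Fin (Module.finrank ℤ L) → ℤ} (hk : B.dualPoint k ∈ Λ.dual) :
    k ∈ Set.range B.dualCoord :=
  ⟨⟨_, hk⟩, funext fun i => by
    rw [← Int.cast_inj (α := ℚ), dualCoord_spec, formQ_dualPoint]⟩

theorem term_latticeHom (τ : ℂ) (z : ℂ ⊗[ℤ] L) (k : Fin (Module.finrank ℤ L) → ℤ) :
    Λ.term τ z (inclQ L (B.latticeHom k)) =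
      ∏ i, jacobiTheta₂_term (k i) (B.coord z i) (B.norm i * τ) := by
  rw [inclQ_latticeHom, term_sum_basis]
  refine Finset.prod_congr rfl fun i _ => ?_
  rw [e, jacobiTheta₂_term]
  congr 1
  push_cast
  ring

theorem term_dualPoint (τ : ℂ) (z : ℂ ⊗[ℤ] L) (k : Fin (Module.finrank ℤ L) → ℤ) :
    Λ.term τ z (B.dualPoint k) =
      ∏ i, jacobiTheta₂_term (k i) (B.coord z i / B.norm i) (τ / B.norm i) := by
  rw [dualPoint, term_sum_basis]
  refine Finset.prod_congr rfl fun i _ => ?_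
  rw [e, jacobiTheta₂_term]
  congr 1
  push_cast
  field_simp [B.norm_ne_zero i]
  ring

theorem summable_norm_jacobiTheta₂_term_mul (z : ℂ) (τ : ℍ) (i : Fin (Module.finrank ℤ L)) :
    Summable fun k => ‖jacobiTheta₂_term k z (B.norm i * τ)‖ := by
  have h : (0 : ℝ) < B.norm i := by exact_mod_cast B.norm_pos i
  refine ((summable_jacobiTheta₂_term_iff _ _).2 ?_).norm
  rw [← Complex.ofReal_intCast, Complex.im_ofReal_mul]
  exact mul_pos h τ.im_pos

theorem summable_norm_jacobiTheta₂_term_div (z : ℂ) (τ : ℍ) (i : Fin (Module.finrank ℤ L)) :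
    Summable fun k => ‖jacobiTheta₂_term k z (τ / B.norm i)‖ := by
  have h : (0 : ℝ) < B.norm i := by exact_mod_cast B.norm_pos i
  refine ((summable_jacobiTheta₂_term_iff _ _).2 ?_).norm
  rw [← Complex.ofReal_intCast, Complex.div_ofReal_im]
  exact div_pos τ.im_pos h

theorem summable_term_dualPoint (τ : ℍ) (z : ℂ ⊗[ℤ] L) :
    Summable fun k => ‖Λ.term τ z (B.dualPoint k)‖ := by
  simp only [term_dualPoint]
  exact summable_norm_pi_prod
    (f := fun i k => jacobiTheta₂_term k (B.coord z i / B.norm i) (τ / B.norm i))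
    fun i => B.summable_norm_jacobiTheta₂_term_div _ τ i

theorem tsum_term_latticeHom (τ : ℍ) (z : ℂ ⊗[ℤ] L) :
    ∑' k, Λ.term τ z (inclQ L (B.latticeHom k)) =
      (∏ i, (√(B.norm i : ℝ))⁻¹ : ℝ) * (rootS τ ^ Module.finrank ℤ L)⁻¹ * e (-Λ.quadC z / τ) *
        ∑' k, Λ.term (ModularGroup.S • τ : ℍ) ((τ : ℂ)⁻¹ • z) (B.dualPoint k) := by
  have hcoord (i) : B.coord ((τ : ℂ)⁻¹ • z) i = (τ : ℂ)⁻¹ * B.coord z i := by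
    rw [coord, map_smul, smul_eq_mul, coord]
  have hinv (i) := jacobiTheta₂_pos_mul (a := B.norm i) (by exact_mod_cast B.norm_pos i) τ
    (B.coord z i)
  simp only [Complex.ofReal_intCast, jacobiTheta₂] at hinv
  simp only [term_latticeHom, term_dualPoint]
  rw [tsum_pi_prod fun i => B.summable_norm_jacobiTheta₂_term_mul _ τ i,
    tsum_pi_prod fun i => B.summable_norm_jacobiTheta₂_term_div _ _ i]
  simp only [hinv, Finset.prod_mul_distrib, hcoord, B.quadC_eq_sum_coord]
  rw [← e_sum]
  simp [neg_div, Finset.sum_div, Finset.sum_neg_distrib]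

theorem tsum_term_add_latticeHom (τ : ℍ) (z : ℂ ⊗[ℤ] L) (r : ℚ ⊗[ℤ] L) :
    ∑' k, Λ.term τ z (r + inclQ L (B.latticeHom k)) =
      (∏ i, (√(B.norm i : ℝ))⁻¹ : ℝ) * (rootS τ ^ Module.finrank ℤ L)⁻¹ * e (-Λ.quadC z / τ) *
        ∑' k, e (Λ.formQ r (B.dualPoint k)) *
          Λ.term (ModularGroup.S • τ : ℍ) ((τ : ℂ)⁻¹ • z) (B.dualPoint k) := by
  have harg : (τ : ℂ)⁻¹ • (z + (τ : ℂ) • inclC L r) = (τ : ℂ)⁻¹ • z + inclC L r := by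
    rw [smul_add, inv_smul_smul₀ τ.ne_zero]
  simp only [term_add, tsum_mul_left, B.tsum_term_latticeHom, harg, term_add_arg,
    mul_comm (e (Λ.formQ _ _))]
  rw [← Λ.term_mul_e_quadC τ z r]
  ring

variable [Module.Free ℤ L] [Module.Finite ℤ L]

instance : Finite (L ⧸ B.latticeHom.range) := by
  have : Module.Finite ℤ (L ⧸ B.latticeHom.range) :=
    Module.Finite.of_surjective (QuotientAddGroup.mk' B.latticeHom.range).toIntLinearMap
      (QuotientAddGroup.mk'_surjective _)
  apply Module.finite_of_fg_torsion
  intro d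
  obtain ⟨x, rfl⟩ := QuotientAddGroup.mk'_surjective _ d
  have hN : ∏ i, B.norm i ≠ 0 := Finset.prod_ne_zero_iff.2 fun i _ => (B.norm_pos i).ne'
  refine ⟨⟨∏ i, B.norm i, mem_nonZeroDivisors_of_ne_zero hN⟩, ?_⟩
  change (∏ i, B.norm i) • QuotientAddGroup.mk' B.latticeHom.range x = 0
  rw [← map_zsmul, QuotientAddGroup.mk'_apply, QuotientAddGroup.eq_zero_iff]
  choose c hc using fun i => Finset.dvd_prod_of_mem B.norm (Finset.mem_univ i)
  refine ⟨fun i => c i * Λ.form x (B.v i), inclQ_injective ?_⟩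
  rw [inclQ_latticeHom, map_zsmul]
  conv_rhs => rw [← B.sum_formQ_div_norm (inclQ L x), Finset.smul_sum]
  refine Finset.sum_congr rfl fun i _ => ?_
  rw [← Int.cast_smul_eq_zsmul ℚ, smul_smul, coe_basis, formQ_inclQ, hc i]
  push_cast
  field_simp [B.norm_ne_zero (R := ℚ) i]

instance : Fintype (L ⧸ B.latticeHom.range) := Fintype.ofFinite _

theorem sum_e_formQ_dualPoint (k : Fin (Module.finrank ℤ L) → ℤ)
    [Decidable (B.dualPoint k ∈ Λ.dual)] :
    ∑ g : L ⧸ B.latticeHom.range, e (Λ.formQ (inclQ L g.out) (B.dualPoint k)) =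
      if B.dualPoint k ∈ Λ.dual then (Fintype.card (L ⧸ B.latticeHom.range) : ℂ) else 0 := by
  classical
  let ψ : AddChar L ℂ :=
    { toFun l := e (Λ.formQ (inclQ L l) (B.dualPoint k))
      map_zero_eq_one' := by simp [e_zero]
      map_add_eq_mul' l m := by simp [e_add] }
  have hψ : ∀ l ∈ B.latticeHom.range, ψ l = 1 := by
    rintro _ ⟨m, rfl⟩
    change e _ = 1
    rw [formQ_latticeHom_dualPoint, Rat.cast_intCast, e_int]
  have hmem : B.dualPoint k ∈ Λ.dual ↔ ∀ l, ψ l = 1 := forall_congr' fun l => by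
    change _ ↔ e (Λ.formQ (inclQ L l) (B.dualPoint k)) = 1
    rw [Λ.formQ_symm, ← e_zero, ← Rat.cast_zero, e_ratCast_inj, coe_addCircle_eq_iff]
    simp only [zero_add]
  simp only [hmem]
  exact sum_addChar_out ψ hψ

end OrthoFrame

end PosDefLattice

theorem rootS_ne_zero (τ : ℍ) : rootS τ ≠ 0 := by
  rw [rootS, Ne, Complex.cpow_eq_zero_iff]
  exact fun h => mul_ne_zero (neg_ne_zero.2 Complex.I_ne_zero) τ.ne_zero h.1

theorem rootS_sq (τ : ℂ) : rootS τ ^ 2 = -Complex.I * τ := by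
  rw [rootS, one_div]
  exact Complex.cpow_nat_inv_pow _ two_ne_zero

theorem rootS_S_smul (τ : ℍ) : rootS (ModularGroup.S • τ : ℍ) = (rootS τ)⁻¹ := by
  have harg : -Complex.I * ((ModularGroup.S • τ : ℍ) : ℂ) = (-Complex.I * τ)⁻¹ := by
    rw [coe_S_smul, mul_inv, ← neg_inv, Complex.inv_I, neg_neg]
    ring
  rw [rootS, rootS, harg, Complex.inv_cpow]
  intro h
  have hre := (Complex.arg_eq_pi_iff.1 h).1
  have him := τ.im_pos
  simp at hre
  linarith

namespace PosDefLattice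

variable {L : Type*} [AddCommGroup L] (Λ : PosDefLattice L)

theorem term_neg_arg (τ : ℂ) (z : ℂ ⊗[ℤ] L) (r : ℚ ⊗[ℤ] L) :
    Λ.term τ (-z) r = Λ.term τ z (-r) := by
  simp only [term, quadQ_neg, map_neg, LinearMap.neg_apply]

variable [Module.Free ℤ L] [Module.Finite ℤ L]

theorem summable_term_dual (τ : ℍ) (z : ℂ ⊗[ℤ] L) : Summable fun x : Λ.dual => Λ.term τ z x := by
  obtain ⟨B⟩ := Λ.nonempty_orthoFrame
  refine ((B.summable_term_dualPoint τ z).of_norm.comp_injective B.dualCoord_injective).congr ?_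
  intro x
  rw [Function.comp_apply, B.dualPoint_dualCoord]

theorem summable_term_inclQ (τ : ℍ) (z : ℂ ⊗[ℤ] L) :
    Summable fun l : L => Λ.term τ z (inclQ L l) := by
  simpa only [Function.comp_def, coe_inclDual] using
    (Λ.summable_term_dual τ z).comp_injective Λ.inclDual_injective

theorem summable_term_shadow (τ : ℍ) (z : ℂ ⊗[ℤ] L) :
    Summable fun r : Λ.shadow => Λ.term τ z r := by
  let ρ : Λ.shadow := Classical.arbitrary _
  rw [← (Equiv.vaddConst ρ).summable_iff]
  refine ((Λ.summable_term_dual τ (z + (τ : ℂ) • inclC L ρ)).mul_left (Λ.term τ z ρ)).congr ?_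
  intro x
  rw [Function.comp_apply, Equiv.coe_vaddConst, coe_vadd, add_comm (x : ℚ ⊗[ℤ] L), term_add]

namespace OrthoFrame

variable {Λ} (B : Λ.OrthoFrame)

theorem tsum_term_inclQ (τ : ℍ) (z : ℂ ⊗[ℤ] L) :
    ∑' l, Λ.term τ z (inclQ L l) =
      ((Fintype.card (L ⧸ B.latticeHom.range) * ∏ i, (√(B.norm i : ℝ))⁻¹ : ℝ) : ℂ) *
        (rootS τ ^ Module.finrank ℤ L)⁻¹ * e (-Λ.quadC z / τ) *
          ∑' x : Λ.dual, Λ.term (ModularGroup.S • τ : ℍ) ((τ : ℂ)⁻¹ • z) x := by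
  classical
  have htwist (g : L ⧸ B.latticeHom.range) :
      Summable fun k => e (Λ.formQ (inclQ L g.out) (B.dualPoint k)) *
        Λ.term (ModularGroup.S • τ : ℍ) ((τ : ℂ)⁻¹ • z) (B.dualPoint k) := by
    refine .of_norm ?_
    simp only [norm_mul, norm_e_ratCast, one_mul]
    exact B.summable_term_dualPoint _ _
  rw [tsum_eq_sum_tsum_out_add B.latticeHom_injective rfl (Λ.summable_term_inclQ τ z)]
  simp only [map_add, tsum_term_add_latticeHom]
  rw [← Finset.mul_sum, ← Summable.tsum_finsetSum fun g _ => htwist g]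
  simp only [← Finset.sum_mul, B.sum_e_formQ_dualPoint, ite_mul, zero_mul]
  rw [← B.dualCoord_injective.tsum_eq]
  · simp only [dualPoint_dualCoord, SetLike.coe_mem, if_true, tsum_mul_left]
    push_cast
    ring
  · exact fun k hk => B.mem_range_dualCoord (of_not_not fun h => hk (if_neg h))

end OrthoFrame

theorem exists_tsum_term_inclQ : ∃ C : ℝ, 0 < C ∧ ∀ (τ : ℍ) (z : ℂ ⊗[ℤ] L),
    ∑' l, Λ.term τ z (inclQ L l) = C * (rootS τ ^ Module.finrank ℤ L)⁻¹ * e (-Λ.quadC z / τ) *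
      ∑' x : Λ.dual, Λ.term (ModularGroup.S • τ : ℍ) ((τ : ℂ)⁻¹ • z) x := by
  obtain ⟨B⟩ := Λ.nonempty_orthoFrame
  refine ⟨_, mul_pos (by exact_mod_cast Fintype.card_pos) (Finset.prod_pos fun i _ => ?_),
    B.tsum_term_inclQ⟩
  exact inv_pos.2 (Real.sqrt_pos.2 (by exact_mod_cast B.norm_pos i))

/-- The positive constant in the inversion formula for theta series, the inverse of the covolume
of the lattice. -/
def inversionConst : ℝ := Λ.exists_tsum_term_inclQ.choose

theorem inversionConst_pos : 0 < Λ.inversionConst := Λ.exists_tsum_term_inclQ.choose_spec.1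

theorem inversionConst_ne_zero : (Λ.inversionConst : ℂ) ≠ 0 := by
  exact_mod_cast Λ.inversionConst_pos.ne'

theorem tsum_term_S_smul (τ : ℍ) (z : ℂ ⊗[ℤ] L) :
    ∑' l, Λ.term (ModularGroup.S • τ : ℍ) ((τ : ℂ)⁻¹ • z) (inclQ L l) =
      Λ.inversionConst * rootS τ ^ Module.finrank ℤ L * e (Λ.quadC z / τ) *
        ∑' x : Λ.dual, Λ.term τ z x := by
  have hS : ModularGroup.S • ModularGroup.S • τ = τ := by
    refine UpperHalfPlane.ext ?_
    rw [coe_S_smul, coe_S_smul, div_div_eq_mul_div, neg_one_mul, neg_div_neg_eq, div_one]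
  have hτ := τ.ne_zero
  have harg : ((-1 / (τ : ℂ))⁻¹ * (τ : ℂ)⁻¹) • z = -z := by
    rw [← neg_one_smul ℂ z]
    congr 1
    field_simp
  have hexp : -((τ : ℂ)⁻¹ ^ 2 * Λ.quadC z) / (-1 / τ) = Λ.quadC z / τ := by field_simp
  rw [Λ.exists_tsum_term_inclQ.choose_spec.2, ← inversionConst, hS, rootS_S_smul, inv_pow, inv_inv,
    quadC_smul, coe_S_smul, smul_smul, harg, hexp, ← (Equiv.neg Λ.dual).tsum_eq]
  simp only [term_neg_arg, Equiv.neg_apply, AddSubgroup.coe_neg, neg_neg]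

end PosDefLattice

/-! ### The transformation laws of theta series -/

theorem coe_T_smul (τ : ℍ) : ((ModularGroup.T • τ : ℍ) : ℂ) = τ + 1 := by
  rw [UpperHalfPlane.modular_T_smul, UpperHalfPlane.coe_vadd, Complex.ofReal_one, add_comm]

namespace PosDefLattice

variable {L : Type*} [AddCommGroup L] (Λ : PosDefLattice L)

theorem theta_eq_tsum (a : Λ.W) (τ : ℍ) (z : ℂ ⊗[ℤ] L) :
    Λ.theta a τ z = ∑' r : Λ.shadow, a.1 r * Λ.term τ z r :=
  tsum_congr fun _ => mul_assoc _ _ _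

theorem theta_T_smul (a : Λ.W) (τ : ℍ) (z : ℂ ⊗[ℤ] L) :
    Λ.theta a (ModularGroup.T • τ) z = Λ.theta (Λ.weilT a) τ z := by
  simp only [theta, weilT_apply, coe_T_smul, mul_add, mul_one, e_add]
  exact tsum_congr fun r => by ring

theorem term_add_tmul (τ : ℂ) (z : ℂ ⊗[ℤ] L) (r : Λ.shadow) (x y : L) :
    Λ.term τ (z + τ ⊗ₜ[ℤ] x + (1 : ℂ) ⊗ₜ[ℤ] y) r *
        e (τ * (Λ.quad x : ℂ) + Λ.formC ((1 : ℂ) ⊗ₜ[ℤ] x) z) =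
      e (Λ.quad y) * Λ.term τ z (Λ.inclDual x +ᵥ r : Λ.shadow) := by
  have hx : τ ⊗ₜ[ℤ] x = τ • inclC L (inclQ L x) := by
    rw [inclC_inclQ, TensorProduct.smul_tmul', smul_eq_mul, mul_one]
  have hterm : e (τ * (Λ.quad x : ℂ) + Λ.formC ((1 : ℂ) ⊗ₜ[ℤ] x) z) =
      Λ.term τ z (inclQ L x) := by
    rw [term, quadQ_inclQ, inclC_inclQ, e_add, mul_comm τ]
  rw [hterm, hx, ← inclC_inclQ y, term_add_arg, Λ.formQ_symm (inclQ L y), e_formQ_shadow,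
    coe_vadd, coe_inclDual, term_add]
  ring

theorem tsum_e_quad_mul_term_vadd (τ : ℂ) (z : ℂ ⊗[ℤ] L) (r : Λ.shadow) :
    ∑' l, e (Λ.quad l) * Λ.term τ z (Λ.inclDual l +ᵥ r : Λ.shadow) =
      Λ.term τ z r * ∑' l, Λ.term τ (z + τ • inclC L r + inclC L r) (inclQ L l) := by
  rw [← tsum_mul_left]
  refine tsum_congr fun l => ?_
  rw [coe_vadd, coe_inclDual, add_comm, term_add, term_add_arg, e_formQ_shadow]
  ring

theorem theta_latticeLaw (a : Λ.W) : Λ.LatticeLaw (Λ.theta a) := by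
  intro x y τ z
  rw [theta_eq_tsum, theta_eq_tsum,
    ← (AddAction.toPerm (Λ.inclDual x)).tsum_eq fun r => a.1 r * Λ.term τ z r,
    ← tsum_mul_right, ← tsum_mul_left]
  refine tsum_congr fun r => ?_
  rw [mul_assoc, term_add_tmul, AddAction.toPerm_apply, W_vadd, e_quad_add]
  linear_combination -Λ.e_quad_mul_self x * (a.1 r * e (Λ.quad y) *
    Λ.term τ z (Λ.inclDual x +ᵥ r : Λ.shadow))

variable [Module.Free ℤ L] [Module.Finite ℤ L]

omit [Module.Free ℤ L] [Module.Finite ℤ L] in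
theorem term_S_smul_mul_e_quadC (τ : ℍ) (z : ℂ ⊗[ℤ] L) (r : ℚ ⊗[ℤ] L) :
    Λ.term (ModularGroup.S • τ : ℍ) ((τ : ℂ)⁻¹ • z) r *
        e (Λ.quadC (z + (τ : ℂ) • inclC L r + inclC L (-r)) / τ) =
      e (Λ.quadC z / τ) * e (-Λ.formQ r r) * Λ.term τ z r := by
  have hτ := τ.ne_zero
  have hr : z + (τ : ℂ) • inclC L r + inclC L (-r) = z + ((τ : ℂ) - 1) • inclC L r := by
    rw [map_neg]
    module
  simp only [hr, term, ← e_add, coe_S_smul, quadC_add, quadC_smul, quadC_inclC, map_smul,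
    smul_eq_mul, Λ.formC_symm z]
  have hform : Λ.formQ r r = 2 * Λ.quadQ r := by
    rw [quadQ]
    ring
  rw [hform, LinearMap.smul_apply, smul_eq_mul]
  congr 1
  push_cast
  field_simp
  ring

theorem tsum_term_vadd_S_smul (r : Λ.shadow) (τ : ℍ) (z : ℂ ⊗[ℤ] L) :
    ∑' l, e (Λ.quad l) *
        Λ.term (ModularGroup.S • τ : ℍ) ((τ : ℂ)⁻¹ • z) (Λ.inclDual l +ᵥ r : Λ.shadow) =
      Λ.inversionConst * rootS τ ^ Module.finrank ℤ L * e (Λ.quadC z / τ) *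
        ∑' s : Λ.shadow, e (-Λ.formQ r s) * Λ.term τ z s := by
  have harg : (τ : ℂ)⁻¹ • z + ((ModularGroup.S • τ : ℍ) : ℂ) • inclC L r + inclC L r =
      (τ : ℂ)⁻¹ • (z + (τ : ℂ) • inclC L r + inclC L (-(r : ℚ ⊗[ℤ] L))) := by
    rw [coe_S_smul, map_neg, smul_add, smul_add, inv_smul_smul₀ τ.ne_zero, neg_div, one_div]
    module
  have hdual (x : Λ.dual) : e (-Λ.formQ r (x +ᵥ r : Λ.shadow)) *
      Λ.term τ z (x +ᵥ r : Λ.shadow) = e (-Λ.formQ r r) * Λ.term τ z r *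
        Λ.term τ (z + (τ : ℂ) • inclC L r + inclC L (-(r : ℚ ⊗[ℤ] L))) x := by
    rw [coe_vadd, add_comm, term_add, term_add_arg, map_add, map_neg, LinearMap.neg_apply,
      Rat.cast_add, Rat.cast_neg, neg_add, e_add]
    ring
  rw [tsum_e_quad_mul_term_vadd, harg,
    ← (Equiv.vaddConst r).tsum_eq fun s : Λ.shadow => e (-Λ.formQ r s) * Λ.term τ z s]
  simp only [Equiv.coe_vaddConst, hdual, tsum_mul_left, tsum_term_S_smul]
  linear_combination Λ.inversionConst * rootS τ ^ Module.finrank ℤ L *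
    (∑' x : Λ.dual, Λ.term τ (z + (τ : ℂ) • inclC L r + inclC L (-(r : ℚ ⊗[ℤ] L))) x) *
    Λ.term_S_smul_mul_e_quadC τ z r

theorem exists_norm_W_le (a : Λ.W) : ∃ M, ∀ r, ‖a.1 r‖ ≤ M := by
  have hper : IsPeriodic fun r : Λ.shadow => ‖a.1 r‖ := fun l r => by
    simp only [W_vadd, norm_mul, norm_e_ratCast, one_mul]
  obtain ⟨M, hM⟩ := hper.finite_range.bddAbove
  exact ⟨M, fun r => hM ⟨r, rfl⟩⟩

theorem summable_W_mul_term (a : Λ.W) (τ : ℍ) (z : ℂ ⊗[ℤ] L) :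
    Summable fun r : Λ.shadow => a.1 r * Λ.term τ z r := by
  obtain ⟨M, hM⟩ := Λ.exists_norm_W_le a
  refine .of_norm_bounded ((Λ.summable_term_shadow τ z).norm.mul_left M) fun r => ?_
  rw [norm_mul]
  exact mul_le_mul_of_nonneg_right (hM r) (norm_nonneg _)

theorem theta_S_smul (a : Λ.W) (τ : ℍ) (z : ℂ ⊗[ℤ] L) :
    Λ.theta a (ModularGroup.S • τ) ((τ : ℂ)⁻¹ • z) =
      Λ.inversionConst * rootS τ ^ Module.finrank ℤ L * e (Λ.quadC z / τ) *
        Λ.theta (Λ.weilS a) τ z := by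
  have hsum (r : Λ.shadow) :
      Summable fun s : Λ.shadow => a.1 r * e (-Λ.formQ r s) * Λ.term τ z s := by
    simp only [mul_assoc]
    refine .mul_left _ (.of_norm ?_)
    simpa only [norm_mul, ← Rat.cast_neg, norm_e_ratCast, one_mul] using
      (Λ.summable_term_shadow τ z).norm
  rw [theta_eq_tsum, theta_eq_tsum, tsum_shadow_eq_classSum (Λ.summable_W_mul_term a _ _)]
  simp only [W_vadd, mul_right_comm _ (a.1 _), tsum_mul_right, tsum_term_vadd_S_smul, weilS_apply]
  simp only [classSum, Finset.sum_mul]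
  rw [Summable.tsum_finsetSum fun d _ => hsum _, Finset.mul_sum]
  refine Finset.sum_congr rfl fun d _ => ?_
  simp only [mul_assoc, tsum_mul_left]
  ring

end PosDefLattice

/-! ### Linear independence of theta series -/

section Fourier

attribute [local instance] instMeasureSpaceUnitAddCircle
  instIsProbabilityMeasureUnitAddCircleVolume

theorem eq_zero_of_hasSum_mFourier {ι d : Type*} [Fintype d] {m : ι → d → ℤ}
    (hm : Function.Injective m) {g : ι → ℂ}
    (h : HasSum (fun i => g i • UnitAddTorus.mFourier (m i)) 0) : g = 0 := by
  classical
  ext i₀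
  let coeff : C(UnitAddTorus d, ℂ) →L[ℂ] ℂ :=
    (innerSL ℂ (UnitAddTorus.mFourierLp (d := d) 2 (m i₀))).comp
      (ContinuousMap.toLp 2 MeasureTheory.volume ℂ)
  have hcoeff (i : ι) :
      coeff (g i • UnitAddTorus.mFourier (m i)) = if i = i₀ then g i₀ else 0 := by
    have orthonormal :=
      orthonormal_iff_ite.1 (UnitAddTorus.orthonormal_mFourier (d := d)) (m i₀) (m i)
    rw [map_smul]
    change g i • inner ℂ (UnitAddTorus.mFourierLp 2 (m i₀)) (UnitAddTorus.mFourierLp 2 (m i)) = _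
    rw [orthonormal]
    rcases eq_or_ne i i₀ with rfl | hi
    · simp
    · rw [if_neg hi, if_neg (hm.ne hi.symm), smul_zero]
  have hsum := coeff.hasSum h
  simp only [hcoeff, map_zero] at hsum
  exact (hasSum_ite_eq i₀ (g i₀)).unique hsum

theorem eq_zero_of_tsum_mFourier_apply_eq_zero {ι d : Type*} [Fintype d] {m : ι → d → ℤ}
    (hm : Function.Injective m) {g : ι → ℂ} (hg : Summable g)
    (h : ∀ t : d → ℝ, ∑' i, g i * ∏ j, e (m i j * t j) = 0) : g = 0 := by
  have hs : Summable fun i => g i • UnitAddTorus.mFourier (m i) := .of_norm <| by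
    simpa only [norm_smul, UnitAddTorus.mFourier_norm, mul_one] using hg.norm
  suffices hzero : ∑' i, g i • UnitAddTorus.mFourier (m i) = 0 from
    eq_zero_of_hasSum_mFourier hm (hzero ▸ hs.hasSum)
  ext x
  choose t ht using fun j => QuotientAddGroup.mk_surjective (x j)
  rw [← ContinuousMap.tsum_apply hs, ContinuousMap.zero_apply, ← h t]
  refine tsum_congr fun i => ?_
  rw [ContinuousMap.smul_apply, smul_eq_mul]
  congr 1
  change ∏ j, fourier (m i j) (x j) = _
  refine Finset.prod_congr rfl fun j _ => ?_
  rw [← ht j, e]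
  refine fourier_coe_apply.trans (congrArg _ ?_)
  push_cast
  ring

end Fourier

namespace PosDefLattice

variable {L : Type*} [AddCommGroup L] [Module.Free ℤ L] [Module.Finite ℤ L]
  {Λ : PosDefLattice L}

theorem eq_zero_of_tsum_e_formC_eq_zero {g : Λ.shadow → ℂ} (hg : Summable g)
    (h : ∀ z, ∑' r : Λ.shadow, g r * e (Λ.formC (inclC L r) z) = 0) : g = 0 := by
  let ρ : Λ.shadow := Classical.arbitrary _
  let E := Equiv.vaddConst ρ
  suffices g ∘ E = 0 from funext fun r => by simpa using congrFun this (E.symm r)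
  refine eq_zero_of_tsum_mFourier_apply_eq_zero (m := fun x => Λ.dualBasis.equivFun x)
    Λ.dualBasis.equivFun.injective (E.summable_iff.2 hg) fun t => ?_
  let z : ℂ ⊗[ℤ] L := ∑ i, (t i : ℂ) • inclC L (ratBasis L i)
  have hrepr (x : Λ.dual) (i) :
      (Λ.formQ x (ratBasis L i) : ℂ) = (Λ.dualBasis.equivFun x i : ℤ) := by
    conv_lhs => rw [← Λ.dualBasis.sum_equivFun x]
    simp only [AddSubgroup.val_finsetSum, AddSubgroup.coe_zsmul, coe_dualBasis, map_sum, map_zsmul,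
      LinearMap.sum_apply, LinearMap.smul_apply, LinearMap.BilinForm.apply_dualBasis_left]
    simp
  have hterm (x : Λ.dual) : e (Λ.formC (inclC L (E x)) z) =
      e (Λ.formC (inclC L ρ) z) * ∏ j, e ((Λ.dualBasis.equivFun x j : ℤ) * t j) := by
    have hx : Λ.formC (inclC L x) z = ∑ j, (Λ.dualBasis.equivFun x j : ℤ) * (t j : ℂ) := by
      simp only [z, map_sum, map_smul, formC_inclC, hrepr, smul_eq_mul, mul_comm]
    rw [Equiv.coe_vaddConst, coe_vadd, map_add, map_add, LinearMap.add_apply, e_add, hx, e_sum,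
      mul_comm]
  have hz := h z
  rw [← E.tsum_eq] at hz
  simp only [hterm, mul_left_comm _ (e (Λ.formC (inclC L ρ) z)), tsum_mul_left] at hz
  exact (mul_eq_zero.1 hz).resolve_left (e_ne_zero _)

/-- The evaluation of theta series at a point, as a linear functional on `W`. -/
def thetaEval (τ : ℍ) (z : ℂ ⊗[ℤ] L) : Λ.W →ₗ[ℂ] ℂ where
  toFun a := Λ.theta a τ z
  map_add' a b := by
    simp only [theta_eq_tsum]
    rw [← (Λ.summable_W_mul_term a τ z).tsum_add (Λ.summable_W_mul_term b τ z)]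
    exact tsum_congr fun r => add_mul _ _ _
  map_smul' c a := by
    simp only [theta_eq_tsum]
    rw [RingHom.id_apply, smul_eq_mul, ← tsum_mul_left]
    exact tsum_congr fun r => mul_assoc _ _ _

theorem thetaEval_apply (τ : ℍ) (z : ℂ ⊗[ℤ] L) (a : Λ.W) : thetaEval τ z a = Λ.theta a τ z := rfl

theorem theta_zero (τ : ℍ) (z : ℂ ⊗[ℤ] L) : Λ.theta 0 τ z = 0 := map_zero (thetaEval τ z)

theorem theta_injective (τ : ℍ) : Function.Injective fun a : Λ.W => Λ.theta a τ := by
  intro a b hab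
  have hsum : Summable fun r : Λ.shadow => (a - b).1 r * e (Λ.quadQ (r : ℚ ⊗[ℤ] L) * τ) := by
    simpa only [term, map_zero, e_zero, mul_one] using Λ.summable_W_mul_term (a - b) τ 0
  have hzero := eq_zero_of_tsum_e_formC_eq_zero hsum fun z => by
    change thetaEval τ z (a - b) = 0
    rw [map_sub, thetaEval_apply, thetaEval_apply, sub_eq_zero]
    exact congrFun hab z
  refine sub_eq_zero.1 (Subtype.ext (funext fun r => ?_))
  exact (mul_eq_zero.1 (congrFun hzero r)).resolve_right (e_ne_zero _)

end PosDefLattice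

/-! ### Holomorphy of theta series -/

section

variable {L : Type*} [AddCommGroup L] [Module.Free ℤ L] [Module.Finite ℤ L]

theorem isHolo_of_differentiableOn {ψ : ℂ → ℂ ⊗[ℤ] L → ℂ}
    (h : DifferentiableOn ℂ (fun p : ℂ × (Fin (Module.finrank ℤ L) → ℂ) => ψ p.1 (ofCoords L p.2))
      {p | 0 < p.1.im}) : IsHolo fun τ : ℍ => ψ τ :=
  h.congr fun p hp => by rw [UpperHalfPlane.ofComplex_apply_of_im_pos hp]

theorem IsHolo.mul {φ ψ : ℍ → ℂ ⊗[ℤ] L → ℂ} (hφ : IsHolo φ) (hψ : IsHolo ψ) :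
    IsHolo fun τ z => φ τ z * ψ τ z :=
  DifferentiableOn.mul hφ hψ

theorem IsHolo.sum {ι : Type*} {u : Finset ι} {φ : ι → ℍ → ℂ ⊗[ℤ] L → ℂ}
    (hφ : ∀ i ∈ u, IsHolo (φ i)) : IsHolo fun τ z => ∑ i ∈ u, φ i τ z :=
  DifferentiableOn.fun_sum hφ

theorem isHolo_of_mdifferentiable {f : ℍ → ℂ} (hf : MDifferentiable 𝓘(ℂ) 𝓘(ℂ) f) :
    IsHolo fun τ (_ : ℂ ⊗[ℤ] L) => f τ :=
  (UpperHalfPlane.mdifferentiable_iff.1 hf).comp differentiableOn_fst fun _ hp => hp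

end

namespace PosDefLattice

variable {L : Type*} [AddCommGroup L] [Module.Free ℤ L] [Module.Finite ℤ L] (Λ : PosDefLattice L)

theorem differentiable_formC_affine (u v w : ℂ ⊗[ℤ] L) :
    Differentiable ℂ fun p : ℂ × (Fin (Module.finrank ℤ L) → ℂ) =>
      Λ.formC u (ofCoords L p.2 + p.1 • v + w) := by
  have hcoords (x : Fin (Module.finrank ℤ L) → ℂ) : Λ.formC u (ofCoords L x) =
      ∑ i, x i * Λ.formC u ((1 : ℂ) ⊗ₜ[ℤ] Module.finBasis ℤ L i) := by
    rw [ofCoords, map_sum]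
    refine Finset.sum_congr rfl fun i _ => ?_
    rw [← smul_eq_mul (x i), ← map_smul, TensorProduct.smul_tmul', smul_eq_mul, mul_one]
  simp only [map_add, map_smul, hcoords, smul_eq_mul]
  fun_prop

theorem differentiable_term_affine (r : ℚ ⊗[ℤ] L) (v w : ℂ ⊗[ℤ] L) :
    Differentiable ℂ fun p : ℂ × (Fin (Module.finrank ℤ L) → ℂ) =>
      Λ.term p.1 (ofCoords L p.2 + p.1 • v + w) r :=
  (differentiable_e.comp (by fun_prop)).mul
    (differentiable_e.comp (Λ.differentiable_formC_affine _ v w))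

namespace OrthoFrame

variable {Λ} (B : Λ.OrthoFrame)

theorem tsum_term_inclQ_eq_prod_jacobiTheta₂ (τ : ℍ) (z : ℂ ⊗[ℤ] L) :
    ∑' l, Λ.term τ z (inclQ L l) = ∑ g : L ⧸ B.latticeHom.range, Λ.term τ z (inclQ L g.out) *
      ∏ i, jacobiTheta₂ (B.coord (z + (τ : ℂ) • inclC L (inclQ L g.out)) i) (B.norm i * τ) := by
  rw [tsum_eq_sum_tsum_out_add B.latticeHom_injective rfl (Λ.summable_term_inclQ τ z)]
  refine Finset.sum_congr rfl fun g _ => ?_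
  simp only [map_add, term_add, tsum_mul_left, term_latticeHom, jacobiTheta₂]
  rw [tsum_pi_prod fun i => B.summable_norm_jacobiTheta₂_term_mul _ τ i]

theorem differentiableOn_jacobiTheta₂_coord (v w : ℂ ⊗[ℤ] L) (i : Fin (Module.finrank ℤ L)) :
    DifferentiableOn ℂ (fun p : ℂ × (Fin (Module.finrank ℤ L) → ℂ) =>
      jacobiTheta₂ (B.coord (ofCoords L p.2 + p.1 • v + w) i) (B.norm i * p.1))
      {p | 0 < p.1.im} := by
  intro p hp
  have him : 0 < (B.norm i * p.1).im := by
    rw [← Complex.ofReal_intCast, Complex.im_ofReal_mul]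
    exact mul_pos (by exact_mod_cast B.norm_pos i) hp
  refine DifferentiableAt.differentiableWithinAt ?_
  exact (hasFDerivAt_jacobiTheta₂ _ him).differentiableAt.comp
    (f := fun p : ℂ × (Fin (Module.finrank ℤ L) → ℂ) =>
      (B.coord (ofCoords L p.2 + p.1 • v + w) i, B.norm i * p.1)) p
    ((Λ.differentiable_formC_affine _ v w p).prodMk (by fun_prop))

end OrthoFrame

theorem isHolo_tsum_term_inclQ (v w : ℂ ⊗[ℤ] L) :
    IsHolo fun τ z => ∑' l, Λ.term τ (z + (τ : ℂ) • v + w) (inclQ L l) := by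
  obtain ⟨B⟩ := Λ.nonempty_orthoFrame
  simp only [B.tsum_term_inclQ_eq_prod_jacobiTheta₂]
  refine IsHolo.sum fun g _ => isHolo_of_differentiableOn (ψ := fun τ z =>
    Λ.term τ (z + τ • v + w) (inclQ L g.out) * ∏ i,
      jacobiTheta₂ (B.coord (z + τ • v + w + τ • inclC L (inclQ L g.out)) i) (B.norm i * τ)) ?_
  have harg (τ : ℂ) (z : ℂ ⊗[ℤ] L) : z + τ • v + w + τ • inclC L (inclQ L g.out) =
      z + τ • (v + inclC L (inclQ L g.out)) + w := by module
  simp only [harg]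
  refine (Λ.differentiable_term_affine _ v w).differentiableOn.mul fun p hp => ?_
  exact (HasFDerivWithinAt.finsetProd fun i _ =>
    (B.differentiableOn_jacobiTheta₂_coord _ w i p hp).hasFDerivWithinAt).differentiableWithinAt

theorem theta_eq_classSum (a : Λ.W) (τ : ℍ) (z : ℂ ⊗[ℤ] L) :
    Λ.theta a τ z = classSum fun r : Λ.shadow => a.1 r * (Λ.term τ z r *
      ∑' l, Λ.term τ (z + (τ : ℂ) • inclC L r + inclC L r) (inclQ L l)) := by
  rw [theta_eq_tsum, tsum_shadow_eq_classSum (Λ.summable_W_mul_term a τ z)]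
  congr 1
  ext r
  rw [← tsum_e_quad_mul_term_vadd, ← tsum_mul_left]
  simp only [W_vadd]
  exact tsum_congr fun l => by ring

theorem isHolo_theta (a : Λ.W) : IsHolo (Λ.theta a) := by
  have hterm (r : ℚ ⊗[ℤ] L) : IsHolo fun τ z => Λ.term τ z r :=
    isHolo_of_differentiableOn (ψ := fun τ z => Λ.term τ z r) <| by
      simpa only [smul_zero, add_zero] using (Λ.differentiable_term_affine r 0 0).differentiableOn
  have htheta : Λ.theta a = _ := funext₂ (Λ.theta_eq_classSum a)
  rw [htheta]
  exact IsHolo.sum fun d _ => (isHolo_of_mdifferentiable mdifferentiable_const).mul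
    ((hterm _).mul (Λ.isHolo_tsum_term_inclQ _ _))

end PosDefLattice

/-! ### The metaplectic group and the slash operators -/

theorem autFactor_eq_denom (A : SL(2, ℤ)) (τ : ℍ) : autFactor A τ = UpperHalfPlane.denom A τ :=
  (ModularGroup.denom_apply A τ).symm

theorem autFactor_ne_zero (A : SL(2, ℤ)) (τ : ℍ) : autFactor A τ ≠ 0 := by
  rw [autFactor_eq_denom]
  exact UpperHalfPlane.denom_ne_zero _ τ

theorem autFactor_one (τ : ℍ) : autFactor 1 τ = 1 := by simp [autFactor]

theorem autFactor_S (τ : ℍ) : autFactor ModularGroup.S τ = τ := by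
  rw [autFactor_eq_denom, ModularGroup.denom_S]

theorem autFactor_T (τ : ℍ) : autFactor ModularGroup.T τ = 1 := by
  simp [autFactor, ModularGroup.T]

theorem autFactor_mul (A B : SL(2, ℤ)) (τ : ℍ) :
    autFactor (A * B) τ = autFactor A (B • τ) * autFactor B τ := by
  have hB := autFactor_ne_zero B τ
  have hcoe : ((B • τ : ℍ) : ℂ) = (B.1 0 0 * τ + B.1 0 1) / autFactor B τ := by
    rw [UpperHalfPlane.coe_specialLinearGroup_apply]
    simp [autFactor]
  rw [autFactor, autFactor, hcoe]
  field_simp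
  simp only [autFactor, Matrix.SpecialLinearGroup.coe_mul, Matrix.mul_apply, Fin.sum_univ_two]
  push_cast
  ring

theorem lowerLeft_mul_autFactor (A B : SL(2, ℤ)) (τ : ℍ) :
    (((A * B).1 1 0 : ℤ) : ℂ) * autFactor B τ = A.1 1 0 + B.1 1 0 * autFactor (A * B) τ := by
  have hdet : (B.1 0 0 : ℂ) * B.1 1 1 - B.1 0 1 * B.1 1 0 = 1 := by
    exact_mod_cast (Matrix.det_fin_two B.1).symm.trans B.2
  simp only [autFactor, Matrix.SpecialLinearGroup.coe_mul, Matrix.mul_apply, Fin.sum_univ_two]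
  push_cast
  linear_combination (A.1 1 0 : ℂ) * hdet

theorem eta_smul_pow (A : SL(2, ℤ)) (τ : ℍ) :
    ModularForm.eta (A • τ : ℍ) ^ 24 = autFactor A τ ^ 12 * ModularForm.eta τ ^ 24 := by
  have h := congrFun (SlashInvariantForm.slash_action_generators_SL2Z
    ModularForm.discriminant_S_invariant ModularForm.discriminant_T_invariant A) τ
  rw [ModularForm.SL_slash_apply, ← autFactor_eq_denom] at h
  simp only [ModularForm.discriminant] at h
  have hne := autFactor_ne_zero A τ
  rw [← h, zpow_neg, zpow_ofNat]
  field_simp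

theorem continuous_eta : Continuous fun τ : ℍ => ModularForm.eta τ :=
  continuous_iff_continuousAt.2 fun τ =>
    (ModularForm.differentiableAt_eta_of_mem_upperHalfPlaneSet τ.2).continuousAt.comp
      UpperHalfPlane.continuous_coe.continuousAt

theorem eta_add_one (τ : ℂ) : ModularForm.eta (τ + 1) = e (1 / 24) * ModularForm.eta τ := by
  have hq (n : ℕ) : ModularForm.eta_q n (τ + 1) = ModularForm.eta_q n τ := by
    simp only [ModularForm.eta_q_eq_pow]
    rw [mul_add, mul_one, Complex.exp_add, Complex.exp_two_pi_mul_I, mul_one]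
  rw [ModularForm.eta, ModularForm.eta]
  simp only [hq]
  rw [← mul_assoc, e, Function.Periodic.qParam, Function.Periodic.qParam, ← Complex.exp_add]
  congr 2
  push_cast
  ring

namespace Metaplectic

theorem w_ne_zero (α : Metaplectic) (τ : ℍ) : α.w τ ≠ 0 := fun h =>
  autFactor_ne_zero α.A τ (by rw [← α.sq, h, zero_pow two_ne_zero])

end Metaplectic

/- The quotient `η(Aτ) / (η(τ) w(τ))` is a continuous function of `τ` with values in the finite set
of `24`-th roots of unity. -/
theorem eta_smul (α : Metaplectic) (τ : ℍ) :
    ModularForm.eta (α.A • τ : ℍ) = epsilon α * (ModularForm.eta τ * α.w τ) := by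
  let g (τ : ℍ) : ℂ := ModularForm.eta (α.A • τ : ℍ) / (ModularForm.eta τ * α.w τ)
  have hne (τ : ℍ) : ModularForm.eta τ * α.w τ ≠ 0 :=
    mul_ne_zero (ModularForm.eta_ne_zero τ.2) (α.w_ne_zero τ)
  have hcont : Continuous g :=
    (continuous_eta.comp (continuous_const_smul (α.A : GL (Fin 2) ℝ))).div
      (continuous_eta.mul α.holo.continuous) hne
  have hpow (τ : ℍ) : g τ ^ 24 = 1 := by
    have hnum : ModularForm.eta (α.A • τ : ℍ) ^ 24 = (ModularForm.eta τ * α.w τ) ^ 24 := by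
      rw [eta_smul_pow, ← α.sq]
      ring
    rw [div_pow, hnum, div_self (pow_ne_zero _ (hne τ))]
  have hfin : {x : ℂ | x ^ 24 = 1}.Finite :=
    (Polynomial.nthRootsFinset 24 (1 : ℂ)).finite_toSet.subset fun x hx => by
      simpa [Polynomial.mem_nthRootsFinset] using hx
  have hconst : g τ = g UpperHalfPlane.I := isPreconnected_univ.constant_of_mapsTo hfin.isDiscrete
    hcont.continuousOn (fun τ _ => hpow τ) (Set.mem_univ _) (Set.mem_univ _)
  rw [← div_eq_iff (hne τ)]
  exact hconst

theorem epsilon_ne_zero (α : Metaplectic) : epsilon α ≠ 0 := fun h =>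
  ModularForm.eta_ne_zero (α.A • UpperHalfPlane.I : ℍ).2 (by
    rw [eta_smul α UpperHalfPlane.I, h, zero_mul])

theorem e_eighth_sq : e (1 / 8) ^ 2 = Complex.I := by
  rw [sq, ← e_add]
  exact (congrArg Complex.exp (by ring)).trans Complex.exp_pi_div_two_mul_I

theorem mdifferentiable_rootS : MDifferentiable 𝓘(ℂ) 𝓘(ℂ) fun τ : ℍ => rootS τ := by
  rw [UpperHalfPlane.mdifferentiable_iff]
  have h : DifferentiableOn ℂ rootS {z | 0 < z.im} := fun z hz =>
    (DifferentiableAt.cpow (by fun_prop) (by fun_prop)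
      (Or.inl (by simpa using hz))).differentiableWithinAt
  exact h.congr fun z hz => by
    rw [Function.comp_apply, UpperHalfPlane.ofComplex_apply_of_im_pos hz]

/-- The element `(S, e(1/8) (-iτ)^{1/2})` of the metaplectic group. -/
def mpS : Metaplectic where
  A := ModularGroup.S
  w τ := e (1 / 8) * rootS τ
  holo := mdifferentiable_const.mul mdifferentiable_rootS
  sq τ := by
    rw [mul_pow, e_eighth_sq, rootS_sq, autFactor_S]
    linear_combination (-τ : ℂ) * Complex.I_mul_I

/-- The element `(T, 1)` of the metaplectic group. -/
def mpT : Metaplectic where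
  A := ModularGroup.T
  w _ := 1
  holo := mdifferentiable_const
  sq τ := by rw [autFactor_T, one_pow]

/-- The element `(1, -1)` of the metaplectic group, the nontrivial one over the identity. -/
def mpZ : Metaplectic where
  A := 1
  w _ := -1
  holo := mdifferentiable_const
  sq τ := by rw [autFactor_one, neg_one_sq]

theorem epsilon_eq_of_eta_smul {α : Metaplectic} {c : ℂ}
    (h : ModularForm.eta (α.A • UpperHalfPlane.I : ℍ) =
      c * (ModularForm.eta UpperHalfPlane.I * α.w UpperHalfPlane.I)) : epsilon α = c :=
  mul_right_cancel₀ (mul_ne_zero (ModularForm.eta_ne_zero UpperHalfPlane.I.2) (α.w_ne_zero _))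
    ((eta_smul α _).symm.trans h)

theorem S_smul_I : ModularGroup.S • UpperHalfPlane.I = UpperHalfPlane.I :=
  UpperHalfPlane.ext (by
    rw [coe_S_smul, UpperHalfPlane.coe_I, neg_div, one_div, Complex.inv_I, neg_neg])

theorem rootS_I : rootS UpperHalfPlane.I = 1 := by
  rw [rootS, UpperHalfPlane.coe_I, neg_mul, Complex.I_mul_I, neg_neg, Complex.one_cpow]

theorem epsilon_mpS : epsilon mpS = (e (1 / 8))⁻¹ := by
  refine epsilon_eq_of_eta_smul ?_
  have he := e_ne_zero (1 / 8)
  simp only [mpS, S_smul_I, rootS_I]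
  field_simp

theorem epsilon_mpT : epsilon mpT = e (1 / 24) :=
  epsilon_eq_of_eta_smul (by simp only [mpT, coe_T_smul, eta_add_one, mul_one])

theorem epsilon_mpZ : epsilon mpZ = -1 :=
  epsilon_eq_of_eta_smul (by simp only [mpZ, one_smul]; ring)

namespace PosDefLattice

variable {L : Type*} [AddCommGroup L] (Λ : PosDefLattice L)

/-- The slash operator of weight `k` on functions on `ℍ × (ℂ ⊗ L)`, a right action of
`SL(2, ℤ)`. -/
def slash (k : ℤ) (A : SL(2, ℤ)) (ψ : ℍ → ℂ ⊗[ℤ] L → ℂ) : ℍ → ℂ ⊗[ℤ] L → ℂ := fun τ z =>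
  ψ (A • τ) ((autFactor A τ)⁻¹ • z) * e (-((A.1 1 0 : ℤ) : ℂ) * Λ.quadC z / autFactor A τ) *
    autFactor A τ ^ (-k)

theorem slash_one (k : ℤ) (ψ : ℍ → ℂ ⊗[ℤ] L → ℂ) : Λ.slash k 1 ψ = ψ := by
  funext τ z
  simp [slash, autFactor_one, e_zero]

theorem slash_mul (k : ℤ) (A B : SL(2, ℤ)) (ψ : ℍ → ℂ ⊗[ℤ] L → ℂ) :
    Λ.slash k (A * B) ψ = Λ.slash k B (Λ.slash k A ψ) := by
  funext τ z
  have hA := autFactor_ne_zero A (B • τ)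
  have hB := autFactor_ne_zero B τ
  have hc := lowerLeft_mul_autFactor A B τ
  rw [autFactor_mul] at hc
  have he : e (-(((A * B).1 1 0 : ℤ) : ℂ) * Λ.quadC z / (autFactor A (B • τ) * autFactor B τ)) =
      e (-((A.1 1 0 : ℤ) : ℂ) * ((autFactor B τ)⁻¹ ^ 2 * Λ.quadC z) / autFactor A (B • τ)) *
        e (-((B.1 1 0 : ℤ) : ℂ) * Λ.quadC z / autFactor B τ) := by
    rw [← e_add]
    congr 1
    field_simp
    linear_combination -Λ.quadC z * hc
  simp only [slash]
  rw [mul_smul, autFactor_mul, mul_zpow, quadC_smul, smul_smul (autFactor A (B • τ))⁻¹, ← mul_inv,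
    he]
  ring

theorem slash_eq_of_generators {k : ℤ} {ψ : ℍ → ℂ ⊗[ℤ] L → ℂ}
    (hS : Λ.slash k ModularGroup.S ψ = ψ) (hT : Λ.slash k ModularGroup.T ψ = ψ) (A : SL(2, ℤ)) :
    Λ.slash k A ψ = ψ := by
  have hA : A ∈ Subgroup.closure {ModularGroup.S, ModularGroup.T} := by
    rw [SpecialLinearGroup.SL2Z_generators]
    trivial
  induction hA using Subgroup.closure_induction with
  | mem x hx =>
    rcases hx with rfl | rfl
    exacts [hS, hT]
  | one => exact Λ.slash_one _ _
  | mul x y _ _ hx hy => rw [slash_mul, hx, hy]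
  | inv x _ hx =>
    conv_lhs => rw [← hx]
    rw [← slash_mul, mul_inv_cancel, slash_one]

/-- The transformation law of `MetaplecticLaw` for a single element `α` of the metaplectic
group. -/
def MetaplecticLawAt (κ h : ℤ) (φ : ℍ → ℂ ⊗[ℤ] L → ℂ) (α : Metaplectic) : Prop :=
  ∀ (τ : ℍ) (z : ℂ ⊗[ℤ] L),
    φ (α.A • τ) ((autFactor α.A τ)⁻¹ • z) *
        e (-((α.A.1 1 0 : ℤ) : ℂ) * Λ.quadC z / autFactor α.A τ) * α.w τ ^ (-κ) =
      epsilon α ^ h * φ τ z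

theorem metaplecticLawAt_mpS_iff {κ h : ℤ} {φ : ℍ → ℂ ⊗[ℤ] L → ℂ} :
    Λ.MetaplecticLawAt κ h φ mpS ↔ ∀ (τ : ℍ) z,
      φ (ModularGroup.S • τ) ((τ : ℂ)⁻¹ • z) * e (-Λ.quadC z / τ) * (e (1 / 8) * rootS τ) ^ (-κ) =
        (e (1 / 8))⁻¹ ^ h * φ τ z := by
  have hc : ModularGroup.S.1 1 0 = 1 := by simp [ModularGroup.S]
  simp only [MetaplecticLawAt, epsilon_mpS]
  simp only [mpS, autFactor_S, hc, Int.cast_one, neg_one_mul]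

theorem metaplecticLawAt_mpT_iff {κ h : ℤ} {φ : ℍ → ℂ ⊗[ℤ] L → ℂ} :
    Λ.MetaplecticLawAt κ h φ mpT ↔
      ∀ (τ : ℍ) z, φ (ModularGroup.T • τ) z = e (1 / 24) ^ h * φ τ z := by
  have hc : ModularGroup.T.1 1 0 = 0 := by simp [ModularGroup.T]
  simp only [MetaplecticLawAt, epsilon_mpT]
  simp only [mpT, autFactor_T, hc, Int.cast_zero, inv_one, one_smul, neg_zero, zero_mul, zero_div,
    e_zero, one_zpow, mul_one]

theorem eq_zero_or_even_of_metaplecticLawAt_mpZ {κ h : ℤ} {φ : ℍ → ℂ ⊗[ℤ] L → ℂ}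
    (hφ : Λ.MetaplecticLawAt κ h φ mpZ) : φ = 0 ∨ Even (κ - h) := by
  refine or_iff_not_imp_right.2 fun hodd => funext₂ fun τ z => ?_
  have hφ := hφ τ z
  rw [epsilon_mpZ] at hφ
  simp only [mpZ, autFactor_one, one_smul, inv_one, Matrix.SpecialLinearGroup.coe_one,
    Matrix.one_apply_ne one_ne_zero, Int.cast_zero, neg_zero, zero_mul, zero_div, e_zero, mul_one,
    zpow_neg, ← inv_zpow, inv_neg_one] at hφ
  have hsign : (-1 : ℂ) ^ κ = -(-1) ^ h := by
    rw [← sub_add_cancel κ h, zpow_add₀ (by norm_num), (Int.not_even_iff_odd.1 hodd).neg_one_zpow,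
      neg_one_mul]
  rw [hsign, mul_neg, mul_comm, neg_eq_iff_add_eq_zero, ← two_mul] at hφ
  exact (mul_eq_zero.1 ((mul_eq_zero.1 hφ).resolve_left two_ne_zero)).resolve_left
    (zpow_ne_zero h (by norm_num))

/- Dividing by `η ^ h` removes the character and leaves an integral weight. -/
theorem metaplecticLawAt_iff_slash {κ h k : ℤ} (hk : κ = h + 2 * k) (φ : ℍ → ℂ ⊗[ℤ] L → ℂ)
    (α : Metaplectic) :
    Λ.MetaplecticLawAt κ h φ α ↔ Λ.slash k α.A (fun τ z => φ τ z * (ModularForm.eta τ ^ h)⁻¹) =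
      fun τ z => φ τ z * (ModularForm.eta τ ^ h)⁻¹ := by
  have hη (τ : ℍ) : (ModularForm.eta (α.A • τ : ℍ) ^ h)⁻¹ * autFactor α.A τ ^ (-k) =
      (epsilon α ^ h)⁻¹ * (ModularForm.eta τ ^ h)⁻¹ * α.w τ ^ (-κ) := by
    rw [eta_smul, ← α.sq, mul_zpow, mul_zpow, hk, neg_add, zpow_add₀ (α.w_ne_zero τ), zpow_neg,
      zpow_neg, zpow_neg, zpow_mul, ← zpow_natCast (α.w τ) 2, mul_inv, mul_inv]
    push_cast
    ring
  have hslash (τ : ℍ) (z : ℂ ⊗[ℤ] L) :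
      Λ.slash k α.A (fun τ z => φ τ z * (ModularForm.eta τ ^ h)⁻¹) τ z =
        (epsilon α ^ h)⁻¹ * (φ (α.A • τ) ((autFactor α.A τ)⁻¹ • z) *
          e (-((α.A.1 1 0 : ℤ) : ℂ) * Λ.quadC z / autFactor α.A τ) * α.w τ ^ (-κ)) *
            (ModularForm.eta τ ^ h)⁻¹ := by
    rw [slash]
    linear_combination (φ (α.A • τ) ((autFactor α.A τ)⁻¹ • z) *
      e (-((α.A.1 1 0 : ℤ) : ℂ) * Λ.quadC z / autFactor α.A τ)) * hη τ
  have hη_ne (τ : ℍ) : (ModularForm.eta τ ^ h)⁻¹ ≠ 0 :=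
    inv_ne_zero (zpow_ne_zero h (ModularForm.eta_ne_zero τ.2))
  simp only [MetaplecticLawAt, funext_iff, hslash, mul_left_inj' (hη_ne _),
    inv_mul_eq_iff_eq_mul₀ (zpow_ne_zero h (epsilon_ne_zero α))]

theorem metaplecticLaw_of_generators {κ h : ℤ} (hκ : Even (κ - h)) {φ : ℍ → ℂ ⊗[ℤ] L → ℂ}
    (hS : Λ.MetaplecticLawAt κ h φ mpS) (hT : Λ.MetaplecticLawAt κ h φ mpT) :
    Λ.MetaplecticLaw κ h φ := fun α => by
  obtain ⟨k, hk⟩ := hκ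
  replace hk : κ = h + 2 * k := by omega
  exact (Λ.metaplecticLawAt_iff_slash hk φ α).2 (Λ.slash_eq_of_generators
    ((Λ.metaplecticLawAt_iff_slash hk φ mpS).1 hS) ((Λ.metaplecticLawAt_iff_slash hk φ mpT).1 hT) _)

end PosDefLattice

/-! ### Milgram's formula -/

theorem T_mul_S_mul_T_mul_S_mul_T : ModularGroup.T * ModularGroup.S * ModularGroup.T *
    ModularGroup.S * ModularGroup.T = ModularGroup.S := by
  ext i j
  fin_cases i <;> fin_cases j <;> rfl

theorem rootS_mul_rootS_I : rootS (ModularGroup.T • ModularGroup.S • ModularGroup.T •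
    UpperHalfPlane.I : ℍ) * rootS (ModularGroup.T • UpperHalfPlane.I : ℍ) = (e (1 / 8))⁻¹ := by
  have hT : ((ModularGroup.T • UpperHalfPlane.I : ℍ) : ℂ) = Complex.I + 1 := by
    rw [coe_T_smul, UpperHalfPlane.coe_I]
  have hI := Complex.I_mul_I
  have hne : Complex.I + 1 ≠ 0 := hT ▸ UpperHalfPlane.ne_zero _
  have hTST : ((ModularGroup.T • ModularGroup.S • ModularGroup.T • UpperHalfPlane.I : ℍ) : ℂ) =
      (1 / 2 : ℝ) * (ModularGroup.T • UpperHalfPlane.I : ℍ) := by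
    rw [coe_T_smul, coe_S_smul, hT]
    push_cast
    field_simp
    linear_combination -hI
  have he : e (1 / 8) = (√(1 / 2) : ℝ) * (1 + Complex.I) := by
    have h : √2 / 2 = √(1 / 2 : ℝ) := by
      rw [Real.sqrt_div zero_le_one, Real.sqrt_one, Real.sqrt_div_self', one_div]
    rw [e, show 2 * Real.pi * Complex.I * (1 / 8) = ((Real.pi / 4 : ℝ) : ℂ) * Complex.I by
      push_cast; ring, Complex.exp_mul_I, ← Complex.ofReal_cos, ← Complex.ofReal_sin,
      Real.cos_pi_div_four, Real.sin_pi_div_four, h]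
    ring
  have hsqrt : ((√(1 / 2) : ℝ) : ℂ) * (√(1 / 2) : ℝ) = 1 / 2 := by
    rw [← Complex.ofReal_mul, Real.mul_self_sqrt (by norm_num)]
    norm_num
  rw [hTST, rootS_real_mul (by norm_num), mul_assoc, ← sq, rootS_sq, hT]
  refine eq_inv_of_mul_eq_one_left ?_
  rw [he]
  linear_combination (-Complex.I * (Complex.I + 1) ^ 2) * hsqrt - (1 / 2 * Complex.I + 1) * hI

namespace PosDefLattice

variable {L : Type*} [AddCommGroup L] (Λ : PosDefLattice L)

theorem slash_fun_mul (k : ℤ) (A : SL(2, ℤ)) (f : ℍ → ℂ) (ψ : ℍ → ℂ ⊗[ℤ] L → ℂ) :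
    Λ.slash k A (fun τ z => f τ * ψ τ z) = fun τ z => f (A • τ) * Λ.slash k A ψ τ z := by
  funext τ z
  simp only [slash, mul_assoc]

theorem slash_T (k : ℤ) (ψ : ℍ → ℂ ⊗[ℤ] L → ℂ) :
    Λ.slash k ModularGroup.T ψ = fun τ z => ψ (ModularGroup.T • τ) z := by
  funext τ z
  have hc : ModularGroup.T.1 1 0 = 0 := by simp [ModularGroup.T]
  simp [slash, autFactor_T, hc, e_zero]

theorem slash_S (k : ℤ) (ψ : ℍ → ℂ ⊗[ℤ] L → ℂ) :
    Λ.slash k ModularGroup.S ψ = fun τ z =>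
      ψ (ModularGroup.S • τ) ((τ : ℂ)⁻¹ • z) * e (-Λ.quadC z / τ) * (τ : ℂ) ^ (-k) := by
  funext τ z
  have hc : ModularGroup.S.1 1 0 = 1 := by simp [ModularGroup.S]
  rw [slash, autFactor_S, hc, Int.cast_one, neg_one_mul]

theorem slash_T_theta (k : ℤ) (a : Λ.W) :
    Λ.slash k ModularGroup.T (Λ.theta a) = Λ.theta (Λ.weilT a) := by
  rw [slash_T]
  exact funext₂ (Λ.theta_T_smul a)

variable [Module.Free ℤ L] [Module.Finite ℤ L]

theorem theta_S_smul_mul_e (a : Λ.W) (τ : ℍ) (z : ℂ ⊗[ℤ] L) :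
    Λ.theta a (ModularGroup.S • τ) ((τ : ℂ)⁻¹ • z) * e (-Λ.quadC z / τ) =
      Λ.inversionConst * rootS τ ^ Module.finrank ℤ L * Λ.theta (Λ.weilS a) τ z := by
  rw [theta_S_smul, neg_div, e_neg, mul_right_comm _ (e _), mul_inv_cancel_right₀ (e_ne_zero _)]

theorem slash_S_theta (k : ℤ) (a : Λ.W) :
    Λ.slash k ModularGroup.S (Λ.theta a) = fun (τ : ℍ) z =>
      (Λ.inversionConst * rootS τ ^ Module.finrank ℤ L * (τ : ℂ) ^ (-k)) *
        Λ.theta (Λ.weilS a) τ z := by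
  rw [slash_S]
  funext τ z
  rw [theta_S_smul_mul_e, mul_right_comm]

theorem slash_T_S_T_S_T_theta (a : Λ.W) (τ : ℍ) (z : ℂ ⊗[ℤ] L) :
    Λ.slash 0 (ModularGroup.T * ModularGroup.S * ModularGroup.T * ModularGroup.S * ModularGroup.T)
      (Λ.theta a) τ z = Λ.inversionConst ^ 2 * Λ.gaussSum *
        (rootS (ModularGroup.T • ModularGroup.S • ModularGroup.T • τ : ℍ) *
          rootS (ModularGroup.T • τ : ℍ)) ^ Module.finrank ℤ L * Λ.theta (Λ.weilS a) τ z := by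
  simp only [slash_mul, slash_T_theta, slash_S_theta, slash_fun_mul,
    weilT_weilS_weilT_weilS_weilT, neg_zero, zpow_zero, mul_one]
  rw [← thetaEval_apply, map_smul, thetaEval_apply, smul_eq_mul, mul_pow]
  ring

theorem weilS_injective : Function.Injective Λ.weilS := by
  rw [injective_iff_map_eq_zero]
  intro a ha
  have hI := UpperHalfPlane.ne_zero UpperHalfPlane.I
  refine Λ.theta_injective (ModularGroup.S • UpperHalfPlane.I) (funext fun z => ?_)
  have h := Λ.theta_S_smul a UpperHalfPlane.I ((UpperHalfPlane.I : ℂ) • z)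
  rw [smul_smul, inv_mul_cancel₀ hI, one_smul, ha, theta_zero, mul_zero] at h
  exact h.trans (theta_zero _ _).symm

/- Compare the actions of `T S T S T = S` on theta series at the point `i`. -/
theorem inversionConst_mul_gaussSum :
    Λ.inversionConst * Λ.gaussSum = e (1 / 8) ^ Module.finrank ℤ L := by
  obtain ⟨a, ha⟩ := exists_ne (0 : Λ.W)
  obtain ⟨z, hz⟩ : ∃ z, Λ.theta (Λ.weilS a) UpperHalfPlane.I z ≠ 0 := by
    by_contra! h
    refine ha (Λ.weilS_injective (Λ.theta_injective UpperHalfPlane.I (funext fun z => ?_)))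
    rw [map_zero]
    exact (h z).trans (theta_zero _ _).symm
  have h := Λ.slash_T_S_T_S_T_theta a UpperHalfPlane.I z
  rw [T_mul_S_mul_T_mul_S_mul_T, slash_S_theta, rootS_mul_rootS_I] at h
  simp only [rootS_I, one_pow, neg_zero, zpow_zero, mul_one, inv_pow] at h
  have hC := Λ.inversionConst_ne_zero
  have he := pow_ne_zero (Module.finrank ℤ L) (e_ne_zero (1 / 8))
  have h := mul_right_cancel₀ hz h
  field_simp at h
  exact h.symm

theorem inversionConst_mul_norm_gaussSum : Λ.inversionConst * ‖Λ.gaussSum‖ = 1 := by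
  have hmilgram := congrArg norm Λ.inversionConst_mul_gaussSum
  have he : ‖e (1 / 8)‖ = 1 := by simpa using norm_e_ratCast (1 / 8)
  rwa [norm_mul, norm_pow, he, one_pow, Complex.norm_of_nonneg Λ.inversionConst_pos.le]
    at hmilgram

end PosDefLattice

/-! ### Fourier expansions -/

theorem e_fract (q : ℚ) : e (Int.fract q : ℚ) = e q :=
  e_ratCast_congr (-⌊q⌋) (by rw [Int.fract]; push_cast; ring)

theorem fract_eq_of_e_eq {p q : ℚ} (h : e p = e q) : Int.fract p = Int.fract q := by
  obtain ⟨m, rfl⟩ := coe_addCircle_eq_iff.1 (e_ratCast_inj.1 h)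
  exact Int.fract_add_intCast q m

theorem mdifferentiable_of_hasSum {q : ℚ} (hq : 0 ≤ q) {a : ℕ → ℂ} {f : ℍ → ℂ}
    (hf : ∀ τ : ℍ, HasSum (fun m : ℕ => a m * e ((q + m) * τ)) (f τ)) :
    MDifferentiable 𝓘(ℂ) 𝓘(ℂ) f := by
  rw [UpperHalfPlane.mdifferentiable_iff]
  have hdiff : DifferentiableOn ℂ (fun t : ℂ => ∑' m : ℕ, a m * e ((q + m) * t))
      {t | 0 < t.im} := by
    intro t (ht : 0 < t.im)
    let s : ℍ := ⟨(t.im / 2 : ℝ) * Complex.I, by simpa using half_pos ht⟩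
    have hopen : IsOpen {u : ℂ | s.im < u.im} := isOpen_lt continuous_const Complex.continuous_im
    have hbound (m : ℕ) (u : ℂ) (hu : u ∈ {u : ℂ | s.im < u.im}) :
        ‖a m * e ((q + m) * u)‖ ≤ ‖a m * e ((q + m) * s)‖ := by
      have him (v : ℂ) : (((q : ℂ) + m) * v).im = ((q : ℝ) + m) * v.im := by
        rw [← Complex.im_ofReal_mul]
        push_cast
        rfl
      have hqm : (0 : ℝ) ≤ (q : ℝ) + m := by positivity
      rw [norm_mul, norm_mul, norm_e, norm_e, him, him, UpperHalfPlane.coe_im]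
      have hle := mul_le_mul_of_nonneg_left (le_of_lt hu) hqm
      have hpi : -2 * Real.pi ≤ 0 := by linarith [Real.pi_pos]
      exact mul_le_mul_of_nonneg_left
        (Real.exp_le_exp.2 (mul_le_mul_of_nonpos_left hle hpi)) (norm_nonneg _)
    have h := Complex.differentiableOn_tsum_of_summable_norm (hf s).summable.norm
      (fun m => ((differentiable_e.comp (differentiable_id.const_mul ((q : ℂ) + m))).const_mul
        (a m)).differentiableOn) hopen hbound
    have hst : t ∈ {u : ℂ | s.im < u.im} := by simpa [s] using ht
    exact ((h t hst).differentiableAt (hopen.mem_nhds hst)).differentiableWithinAt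
  refine hdiff.congr fun t ht => ?_
  rw [Function.comp_apply, ← (hf _).tsum_eq, UpperHalfPlane.ofComplex_apply_of_im_pos ht]

namespace PosDefLattice

variable {L : Type*} [AddCommGroup L] {Λ : PosDefLattice L}

/-- The smallest non-negative exponent congruent to `h / 24 - β(r)` modulo `ℤ`. The coefficient of
`ϑ` at `r` in a theta expansion is a power series in `q` times `q` to this exponent. -/
def expo (h : ℤ) (r : Λ.shadow) : ℚ := Int.fract ((h : ℚ) / 24 - Λ.quadQ (r : ℚ ⊗[ℤ] L))

theorem expo_nonneg (h : ℤ) (r : Λ.shadow) : 0 ≤ expo h r := Int.fract_nonneg _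

theorem e_twentyFourth_zpow (h : ℤ) : e (1 / 24) ^ h = e ((h / 24 : ℚ) : ℂ) := by
  rw [← e_int_mul]
  congr 1
  push_cast
  ring

theorem e_quadQ_mul_e_expo (h : ℤ) (r : Λ.shadow) :
    e (Λ.quadQ (r : ℚ ⊗[ℤ] L)) * e (expo h r) = e (1 / 24) ^ h := by
  rw [expo, e_fract, ← e_add, e_twentyFourth_zpow]
  push_cast
  rw [add_sub_cancel]

theorem expo_eq_of_mul_e_quadQ {L' : Type*} [AddCommGroup L'] {Λ' : PosDefLattice L'}
    {h h' : ℤ} {r : Λ.shadow} {r' : Λ'.shadow}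
    (heq : e (1 / 24) ^ h' * e (Λ.quadQ (r : ℚ ⊗[ℤ] L)) =
      e (1 / 24) ^ h * e (Λ'.quadQ (r' : ℚ ⊗[ℤ] L'))) : expo h r = expo h' r' := by
  refine fract_eq_of_e_eq ?_
  have hr := e_ne_zero (Λ.quadQ (r : ℚ ⊗[ℤ] L))
  have hr' := e_ne_zero (Λ'.quadQ (r' : ℚ ⊗[ℤ] L'))
  rw [Rat.cast_sub, Rat.cast_sub, e_sub, e_sub, ← e_twentyFourth_zpow, ← e_twentyFourth_zpow,
    div_eq_div_iff hr hr', heq]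

theorem isPeriodic_expo (h : ℤ) : IsPeriodic fun r : Λ.shadow => expo h r := fun l r =>
  expo_eq_of_mul_e_quadQ (congrArg (e (1 / 24) ^ h * ·) (Λ.isPeriodic_e_quadQ l r))

theorem quadQ_add_expo (h : ℤ) (r : Λ.shadow) :
    Λ.quadQ (r : ℚ ⊗[ℤ] L) + expo h r =
      (h : ℚ) / 24 - ⌊(h : ℚ) / 24 - Λ.quadQ (r : ℚ ⊗[ℤ] L)⌋ := by
  rw [expo, Int.fract]
  ring

/-- The indices `(n, r)` of a Fourier expansion as pairs of an element `r` of the shadow and the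
natural number `n - β(r) - expo h r`. -/
def fourierEquiv (h : ℤ) : Λ.shadow × ℕ ≃ Λ.FourierIndex h where
  toFun p := ⟨(Λ.quadQ (p.1 : ℚ ⊗[ℤ] L) + expo h p.1 + p.2, p.1),
    ⟨-⌊(h : ℚ) / 24 - Λ.quadQ (p.1 : ℚ ⊗[ℤ] L)⌋ + p.2, by
      rw [quadQ_add_expo]
      push_cast
      ring⟩, p.1.2, by
      have := expo_nonneg h p.1
      simp only
      linarith [p.2.cast_nonneg (α := ℚ)]⟩
  invFun p := (⟨p.1.2, p.2.2.1⟩, ⌊p.1.1 - Λ.quadQ p.1.2⌋₊)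
  left_inv p := by
    have hfloor : ⌊expo h p.1 + p.2⌋₊ = p.2 := by
      rw [Nat.floor_add_natCast (expo_nonneg h p.1), expo,
        Nat.floor_eq_zero.2 (Int.fract_lt_one _),
        zero_add]
    simp only [add_assoc, add_sub_cancel_left, hfloor]
  right_inv := by
    rintro ⟨⟨n, r⟩, ⟨m, hm⟩, hr, hn⟩
    refine Subtype.ext (Prod.ext ?_ rfl)
    simp only at hm hn ⊢
    have hfract : expo h ⟨r, hr⟩ = Int.fract (n - Λ.quadQ r) := by
      rw [expo, hm, add_sub_right_comm, Int.fract_add_intCast]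
    rw [hfract, add_assoc, Int.fract, natCast_floor_eq_intCast_floor (sub_nonneg.2 hn)]
    ring

theorem fourierEquiv_term (h : ℤ) (r : Λ.shadow) (m : ℕ) (c : ℂ) (τ : ℂ) (z : ℂ ⊗[ℤ] L) :
    c * e (((fourierEquiv h (r, m)).1.1 : ℂ) * τ) *
        e (Λ.formC z (inclC L (fourierEquiv h (r, m)).1.2)) =
      c * e ((expo h r + m) * τ) * Λ.term τ z r := by
  have hn : (fourierEquiv h (r, m)).1.1 = Λ.quadQ (r : ℚ ⊗[ℤ] L) + expo h r + m := rfl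
  have hr : (fourierEquiv h (r, m)).1.2 = r := rfl
  rw [hn, hr, term]
  push_cast
  rw [add_assoc, add_mul, e_add, Λ.formC_symm z]
  ring

theorem exists_hasFourier_iff {h : ℤ} {φ : ℍ → ℂ ⊗[ℤ] L → ℂ} :
    (∃ c, Λ.HasFourier h c φ) ↔ ∃ c : Λ.shadow × ℕ → ℂ, ∀ (τ : ℍ) z,
      HasSum (fun p => c p * e ((expo h p.1 + p.2) * τ) * Λ.term τ z p.1) (φ τ z) := by
  rw [← ((fourierEquiv h).arrowCongr (Equiv.refl ℂ)).exists_congr_right]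
  refine exists_congr fun c => forall₂_congr fun τ z => ?_
  rw [← (fourierEquiv h).hasSum_iff]
  refine Eq.to_iff (congrArg (HasSum · _) (funext fun p => ?_))
  rw [← fourierEquiv_term h p.1 p.2]
  simp

end PosDefLattice

/-! ### Theta expansions -/

namespace PosDefLattice

variable {L : Type*} [AddCommGroup L] {Λ : PosDefLattice L}

/-- `F = ∑ m, a m * q ^ (expo h + m)`, the Fourier expansion of a function `F : ℍ → W`, with the
exponent depending on the argument of the elements of `W`. -/
def HasExpansion (h : ℤ) (a : ℕ → Λ.W) (F : ℍ → Λ.W) : Prop :=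
  ∀ (τ : ℍ) (r : Λ.shadow),
    HasSum (fun m => (a m).1 r * e ((expo h r + m) * τ)) ((F τ).1 r)

theorem HasExpansion.mdifferentiable {h : ℤ} {a : ℕ → Λ.W} {F : ℍ → Λ.W}
    (hF : HasExpansion h a F) (r : Λ.shadow) : MDifferentiable 𝓘(ℂ) 𝓘(ℂ) fun τ => (F τ).1 r :=
  mdifferentiable_of_hasSum (expo_nonneg h r) fun τ => hF τ r

theorem HasExpansion.weilT_T_smul {h : ℤ} {a : ℕ → Λ.W} {F : ℍ → Λ.W} (hF : HasExpansion h a F)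
    (τ : ℍ) : Λ.weilT (F (ModularGroup.T • τ)) = e (1 / 24) ^ h • F τ := by
  ext r
  have hT : (F (ModularGroup.T • τ)).1 r = e (expo h r) * (F τ).1 r := by
    refine (hF _ r).unique (((hF τ r).mul_left (e (expo h r))).congr_fun fun m => ?_)
    have hm := e_int m
    rw [Int.cast_natCast] at hm
    rw [coe_T_smul, mul_add, mul_one, e_add, e_add, hm]
    ring
  rw [weilT_apply, hT, ← mul_assoc, e_quadQ_mul_e_expo]
  rfl

theorem exists_hasSum_mul_term {h : ℤ} {c : Λ.shadow × ℕ → ℂ} {φ : ℍ → ℂ ⊗[ℤ] L → ℂ}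
    (hc : ∀ (τ : ℍ) z,
      HasSum (fun p => c p * e ((expo h p.1 + p.2) * τ) * Λ.term τ z p.1) (φ τ z)) :
    ∃ G : ℍ → Λ.shadow → ℂ,
      (∀ (τ : ℍ) r, HasSum (fun m : ℕ => c (r, m) * e ((expo h r + m) * τ)) (G τ r)) ∧
        ∀ (τ : ℍ) z, HasSum (fun r => G τ r * Λ.term τ z r) (φ τ z) := by
  have hsum (τ : ℍ) (r : Λ.shadow) : Summable fun m : ℕ => c (r, m) * e ((expo h r + m) * τ) := by
    have hterm : Summable fun m : ℕ => c (r, m) * e ((expo h r + m) * τ) * Λ.term τ 0 r :=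
      (hc τ 0).summable.prod_factor r
    exact (summable_mul_right_iff (Λ.term_ne_zero τ 0 r)).1 hterm
  refine ⟨fun τ r => ∑' m : ℕ, c (r, m) * e ((expo h r + m) * τ), fun τ r => (hsum τ r).hasSum,
    fun τ z => ?_⟩
  exact (hc τ z).prod_fiberwise fun r => (hsum τ r).hasSum.mul_right (Λ.term τ z r)

variable [Module.Free ℤ L] [Module.Finite ℤ L]

theorem exists_hasExpansion {h : ℤ} {c : Λ.shadow × ℕ → ℂ} {F : ℍ → Λ.W}
    (hF : ∀ (τ : ℍ) r, HasSum (fun m => c (r, m) * e ((expo h r + m) * τ)) ((F τ).1 r)) :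
    ∃ a, HasExpansion h a F := by
  let ρ : Λ.shadow := Classical.arbitrary _
  let a (m : ℕ) : Λ.W := coeffEquiv ρ fun d =>
    (e (Λ.quadQ (d.out : Λ.dual)))⁻¹ * c (d.out +ᵥ ρ, m)
  have ha (m : ℕ) (d : Λ.Disc) : (a m).1 (d.out +ᵥ ρ) = c (d.out +ᵥ ρ, m) := by
    rw [coeffEquiv_vadd, toDisc_out, mul_inv_cancel_left₀ (e_ne_zero _)]
  refine ⟨a, fun τ r => ?_⟩
  obtain ⟨l, hl⟩ := eq_inclDual_vadd_out ρ r
  generalize Λ.toDisc (r -ᵥ ρ) = d at hl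
  have hexpo : expo h (Λ.inclDual l +ᵥ (d.out +ᵥ ρ)) = expo h (d.out +ᵥ ρ) :=
    isPeriodic_expo h l _
  subst hl
  simp only [hexpo, W_vadd, ha, mul_assoc]
  exact (hF τ (d.out +ᵥ ρ)).mul_left _

theorem HasExpansion.summable_mul_term {h : ℤ} {a : ℕ → Λ.W} {F : ℍ → Λ.W}
    (hF : HasExpansion h a F) (τ : ℍ) (z : ℂ ⊗[ℤ] L) :
    Summable fun p : Λ.shadow × ℕ =>
      (a p.2).1 p.1 * e ((expo h p.1 + p.2) * τ) * Λ.term τ z p.1 := by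
  have hperiodic : IsPeriodic fun r : Λ.shadow => ∑' m, ‖(a m).1 r * e ((expo h r + m) * τ)‖ :=
    fun l r => by
      have hexpo : expo h (Λ.inclDual l +ᵥ r) = expo h r := isPeriodic_expo h l r
      simp only [W_vadd, norm_mul, norm_e_ratCast, one_mul, hexpo]
  obtain ⟨M, hM⟩ := hperiodic.finite_range.bddAbove
  have hnorm (r : Λ.shadow) (m : ℕ) :
      ‖(a m).1 r * e ((expo h r + m) * τ) * Λ.term τ z r‖ =
        ‖(a m).1 r * e ((expo h r + m) * τ)‖ * ‖Λ.term τ z r‖ := norm_mul _ _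
  rw [← summable_norm_iff, summable_prod_of_nonneg fun _ => norm_nonneg _]
  simp only [hnorm, tsum_mul_right]
  refine ⟨fun r => (hF τ r).summable.norm.mul_right _, ?_⟩
  exact ((Λ.summable_term_shadow τ z).norm.mul_left M).of_nonneg_of_le
    (fun _ => mul_nonneg (tsum_nonneg fun _ => norm_nonneg _) (norm_nonneg _))
    fun r => mul_le_mul_of_nonneg_right (hM ⟨r, rfl⟩) (norm_nonneg _)

theorem HasExpansion.exists_hasFourier {h : ℤ} {a : ℕ → Λ.W} {F : ℍ → Λ.W}
    (hF : HasExpansion h a F) : ∃ c, Λ.HasFourier h c fun τ z => Λ.theta (F τ) τ z := by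
  refine exists_hasFourier_iff.2 ⟨fun p => (a p.2).1 p.1, fun τ z => ?_⟩
  have hsum := (hF.summable_mul_term τ z).hasSum
  have hfiber (r : Λ.shadow) : HasSum (fun m => (a m).1 r * e ((expo h r + m) * τ) * Λ.term τ z r)
      ((F τ).1 r * Λ.term τ z r) := (hF τ r).mul_right _
  rw [theta_eq_tsum, (hsum.prod_fiberwise hfiber).tsum_eq]
  exact hsum

theorem HasExpansion.exists_isThetaExpansion {h : ℤ} {a : ℕ → Λ.W} {F : ℍ → Λ.W}
    (hF : HasExpansion h a F) :
    ∃ (m : ℕ) (f : Fin m → ℍ → ℂ) (b : Fin m → Λ.W),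
      (∀ i, MDifferentiable 𝓘(ℂ) 𝓘(ℂ) (f i)) ∧
        IsThetaExpansion Λ f b fun τ z => Λ.theta (F τ) τ z := by
  let ρ : Λ.shadow := Classical.arbitrary _
  let B := (Module.Basis.ofEquivFun (coeffEquiv ρ).symm).reindex (Fintype.equivFin Λ.Disc)
  refine ⟨_, fun i τ => B.repr (F τ) i, B, fun i => ?_, fun τ z => ?_⟩
  · simp only [B, Module.Basis.repr_reindex_apply]
    exact mdifferentiable_const.mul (hF.mdifferentiable _)
  · simp only [← thetaEval_apply]
    conv_lhs => rw [← B.sum_repr (F τ), map_sum]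
    simp only [map_smul, smul_eq_mul]

theorem isHolo_of_isThetaExpansion {m : ℕ} {f : Fin m → ℍ → ℂ} {a : Fin m → Λ.W}
    {φ : ℍ → ℂ ⊗[ℤ] L → ℂ} (hf : ∀ i, MDifferentiable 𝓘(ℂ) 𝓘(ℂ) (f i))
    (hφ : IsThetaExpansion Λ f a φ) : IsHolo φ := by
  have hφ : φ = _ := funext₂ hφ
  rw [hφ]
  exact .sum fun i _ => (isHolo_of_mdifferentiable (hf i)).mul (Λ.isHolo_theta (a i))

theorem LatticeLaw.mem_W {φ : ℍ → ℂ ⊗[ℤ] L → ℂ} (hφ : Λ.LatticeLaw φ) {τ : ℍ}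
    {G : Λ.shadow → ℂ} (hG : ∀ z, HasSum (fun r => G r * Λ.term τ z r) (φ τ z)) : G ∈ Λ.W := by
  refine mem_W_iff.2 fun l r => ?_
  let E : Equiv.Perm Λ.shadow := AddAction.toPerm (Λ.inclDual l)
  let g (s : Λ.shadow) : ℂ := G (E.symm s) - e (Λ.quad l) * G s
  have hsum (z : ℂ ⊗[ℤ] L) : HasSum (fun s => g s * Λ.term τ z s) 0 := by
    have hshift := (hG (z + (τ : ℂ) ⊗ₜ[ℤ] l + (1 : ℂ) ⊗ₜ[ℤ] (0 : L))).mul_right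
      (e ((τ : ℂ) * Λ.quad l + Λ.formC ((1 : ℂ) ⊗ₜ[ℤ] l) z))
    have hterm (s : Λ.shadow) : Λ.term τ (z + (τ : ℂ) ⊗ₜ[ℤ] l + (1 : ℂ) ⊗ₜ[ℤ] (0 : L)) s *
        e ((τ : ℂ) * Λ.quad l + Λ.formC ((1 : ℂ) ⊗ₜ[ℤ] l) z) = Λ.term τ z (E s) := by
      rw [term_add_tmul, quad_zero, Rat.cast_zero, e_zero, one_mul]
      rfl
    simp only [mul_assoc, hterm, hφ l 0 τ z, add_zero] at hshift
    have hperm : HasSum (fun s => G (E.symm s) * Λ.term τ z s) (e (Λ.quad l) * φ τ z) :=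
      E.hasSum_iff.1 (by simpa only [Function.comp_def, Equiv.symm_apply_apply] using hshift)
    have hsub := hperm.sub ((hG z).mul_left (e (Λ.quad l)))
    simpa only [← mul_assoc, ← sub_mul, sub_self] using hsub
  have hg := eq_zero_of_tsum_e_formC_eq_zero (g := fun s => g s * e (Λ.quadQ s * τ))
    (by simpa only [term, map_zero, e_zero, mul_one] using (hsum 0).summable)
    (fun z => by simpa only [term, mul_assoc] using (hsum z).tsum_eq)
  have hr := (mul_eq_zero.1 (congrFun hg (E r))).resolve_right (e_ne_zero _)
  simp only [g, Equiv.symm_apply_apply] at hr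
  change G (E r) = _
  linear_combination (-e (Λ.quad l)) * hr - G (E r) * Λ.e_quad_mul_self l

theorem LatticeLaw.exists_hasExpansion {h : ℤ} {φ : ℍ → ℂ ⊗[ℤ] L → ℂ} (hφ : Λ.LatticeLaw φ)
    (hc : ∃ c, Λ.HasFourier h c φ) :
    ∃ (F : ℍ → Λ.W) (a : ℕ → Λ.W), HasExpansion h a F ∧ φ = fun τ z => Λ.theta (F τ) τ z := by
  obtain ⟨c, hc⟩ := exists_hasFourier_iff.1 hc
  obtain ⟨G, hcG, hG⟩ := exists_hasSum_mul_term hc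
  let F (τ : ℍ) : Λ.W := ⟨G τ, hφ.mem_W (hG τ)⟩
  obtain ⟨a, ha⟩ := PosDefLattice.exists_hasExpansion (F := F) hcG
  exact ⟨F, a, ha, funext₂ fun τ z => by rw [theta_eq_tsum, (hG τ z).tsum_eq]⟩

end PosDefLattice

/-! ### Jacobi forms and vector-valued modular forms -/

namespace PosDefLattice

variable {L : Type*} [AddCommGroup L] [Module.Free ℤ L] [Module.Finite ℤ L] {Λ : PosDefLattice L}

variable (Λ) in
/-- The condition on `F : ℍ → W` for `ϑ_{F(τ)}(τ, z)` to be a Jacobi form of weight `κ / 2` and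
character `ε^h`: a Fourier expansion, and the transformation laws under the elements over `S` and
`-1` of the metaplectic group. -/
structure IsThetaVector (κ h : ℤ) (F : ℍ → Λ.W) : Prop where
  expansion : ∃ a, HasExpansion h a F
  inversion : ∀ τ : ℍ, (Λ.inversionConst * rootS τ ^ Module.finrank ℤ L *
    (e (1 / 8) * rootS τ) ^ (-κ)) • Λ.weilS (F (ModularGroup.S • τ)) = (e (1 / 8))⁻¹ ^ h • F τ
  parity : F = 0 ∨ Even (κ - h)

variable (Λ) in
/-- The function `ϑ_{F(τ)}(τ, z)`, as a linear function of `F`. -/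
def thetaLift : (ℍ → Λ.W) →ₗ[ℂ] (ℍ → ℂ ⊗[ℤ] L → ℂ) where
  toFun F τ z := Λ.theta (F τ) τ z
  map_add' F G := funext₂ fun τ z => map_add (thetaEval τ z) (F τ) (G τ)
  map_smul' t F := funext₂ fun τ z => map_smul (thetaEval τ z) t (F τ)

theorem thetaLift_injective : Function.Injective Λ.thetaLift := fun _ _ hFG =>
  funext fun τ => Λ.theta_injective τ (congrFun hFG τ)

theorem metaplecticLawAt_mpS_thetaLift_iff {κ h : ℤ} {F : ℍ → Λ.W} :
    Λ.MetaplecticLawAt κ h (Λ.thetaLift F) mpS ↔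
      ∀ τ : ℍ, (Λ.inversionConst * rootS τ ^ Module.finrank ℤ L *
        (e (1 / 8) * rootS τ) ^ (-κ)) • Λ.weilS (F (ModularGroup.S • τ)) =
          (e (1 / 8))⁻¹ ^ h • F τ := by
  rw [metaplecticLawAt_mpS_iff]
  refine forall_congr' fun τ => ?_
  rw [← (Λ.theta_injective τ).eq_iff, funext_iff]
  refine forall_congr' fun z => ?_
  change Λ.theta (F _) _ _ * _ * _ = _ * thetaEval τ z (F τ) ↔ thetaEval τ z _ = thetaEval τ z _
  rw [theta_S_smul_mul_e, map_smul, map_smul, smul_eq_mul, smul_eq_mul, mul_right_comm,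
    ← thetaEval_apply]

theorem HasExpansion.metaplecticLawAt_mpT {κ h : ℤ} {a : ℕ → Λ.W} {F : ℍ → Λ.W}
    (hF : HasExpansion h a F) : Λ.MetaplecticLawAt κ h (Λ.thetaLift F) mpT := by
  refine Λ.metaplecticLawAt_mpT_iff.2 fun τ z => ?_
  change Λ.theta (F _) _ z = _ * thetaEval τ z (F τ)
  rw [theta_T_smul, hF.weilT_T_smul, ← thetaEval_apply, map_smul, smul_eq_mul]

theorem thetaLift_mem_jacobiForms {κ h : ℤ} {F : ℍ → Λ.W} (hF : Λ.IsThetaVector κ h F) :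
    Λ.thetaLift F ∈ JacobiForms κ Λ h := by
  obtain rfl | hκ := hF.parity
  · rw [map_zero]
    exact zero_mem _
  obtain ⟨a, ha⟩ := hF.expansion
  obtain ⟨m, f, b, hf, hb⟩ := ha.exists_isThetaExpansion
  exact ⟨isHolo_of_isThetaExpansion hf hb, Λ.metaplecticLaw_of_generators hκ
    (metaplecticLawAt_mpS_thetaLift_iff.2 hF.inversion) ha.metaplecticLawAt_mpT,
    fun x y τ z => Λ.theta_latticeLaw (F τ) x y τ z, ha.exists_hasFourier⟩

theorem exists_isThetaVector {κ h : ℤ} {φ : ℍ → ℂ ⊗[ℤ] L → ℂ} (hφ : φ ∈ JacobiForms κ Λ h) :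
    ∃ F, Λ.IsThetaVector κ h F ∧ Λ.thetaLift F = φ := by
  obtain ⟨-, hmeta, hlat, hc⟩ := hφ
  obtain ⟨F, a, ha, rfl⟩ := hlat.exists_hasExpansion hc
  have hlaw (α : Metaplectic) : Λ.MetaplecticLawAt κ h (Λ.thetaLift F) α := hmeta α
  refine ⟨F, ⟨⟨a, ha⟩, metaplecticLawAt_mpS_thetaLift_iff.1 (hlaw mpS), ?_⟩, rfl⟩
  exact (Λ.eq_zero_or_even_of_metaplecticLawAt_mpZ (hlaw mpZ)).imp_left fun hzero =>
    thetaLift_injective (hzero.trans (map_zero _).symm)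

theorem thetaLift_mem_jacobiForms_iff {κ h : ℤ} {F : ℍ → Λ.W} :
    Λ.thetaLift F ∈ JacobiForms κ Λ h ↔ Λ.IsThetaVector κ h F := by
  refine ⟨fun hF => ?_, thetaLift_mem_jacobiForms⟩
  obtain ⟨G, hG, hGF⟩ := exists_isThetaVector hF
  rwa [← thetaLift_injective hGF]

variable (Λ) in
/-- The Jacobi forms of weight `κ / 2` and character `ε^h` in terms of the coefficients `F` of
their theta expansions `ϑ_{F(τ)}(τ, z)`. -/
def thetaVectorEquiv (κ h : ℤ) :
    (JacobiForms κ Λ h).comap Λ.thetaLift ≃ₗ[ℂ] JacobiForms κ Λ h :=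
  .ofBijective (Λ.thetaLift.submoduleComap (JacobiForms κ Λ h))
    ⟨fun _ _ hFG => Subtype.ext (thetaLift_injective (congrArg Subtype.val hFG)), fun φ => by
      obtain ⟨F, -, hF⟩ := exists_isThetaVector φ.2
      exact ⟨⟨F, Submodule.mem_comap.2 (hF ▸ φ.2)⟩, Subtype.ext hF⟩⟩

end PosDefLattice

/-! ### Lattices with isomorphic bilinear modules -/

namespace PosDefLattice

variable {L : Type*} [AddCommGroup L] {Λ : PosDefLattice L}

theorem isPeriodic_coe_quadQ : IsPeriodic fun r : Λ.shadow =>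
    ((Λ.quadQ (r : ℚ ⊗[ℤ] L) : ℚ) : AddCircle (1 : ℚ)) :=
  fun l r => e_ratCast_inj.1 (Λ.isPeriodic_e_quadQ l r)

/-- The function `x + L ↦ β(x + ρ) - β(ρ) + ℤ` on `L^# / L`, for `ρ` in the shadow. It is a
quadratic refinement of the form on `L^# / L`, whereas `x ↦ β(x)` is defined modulo `1 / 2` only. -/
def shadowQuad (ρ : Λ.shadow) (d : Λ.Disc) : AddCircle (1 : ℚ) :=
  ((Λ.quadQ (d.out +ᵥ ρ : Λ.shadow) : ℚ) : AddCircle (1 : ℚ)) - (Λ.quadQ ρ : ℚ)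

theorem shadowQuad_toDisc (ρ : Λ.shadow) (x : Λ.dual) : shadowQuad ρ (Λ.toDisc x) =
    ((Λ.quadQ (x : ℚ ⊗[ℤ] L) + Λ.formQ x ρ : ℚ) : AddCircle (1 : ℚ)) := by
  have h := isPeriodic_coe_quadQ.congr (Λ.toDisc_out (Λ.toDisc x)) ρ
  beta_reduce at h
  rw [shadowQuad, h, ← AddCircle.coe_sub, coe_vadd, quadQ_add]
  congr 1
  ring

theorem shadowQuad_add (ρ : Λ.shadow) (d d' : Λ.Disc) :
    shadowQuad ρ (d + d') = shadowQuad ρ d + shadowQuad ρ d' + Λ.discForm d d' := by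
  obtain ⟨x, rfl⟩ := Λ.toDisc_surjective d
  obtain ⟨y, rfl⟩ := Λ.toDisc_surjective d'
  rw [← map_add, shadowQuad_toDisc, shadowQuad_toDisc, shadowQuad_toDisc, discForm_toDisc,
    ← AddCircle.coe_add, ← AddCircle.coe_add, AddSubgroup.coe_add, quadQ_add, map_add,
    LinearMap.add_apply]
  congr 1
  ring

theorem shadowQuad_vadd (ρ : Λ.shadow) (x : Λ.dual) (d : Λ.Disc) :
    shadowQuad (x +ᵥ ρ) d = shadowQuad ρ d + Λ.discForm (Λ.toDisc x) d := by
  obtain ⟨y, rfl⟩ := Λ.toDisc_surjective d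
  rw [shadowQuad_toDisc, shadowQuad_toDisc, discForm_toDisc, ← AddCircle.coe_add, coe_vadd,
    map_add, Λ.formQ_symm x]
  congr 1
  ring

end PosDefLattice

open PosDefLattice

variable {L₁ L₂ : Type*} [AddCommGroup L₁] [AddCommGroup L₂]
  {Λ₁ : PosDefLattice L₁} {Λ₂ : PosDefLattice L₂}
  {σ : Λ₁.Disc ≃+ Λ₂.Disc} {ρ₁ : Λ₁.shadow} {ρ₂ : Λ₂.shadow}

/-- Elements `ρ₁`, `ρ₂` of the shadows are compatible with `σ` if `σ` respects the quadratic
refinements that they define. -/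
def ShadowCompat (σ : Λ₁.Disc ≃+ Λ₂.Disc) (ρ₁ : Λ₁.shadow) (ρ₂ : Λ₂.shadow) : Prop :=
  ∀ d, shadowQuad ρ₂ (σ d) = shadowQuad ρ₁ d

/- The two quadratic refinements differ by a character of `L₂^# / L₂`, which is `β(δ, ·)` for some
`δ`; then `ρ₂` is replaced by `ρ₂ + δ`. -/
theorem exists_shadowCompat [Module.Free ℤ L₂] [Module.Finite ℤ L₂]
    (hσ : ∀ x y, Λ₂.discForm (σ x) (σ y) = Λ₁.discForm x y) (ρ₁ : Λ₁.shadow) :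
    ∃ ρ₂ : Λ₂.shadow, ShadowCompat σ ρ₁ ρ₂ := by
  let ρ : Λ₂.shadow := Classical.arbitrary _
  let χ : Λ₂.Disc →+ AddCircle (1 : ℚ) :=
    .mk' (fun d => shadowQuad ρ₁ (σ.symm d) - shadowQuad ρ d) fun d d' => by
      rw [map_add, shadowQuad_add, shadowQuad_add, ← hσ, σ.apply_symm_apply, σ.apply_symm_apply]
      abel
  obtain ⟨δ, hδ⟩ := Λ₂.exists_discForm_eq χ
  obtain ⟨x, rfl⟩ := Λ₂.toDisc_surjective δ
  refine ⟨x +ᵥ ρ, fun d => ?_⟩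
  rw [shadowQuad_vadd, hδ]
  change _ + (shadowQuad ρ₁ (σ.symm (σ d)) - shadowQuad ρ (σ d)) = _
  rw [σ.symm_apply_apply, add_sub_cancel]

theorem exists_eq_vadd [Module.Free ℤ L₂] [Module.Finite ℤ L₂] (σ : Λ₁.Disc ≃+ Λ₂.Disc)
    (ρ₂ r : Λ₂.shadow) : ∃ x y, σ (Λ₁.toDisc x) = Λ₂.toDisc y ∧ r = y +ᵥ ρ₂ := by
  obtain ⟨d, hd⟩ := σ.surjective (Λ₂.toDisc (r -ᵥ ρ₂))
  exact ⟨d.out, r -ᵥ ρ₂, by rw [toDisc_out, hd], (vsub_vadd _ _).symm⟩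

theorem classSum_eq_mul_classSum [Module.Free ℤ L₁] [Module.Finite ℤ L₁] [Module.Free ℤ L₂]
    [Module.Finite ℤ L₂] {f₁ : Λ₁.shadow → ℂ} {f₂ : Λ₂.shadow → ℂ} (hf₁ : IsPeriodic f₁)
    (hf₂ : IsPeriodic f₂) {t : ℂ} (h : ∀ x y, σ (Λ₁.toDisc x) = Λ₂.toDisc y →
      f₂ (y +ᵥ ρ₂) = t * f₁ (x +ᵥ ρ₁)) : classSum f₂ = t * classSum f₁ := by
  rw [hf₁.classSum_eq ρ₁, hf₂.classSum_eq ρ₂, ← Equiv.sum_comp σ.toEquiv, Finset.mul_sum]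
  exact Finset.sum_congr rfl fun d _ => h _ _ (by rw [toDisc_out, toDisc_out]; rfl)

namespace ShadowCompat

theorem symm (h : ShadowCompat σ ρ₁ ρ₂) : ShadowCompat σ.symm ρ₂ ρ₁ := fun d => by
  rw [← h, σ.apply_symm_apply]

theorem discForm_eq (h : ShadowCompat σ ρ₁ ρ₂) (d d' : Λ₁.Disc) :
    Λ₂.discForm (σ d) (σ d') = Λ₁.discForm d d' := by
  have hadd := h (d + d')
  rwa [map_add, shadowQuad_add, shadowQuad_add, h, h, add_right_inj] at hadd

variable {x x' : Λ₁.dual} {y y' : Λ₂.dual}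

theorem exists_formQ_eq (h : ShadowCompat σ ρ₁ ρ₂) (hxy : σ (Λ₁.toDisc x) = Λ₂.toDisc y)
    (hxy' : σ (Λ₁.toDisc x') = Λ₂.toDisc y') :
    ∃ m : ℤ, Λ₂.formQ y y' = Λ₁.formQ x x' + m := by
  rw [← coe_addCircle_eq_iff, ← discForm_toDisc, ← discForm_toDisc, ← hxy, ← hxy', h.discForm_eq]

theorem exists_quadQ_eq (h : ShadowCompat σ ρ₁ ρ₂) (hxy : σ (Λ₁.toDisc x) = Λ₂.toDisc y) :
    ∃ m : ℤ, Λ₂.quadQ (y : ℚ ⊗[ℤ] L₂) + Λ₂.formQ y ρ₂ =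
      Λ₁.quadQ (x : ℚ ⊗[ℤ] L₁) + Λ₁.formQ x ρ₁ + m := by
  rw [← coe_addCircle_eq_iff, ← shadowQuad_toDisc, ← shadowQuad_toDisc, ← hxy, h]

theorem exists_e_quadQ_eq_intUnit_mul (h : ShadowCompat σ ρ₁ ρ₂)
    (hxy : σ (Λ₁.toDisc x) = Λ₂.toDisc y) : ∃ u : ℤˣ,
      e (Λ₂.quadQ (y : ℚ ⊗[ℤ] L₂)) = ((u : ℤ) : ℂ) * e (Λ₁.quadQ (x : ℚ ⊗[ℤ] L₁)) := by
  obtain ⟨m, hm⟩ := h.exists_formQ_eq hxy hxy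
  have hquad : Λ₂.quadQ (y : ℚ ⊗[ℤ] L₂) = m / 2 + Λ₁.quadQ (x : ℚ ⊗[ℤ] L₁) := by
    rw [quadQ, hm, quadQ]
    ring
  have hsq : e (m / 2) * e (m / 2) = 1 := by rw [← e_add, add_halves, e_int]
  rw [hquad]
  push_cast
  rw [e_add]
  rcases mul_self_eq_one_iff.1 hsq with hu | hu
  · exact ⟨1, by rw [hu, Units.val_one, Int.cast_one]⟩
  · exact ⟨-1, by rw [hu, Units.val_neg, Units.val_one, Int.cast_neg, Int.cast_one]⟩

end ShadowCompat

/-- The quotient of the values of `e(β(r))` at corresponding elements `r` of the shadows. -/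
def shadowRatio (ρ₁ : Λ₁.shadow) (ρ₂ : Λ₂.shadow) : ℂ :=
  e (Λ₂.quadQ (ρ₂ : ℚ ⊗[ℤ] L₂) - Λ₁.quadQ (ρ₁ : ℚ ⊗[ℤ] L₁))

theorem shadowRatio_ne_zero : shadowRatio ρ₁ ρ₂ ≠ 0 := e_ne_zero _

theorem norm_shadowRatio : ‖shadowRatio ρ₁ ρ₂‖ = 1 := by
  rw [shadowRatio, ← Rat.cast_sub, norm_e_ratCast]

namespace ShadowCompat

theorem e_quadQ_vadd {x : Λ₁.dual} {y : Λ₂.dual} (h : ShadowCompat σ ρ₁ ρ₂)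
    (hxy : σ (Λ₁.toDisc x) = Λ₂.toDisc y) : e (Λ₂.quadQ (y +ᵥ ρ₂ : Λ₂.shadow)) =
      shadowRatio ρ₁ ρ₂ * e (Λ₁.quadQ (x +ᵥ ρ₁ : Λ₁.shadow)) := by
  obtain ⟨m, hm⟩ := h.exists_quadQ_eq hxy
  rw [shadowRatio, ← e_add, ← Rat.cast_sub, ← Rat.cast_add, coe_vadd, coe_vadd, quadQ_add,
    quadQ_add]
  exact e_ratCast_congr m (by linear_combination hm)

/- Modulo `ℤ`, `β(x') - β(x) - β(x' + ρ, x + ρ) + 2β(ρ)` is a combination of `β(x' + ρ) - β(ρ)`,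
`β(x + ρ) - β(ρ)` and values of the bilinear form at elements of the dual. -/
theorem e_neg_formQ_vadd {x x' : Λ₁.dual} {y y' : Λ₂.dual} (h : ShadowCompat σ ρ₁ ρ₂)
    (hxy : σ (Λ₁.toDisc x) = Λ₂.toDisc y) (hxy' : σ (Λ₁.toDisc x') = Λ₂.toDisc y') :
    shadowRatio ρ₁ ρ₂ ^ 2 * (e (Λ₂.quadQ y') / e (Λ₂.quadQ y)) *
        e (-Λ₂.formQ (y' +ᵥ ρ₂ : Λ₂.shadow) (y +ᵥ ρ₂ : Λ₂.shadow)) =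
      e (Λ₁.quadQ x') / e (Λ₁.quadQ x) *
        e (-Λ₁.formQ (x' +ᵥ ρ₁ : Λ₁.shadow) (x +ᵥ ρ₁ : Λ₁.shadow)) := by
  obtain ⟨m, hm⟩ := h.exists_quadQ_eq hxy
  obtain ⟨m', hm'⟩ := h.exists_quadQ_eq hxy'
  obtain ⟨j, hj⟩ := h.exists_formQ_eq hxy' hxy
  obtain ⟨j', hj'⟩ := h.exists_formQ_eq hxy' hxy'
  rw [pow_two, shadowRatio]
  simp only [← e_sub, ← e_add, ← Rat.cast_add, ← Rat.cast_sub, ← Rat.cast_neg]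
  refine e_ratCast_congr (j' - j - m - m') ?_
  simp only [coe_vadd, map_add, LinearMap.add_apply, quadQ, Λ₁.formQ_symm ρ₁ x,
    Λ₂.formQ_symm ρ₂ y] at hm hm' ⊢
  push_cast
  linear_combination hj' - hj - hm - hm'

variable [Module.Free ℤ L₁] [Module.Finite ℤ L₁] [Module.Free ℤ L₂] [Module.Finite ℤ L₂]

theorem gaussSum_eq (h : ShadowCompat σ ρ₁ ρ₂) :
    Λ₂.gaussSum = shadowRatio ρ₁ ρ₂ * Λ₁.gaussSum :=
  classSum_eq_mul_classSum Λ₁.isPeriodic_e_quadQ Λ₂.isPeriodic_e_quadQ fun _ _ => h.e_quadQ_vadd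

theorem inversionConst_eq (h : ShadowCompat σ ρ₁ ρ₂) :
    Λ₁.inversionConst = Λ₂.inversionConst := by
  have h₁ := Λ₁.inversionConst_mul_norm_gaussSum
  have h₂ := Λ₂.inversionConst_mul_norm_gaussSum
  rw [h.gaussSum_eq, norm_mul, norm_shadowRatio, one_mul, ← h₁] at h₂
  refine (mul_right_cancel₀ (fun hzero => ?_) h₂).symm
  rw [hzero, mul_zero] at h₁
  exact zero_ne_one h₁

theorem shadowRatio_mul_e_pow (h : ShadowCompat σ ρ₁ ρ₂) :
    shadowRatio ρ₁ ρ₂ * e (1 / 8) ^ Module.finrank ℤ L₁ = e (1 / 8) ^ Module.finrank ℤ L₂ := by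
  rw [← Λ₁.inversionConst_mul_gaussSum, ← Λ₂.inversionConst_mul_gaussSum, h.gaussSum_eq,
    h.inversionConst_eq]
  ring

theorem expo_eq {x : Λ₁.dual} {y : Λ₂.dual} (h : ShadowCompat σ ρ₁ ρ₂)
    (hxy : σ (Λ₁.toDisc x) = Λ₂.toDisc y) (k : ℤ) :
    expo (k + 3 * Module.finrank ℤ L₂) (y +ᵥ ρ₂) =
      expo (k + 3 * Module.finrank ℤ L₁) (x +ᵥ ρ₁) := by
  have hpow (n : ℕ) : e (1 / 24) ^ (k + 3 * n) = e (1 / 24) ^ k * e (1 / 8) ^ n := by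
    have he : e (1 / 24) ^ (3 : ℤ) = e (1 / 8) := by
      rw [← e_int_mul]
      norm_num
    rw [zpow_add₀ (e_ne_zero _), zpow_mul, he, zpow_natCast]
  refine expo_eq_of_mul_e_quadQ ?_
  rw [hpow, hpow, h.e_quadQ_vadd hxy, ← h.shadowRatio_mul_e_pow]
  ring

end ShadowCompat

variable [Module.Free ℤ L₁] [Module.Finite ℤ L₁] [Module.Free ℤ L₂] [Module.Finite ℤ L₂]

/-- The isomorphism of the spaces `W` over `σ` and `ρ₁ ↦ ρ₂`: both spaces are identified with
functions on the discriminant groups. -/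
def transport (σ : Λ₁.Disc ≃+ Λ₂.Disc) (ρ₁ : Λ₁.shadow) (ρ₂ : Λ₂.shadow) : Λ₁.W ≃ₗ[ℂ] Λ₂.W :=
  (coeffEquiv ρ₁).symm ≪≫ₗ LinearEquiv.funCongrLeft ℂ ℂ σ.symm.toEquiv ≪≫ₗ coeffEquiv ρ₂

theorem transport_apply_vadd {x : Λ₁.dual} {y : Λ₂.dual} (hxy : σ (Λ₁.toDisc x) = Λ₂.toDisc y)
    (a : Λ₁.W) : (transport σ ρ₁ ρ₂ a).1 (y +ᵥ ρ₂) =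
      e (Λ₂.quadQ (y : ℚ ⊗[ℤ] L₂)) / e (Λ₁.quadQ (x : ℚ ⊗[ℤ] L₁)) * a.1 (x +ᵥ ρ₁) := by
  obtain ⟨b, rfl⟩ := (coeffEquiv ρ₁).surjective a
  have hx := e_ne_zero (Λ₁.quadQ (x : ℚ ⊗[ℤ] L₁))
  change (coeffEquiv ρ₂ fun d => (coeffEquiv ρ₁).symm (coeffEquiv ρ₁ b) (σ.symm d)).1 _ = _
  rw [LinearEquiv.symm_apply_apply, coeffEquiv_vadd, coeffEquiv_vadd, ← hxy, σ.symm_apply_apply]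
  field_simp

/- The shift of the weight by `n / 2` and of the character by `ε^{3n}` contributes the factor
`e(n/8)^2`, which is the only trace of the rank. -/
theorem inversion_shift_iff {V : Type*} [AddCommGroup V] [Module ℂ V] {c ω w : ℂ} (hω : ω ≠ 0)
    (hw : w ≠ 0) {n : ℕ} {κ k : ℤ} {u v : V} :
    (c * w ^ n * (ω * w) ^ (-(κ + n))) • u = ω⁻¹ ^ (k + 3 * n) • v ↔
      ((ω ^ n) ^ 2 * (c * (ω * w) ^ (-κ))) • u = ω⁻¹ ^ k • v := by
  have hωn := pow_ne_zero n hω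
  have hwn := pow_ne_zero n hw
  have hleft : c * w ^ n * (ω * w) ^ (-(κ + n)) =
      ((ω ^ n) ^ 3)⁻¹ * ((ω ^ n) ^ 2 * (c * (ω * w) ^ (-κ))) := by
    rw [neg_add, zpow_add₀ (mul_ne_zero hω hw), zpow_neg _ (n : ℤ), zpow_natCast, mul_pow]
    field_simp
  have hright : ω⁻¹ ^ (k + 3 * n) = ((ω ^ n) ^ 3)⁻¹ * ω⁻¹ ^ k := by
    rw [zpow_add₀ (inv_ne_zero hω), ← pow_mul, mul_comm n, ← inv_pow, mul_comm]
    norm_cast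
  rw [hleft, hright, mul_smul _ _ u, mul_smul _ _ v,
    smul_right_inj (inv_ne_zero (pow_ne_zero 3 hωn))]

namespace ShadowCompat

theorem liesOver_transport (h : ShadowCompat σ ρ₁ ρ₂) : LiesOver σ (transport σ ρ₁ ρ₂) := by
  let y (r : Λ₁.shadow) : Λ₂.dual := (σ (Λ₁.toDisc (r -ᵥ ρ₁))).out
  have hy (r : Λ₁.shadow) : σ (Λ₁.toDisc (r -ᵥ ρ₁)) = Λ₂.toDisc (y r) := (toDisc_out _ _).symm
  choose u hu using fun r => h.exists_e_quadQ_eq_intUnit_mul (hy r)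
  refine ⟨fun r => y r +ᵥ ρ₂, u, fun r r' x hr => ⟨y r' - y r, ?_, ?_⟩, fun a r => ?_⟩
  · change (y r' + ρ₂ : ℚ ⊗[ℤ] L₂) = y r + ρ₂ + (y r' - y r : Λ₂.dual)
    rw [AddSubgroup.coe_sub]
    abel
  · have hx : r' = x +ᵥ r := Subtype.ext (hr.trans (add_comm _ _))
    rw [map_sub, ← hy, ← hy, ← map_sub, ← map_sub, vsub_sub_vsub_cancel_right, hx, vadd_vsub]
  · rw [transport_apply_vadd (hy r), hu, mul_div_cancel_right₀ _ (e_ne_zero _), vsub_vadd]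

theorem weilS_transport (h : ShadowCompat σ ρ₁ ρ₂) (a : Λ₁.W) :
    Λ₂.weilS (transport σ ρ₁ ρ₂ a) =
      (shadowRatio ρ₁ ρ₂ ^ 2)⁻¹ • transport σ ρ₁ ρ₂ (Λ₁.weilS a) := by
  ext s
  obtain ⟨x, y, hxy, rfl⟩ := exists_eq_vadd σ ρ₂ s
  change _ = (shadowRatio ρ₁ ρ₂ ^ 2)⁻¹ * (transport σ ρ₁ ρ₂ (Λ₁.weilS a)).1 _
  rw [transport_apply_vadd hxy, weilS_apply, weilS_apply, ← mul_assoc]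
  refine classSum_eq_mul_classSum (σ := σ) (ρ₁ := ρ₁) (ρ₂ := ρ₂)
    (isPeriodic_mul_e_neg_formQ a _) (isPeriodic_mul_e_neg_formQ _ _) fun x' y' hxy' => ?_
  have hkernel := h.e_neg_formQ_vadd hxy hxy'
  have hζ := shadowRatio_ne_zero (ρ₁ := ρ₁) (ρ₂ := ρ₂)
  have he := e_ne_zero
  rw [transport_apply_vadd hxy']
  field_simp [he] at hkernel ⊢
  linear_combination a.1 (x' +ᵥ ρ₁) * hkernel

theorem hasExpansion_transport (h : ShadowCompat σ ρ₁ ρ₂) {k : ℤ} {a : ℕ → Λ₁.W} {F : ℍ → Λ₁.W}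
    (hF : HasExpansion (k + 3 * Module.finrank ℤ L₁) a F) :
    HasExpansion (k + 3 * Module.finrank ℤ L₂) (fun m => transport σ ρ₁ ρ₂ (a m))
      fun τ => transport σ ρ₁ ρ₂ (F τ) := by
  intro τ r
  obtain ⟨x, y, hxy, rfl⟩ := exists_eq_vadd σ ρ₂ r
  simpa only [h.expo_eq hxy, transport_apply_vadd hxy, mul_assoc] using
    (hF τ (x +ᵥ ρ₁)).mul_left _

theorem inversion_transport (h : ShadowCompat σ ρ₁ ρ₂) {κ k : ℤ} {τ : ℍ} {a b : Λ₁.W}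
    (hab : (Λ₁.inversionConst * rootS τ ^ Module.finrank ℤ L₁ *
        (e (1 / 8) * rootS τ) ^ (-(κ + Module.finrank ℤ L₁))) • Λ₁.weilS a =
      (e (1 / 8))⁻¹ ^ (k + 3 * Module.finrank ℤ L₁) • b) :
    (Λ₂.inversionConst * rootS τ ^ Module.finrank ℤ L₂ *
        (e (1 / 8) * rootS τ) ^ (-(κ + Module.finrank ℤ L₂))) • Λ₂.weilS (transport σ ρ₁ ρ₂ a) =
      (e (1 / 8))⁻¹ ^ (k + 3 * Module.finrank ℤ L₂) • transport σ ρ₁ ρ₂ b := by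
  have hw := rootS_ne_zero τ
  rw [inversion_shift_iff (V := Λ₁.W) (e_ne_zero _) hw] at hab
  rw [inversion_shift_iff (V := Λ₂.W) (e_ne_zero _) hw]
  rw [← map_smul (transport σ ρ₁ ρ₂), ← hab, map_smul, h.weilS_transport, smul_smul,
    ← h.shadowRatio_mul_e_pow, h.inversionConst_eq]
  congr 1
  have hζ := shadowRatio_ne_zero (ρ₁ := ρ₁) (ρ₂ := ρ₂)
  field_simp

theorem isThetaVector (h : ShadowCompat σ ρ₁ ρ₂) {κ k : ℤ} {F : ℍ → Λ₁.W}
    (hF : Λ₁.IsThetaVector (κ + Module.finrank ℤ L₁) (k + 3 * Module.finrank ℤ L₁) F) :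
    Λ₂.IsThetaVector (κ + Module.finrank ℤ L₂) (k + 3 * Module.finrank ℤ L₂)
      fun τ => transport σ ρ₁ ρ₂ (F τ) := by
  obtain ⟨a, ha⟩ := hF.expansion
  refine ⟨⟨_, h.hasExpansion_transport ha⟩, fun τ => h.inversion_transport (hF.inversion τ), ?_⟩
  refine hF.parity.imp (fun hzero => ?_) fun heven => ?_
  · funext τ
    rw [hzero]
    exact map_zero _
  · obtain ⟨j, hj⟩ := heven
    exact ⟨j + Module.finrank ℤ L₁ - Module.finrank ℤ L₂, by linarith⟩

theorem map_comap_thetaLift (h : ShadowCompat σ ρ₁ ρ₂) (κ k : ℤ) :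
    ((JacobiForms (κ + Module.finrank ℤ L₁) Λ₁ (k + 3 * Module.finrank ℤ L₁)).comap
        Λ₁.thetaLift).map (LinearEquiv.piCongrRight fun _ : ℍ => transport σ ρ₁ ρ₂).toLinearMap =
      (JacobiForms (κ + Module.finrank ℤ L₂) Λ₂ (k + 3 * Module.finrank ℤ L₂)).comap
        Λ₂.thetaLift := by
  ext F
  rw [Submodule.mem_map_equiv, Submodule.mem_comap, Submodule.mem_comap,
    thetaLift_mem_jacobiForms_iff, thetaLift_mem_jacobiForms_iff]
  refine ⟨fun hF => ?_, h.symm.isThetaVector⟩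
  have hT := h.isThetaVector hF
  simpa only [LinearEquiv.piCongrRight_symm, LinearEquiv.piCongrRight_apply,
    LinearEquiv.apply_symm_apply] using hT

/-- The isomorphism of spaces of Jacobi forms that applies `transport` to the coefficients of theta
expansions. -/
def jacobiTransport (h : ShadowCompat σ ρ₁ ρ₂) (κ k : ℤ) :
    JacobiForms (κ + Module.finrank ℤ L₁) Λ₁ (k + 3 * Module.finrank ℤ L₁) ≃ₗ[ℂ]
      JacobiForms (κ + Module.finrank ℤ L₂) Λ₂ (k + 3 * Module.finrank ℤ L₂) :=
  (Λ₁.thetaVectorEquiv _ _).symm ≪≫ₗ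
    LinearEquiv.ofSubmodules _ _ _ (h.map_comap_thetaLift κ k) ≪≫ₗ Λ₂.thetaVectorEquiv _ _

theorem inducedByTheta_jacobiTransport (h : ShadowCompat σ ρ₁ ρ₂) (κ k : ℤ) :
    InducedByTheta (transport σ ρ₁ ρ₂) (h.jacobiTransport κ k) := by
  intro φ
  obtain ⟨F, rfl⟩ := (Λ₁.thetaVectorEquiv _ _).surjective φ
  have hΦ : (h.jacobiTransport κ k (Λ₁.thetaVectorEquiv _ _ F)).1 =
      Λ₂.thetaLift fun τ => transport σ ρ₁ ρ₂ (F.1 τ) := by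
    rw [jacobiTransport, LinearEquiv.trans_apply, LinearEquiv.trans_apply,
      LinearEquiv.symm_apply_apply]
    rfl
  constructor
  · obtain ⟨a, ha⟩ := (thetaLift_mem_jacobiForms_iff.1 F.2).expansion
    exact ha.exists_isThetaExpansion
  · intro m f a ha τ z
    have hF : F.1 τ = ∑ i, f i τ • a i := Λ₁.theta_injective τ <| funext fun z => by
      change thetaEval τ z (F.1 τ) = thetaEval τ z (∑ i, f i τ • a i)
      simp only [map_sum, map_smul]
      exact ha τ z
    rw [hΦ]
    change thetaEval τ z (transport σ ρ₁ ρ₂ (F.1 τ)) = _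
    simp only [hF, map_sum, map_smul, smul_eq_mul, thetaEval_apply]

end ShadowCompat

end JacobiLattice

end

open JacobiLattice in
theorem theorem2p7 {L₁ L₂ : Type*} [AddCommGroup L₁] [Module.Free ℤ L₁] [Module.Finite ℤ L₁]
    [AddCommGroup L₂] [Module.Free ℤ L₂] [Module.Finite ℤ L₂]
    (Λ₁ : PosDefLattice L₁) (Λ₂ : PosDefLattice L₂) (n₁ n₂ : ℕ)
    (hn₁ : Module.finrank ℤ L₁ = n₁) (hn₂ : Module.finrank ℤ L₂ = n₂)
    (σ : Λ₁.Disc ≃+ Λ₂.Disc)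
    (hσ : ∀ x y, Λ₂.discForm (σ x) (σ y) = Λ₁.discForm x y) :
    ∃ T : Λ₁.W ≃ₗ[ℂ] Λ₂.W, LiesOver σ T ∧
      ∀ κ h : ℤ, ∃ Φ : JacobiForms (κ + n₁) Λ₁ (h + 3 * n₁) ≃ₗ[ℂ]
        JacobiForms (κ + n₂) Λ₂ (h + 3 * n₂), InducedByTheta T Φ := by
  subst hn₁ hn₂
  let ρ₁ : Λ₁.shadow := Classical.arbitrary _
  obtain ⟨ρ₂, hρ⟩ := exists_shadowCompat hσ ρ₁
  exact ⟨transport σ ρ₁ ρ₂, hρ.liesOver_transport, fun κ h =>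
    ⟨hρ.jacobiTransport κ h, hρ.inducedByTheta_jacobiTransport κ h⟩⟩
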